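/- **Theorem (noncommutative PBW theorem).** Let $\mathbb K$ be a field of characteristic zero and $(X,\mathcal O_X)$ a locally ringed space whose structure sheaf is a sheaf of $\mathbb K$-algebras. Let $\mathcal L$ be a Lie algebroid over $X$, that is, a sheaf of $\mathcal O_X$-modules such that $(\mathcal O_X(U),\mathcal L(U))$ is a Lie–Rinehart algebra over $\mathbb K$ for every open $U$, compatibly with restriction. Assume that $\mathcal L$ is locally free of constant finite rank $r$, and let $\nabla$ be an $\mathcal L$-connection on $\mathcal L$ (a morphism of sheaves $Y\mapsto (Z\mapsto\nabla_Z Y)$, $\mathbb K$-linear in $Y$, $\mathcal O_X$-linear in $Z$, with $\nabla_Z(fY)=f\nabla_ZY+Z(f)Y$). *Notation.* $\mathcal U(\mathcal L)$ is the sheaf of universal enveloping algebras, a sheaf of cocommutative $\mathcal O_X$-coalgebras with $\Delta(f)=f\otimes 1$, $\Delta(Y)=Y\otimes1+1\otimes Y$, $\epsilon(D)=D(1)$ ($f\in\mathcal O_X$, $Y\in\mathcal L$). $\mathcal J(\mathcal L)=\mathcal Hom_{\mathcal O_X}(\mathcal U(\mathcal L),\mathcal O_X)$ (left multiplication) is the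 sheaf of jets, a sheaf of commutative algebras with $(\phi\psi)(D)=\phi(D_{(1)})\psi(D_{(2)})$. It has two algebra maps $\alpha_1,\alpha_2:\mathcal O_X\to\mathcal J(\mathcal L)$, $\alpha_1(f)(D)=f\epsilon(D)$, $\alpha_2(f)(D)=D(f)$, whose $\mathcal O_X$-module structures are written $\mathcal O_{X_1}$, $\mathcal O_{X_2}$, and $\mathcal U(\mathcal L)$ acts by $(D\cdot_2\phi)(E)=\phi(ED)$; in particular $\nabla^{(2)}_Y\phi=Y\cdot_2\phi$ for $Y\in\mathcal L$. The sheaf $\mathcal J(\mathcal L)\otimes_{\mathcal O_{X_2}}\mathcal U(\mathcal L)$ is a sheaf of $\mathbb K$-algebras with the product $$(\phi\otimes D)(\psi\otimes E)=\phi\,(D_{(1)}\cdot_2\psi)\otimes D_{(2)}E .$$ $\widehat{\mathrm{Sym}}(\mathcal L^\vee)$ is the sheaf of jets of $\mathcal L$ equipped with zero bracket and zero anchor, that is $\mathcal Hom_{\mathcal O_X}(\mathrm{Sym}\,\mathcal L,\mathcal O_X)$ with the convolution product. $\mathrm{Diff}_{\mathcal O_X}(\widehat{\mathrm{Sym}}(\mathcal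 L^\vee))$ is the sheaf of $\mathcal O_X$-linear differential operators, locally of finite order, on this sheaf of commutative algebras (order $<0$ means zero; order $<n+1$ means that all commutators with multiplications by sections have order $<n$). *Conclusions.* 1. Every point of every open $U\subseteq X$ has an open neighbourhood $V\subseteq U$ for which the canonical map $\mathrm{Sym}_{\mathcal O_X(V)}(\mathcal L^\vee(V))\to\widehat{\mathrm{Sym}}(\mathcal L^\vee)(V)$ (the extension of $\xi\mapsto(\xi$ on $\mathcal L$, zero on $\mathrm{Sym}^n\mathcal L$ for $n\ne1)$) extends to a ring isomorphism from the completion of the symmetric algebra with respect to the degree (the adic completion at the ideal generated by $\mathcal L^\vee(V)$). 2. There is an isomorphism of sheaves of $\mathbb K$-algebras $j_\nabla:\mathcal J(\mathcal L)\to\widehat{\mathrm{Sym}}(\mathcal L^\vee)$ given by $$j_\nabla(\phi)=\sum_{n\ge0}\frac1{n!}\,(D^n(\phi\otimes1))(1).$$ Here $D$ is the symmetrization of the connection $\nabla^{(2)}\otimes1+1\otimes\nabla$ on $\mathcal J(\mathcal L)\otimes_{\mathcal O_{X_2}}\widehat{\mathrm{Sym}}(\mathcal L^\vee)$ (understood as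 $\mathcal O_X$-linear maps $\Phi:\mathrm{Sym}\,\mathcal L\to\mathcal J(\mathcal L)$, for the module structure $\mathcal O_{X_2}$), i.e. $$(D\Phi)(Y_1\cdots Y_n)=\sum_i\bigl(Y_i\cdot_2\Phi(Y_1\cdots\widehat{Y_i}\cdots Y_n)-\Phi(\nabla_{Y_i}(Y_1\cdots\widehat{Y_i}\cdots Y_n))\bigr),$$ where $\nabla_Y$ is extended to $\mathrm{Sym}\,\mathcal L$ by the Leibniz rule. It satisfies $j_\nabla(\alpha_1(f))=f$, so it is $\mathcal O_{X_1}$-linear. 3. The connection induces an isomorphism of sheaves of $\mathbb K$-algebras $$\tilde j_\nabla:\mathcal J(\mathcal L)\otimes_{\mathcal O_{X_2}}\mathcal U(\mathcal L)\xrightarrow{\ \cong\ }\mathrm{Diff}_{\mathcal O_X}\bigl(\widehat{\mathrm{Sym}}(\mathcal L^\vee)\bigr),\qquad \tilde j_\nabla(\phi\otimes D)\bigl(j_\nabla(\psi)\bigr)=j_\nabla\bigl(\phi\,(D\cdot_2\psi)\bigr).$$ 4. The target is a sheaf of (partially completed) Weyl algebras: with $\mathcal W(\mathcal L)=\widehat{\mathrm{Sym}}(\mathcal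 L^\vee)\otimes_{\mathcal O_X}\mathrm{Sym}(\mathcal L)$ with the product $(\alpha\otimes P)(\beta\otimes Q)=\alpha\,(P_{(1)}\cdot\beta)\otimes P_{(2)}Q$, where $Y\in\mathcal L$ acts on $\widehat{\mathrm{Sym}}(\mathcal L^\vee)$ by contraction, there is a canonical isomorphism of sheaves of $\mathbb K$-algebras $\mathcal W(\mathcal L)\cong\mathrm{Diff}_{\mathcal O_X}(\widehat{\mathrm{Sym}}(\mathcal L^\vee))$, $(\alpha\otimes P)(\beta)=\alpha\,(P\cdot\beta)$. In $\mathcal W(\mathcal L)$ the sections of $\mathcal L^\vee$ commute with each other, so do those of $\mathcal L$, and $[Y,\xi]=\xi(Y)$ for $Y\in\mathcal L$, $\xi\in\mathcal L^\vee$. -/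

import Mathlib

universe u

set_option linter.unusedSectionVars false
set_option linter.unusedVariables false

open scoped TensorProduct

namespace LieRinehart

section Enveloping

variable (K R L : Type*) [CommRing K] [CommRing R] [Algebra K R] [LieRing L]
  [Module R L] [LieRingModule L R]

/-- Defining relations of the universal enveloping algebra of a Lie-Rinehart algebra `(R, L)`,
on the free `K`-algebra with generators the elements of `R` and of `L`. -/
inductive EnvRel : FreeAlgebra K (R ⊕ L) → FreeAlgebra K (R ⊕ L) → Prop
  | algebraMap (c : K) :
      EnvRel (FreeAlgebra.ι K (Sum.inl (algebraMap K R c))) (algebraMap K _ c)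
  | add_left (r s : R) :
      EnvRel (FreeAlgebra.ι K (Sum.inl (r + s)))
        (FreeAlgebra.ι K (Sum.inl r) + FreeAlgebra.ι K (Sum.inl s))
  | mul_left (r s : R) :
      EnvRel (FreeAlgebra.ι K (Sum.inl (r * s)))
        (FreeAlgebra.ι K (Sum.inl r) * FreeAlgebra.ι K (Sum.inl s))
  | add_right (X Y : L) :
      EnvRel (FreeAlgebra.ι K (Sum.inr (X + Y)))
        (FreeAlgebra.ι K (Sum.inr X) + FreeAlgebra.ι K (Sum.inr Y))
  | smul (r : R) (X : L) :
      EnvRel (FreeAlgebra.ι K (Sum.inl r) * FreeAlgebra.ι K (Sum.inr X))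
        (FreeAlgebra.ι K (Sum.inr (r • X)))
  | anchor (X : L) (r : R) :
      EnvRel (FreeAlgebra.ι K (Sum.inr X) * FreeAlgebra.ι K (Sum.inl r))
        (FreeAlgebra.ι K (Sum.inl r) * FreeAlgebra.ι K (Sum.inr X) +
          FreeAlgebra.ι K (Sum.inl ⁅X, r⁆))
  | bracket (X Y : L) :
      EnvRel (FreeAlgebra.ι K (Sum.inr X) * FreeAlgebra.ι K (Sum.inr Y))
        (FreeAlgebra.ι K (Sum.inr Y) * FreeAlgebra.ι K (Sum.inr X) +
          FreeAlgebra.ι K (Sum.inr ⁅X, Y⁆))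

/-- The universal enveloping algebra `U(L, R)` of a Lie-Rinehart algebra `(R, L)`: the unital
`K`-algebra generated by the `K`-algebra `R` and the Lie algebra `L` subject to `r · X = rX` and
`X · r - r · X = X(r)`. -/
def Env : Type _ := RingQuot (EnvRel K R L)

namespace Env

noncomputable instance : Ring (Env K R L) := inferInstanceAs (Ring (RingQuot (EnvRel K R L)))

noncomputable instance : Algebra K (Env K R L) :=
  inferInstanceAs (Algebra K (RingQuot (EnvRel K R L)))

noncomputable def mk : FreeAlgebra K (R ⊕ L) →ₐ[K] Env K R L := RingQuot.mkAlgHom K (EnvRel K R L)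

variable {K R L}

theorem mk_rel {a b : FreeAlgebra K (R ⊕ L)} (h : EnvRel K R L a b) :
    mk K R L a = mk K R L b := RingQuot.mkAlgHom_rel K h

theorem mk_surjective : Function.Surjective (mk K R L) := RingQuot.mkAlgHom_surjective K _

variable (K R L)

/-- The structure map `R → U(L, R)`. -/
noncomputable def ofR : R →ₐ[K] Env K R L where
  toFun r := mk K R L (FreeAlgebra.ι K (Sum.inl r))
  map_one' := by
    have := mk_rel (EnvRel.algebraMap (K := K) (R := R) (L := L) 1)
    simpa using this
  map_mul' r s := by simpa using mk_rel (EnvRel.mul_left (K := K) (L := L) r s)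
  map_zero' := by
    have := mk_rel (EnvRel.algebraMap (K := K) (R := R) (L := L) 0)
    simpa using this
  map_add' r s := by simpa using mk_rel (EnvRel.add_left (K := K) (L := L) r s)
  commutes' c := by
    have := mk_rel (EnvRel.algebraMap (K := K) (R := R) (L := L) c)
    simpa using this

/-- The structure map `L → U(L, R)`. -/
noncomputable def ofL : L →+ Env K R L :=
  AddMonoidHom.mk' (fun X => mk K R L (FreeAlgebra.ι K (Sum.inr X)))
    (fun X Y => by simpa using mk_rel (EnvRel.add_right (K := K) (R := R) X Y))

variable {K R L}

theorem ofR_mul_ofL (r : R) (X : L) : ofR K R L r * ofL K R L X = ofL K R L (r • X) := by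
  exact (map_mul (mk K R L) _ _).symm.trans (mk_rel (EnvRel.smul (K := K) r X))

theorem ofL_mul_ofR (X : L) (r : R) :
    ofL K R L X * ofR K R L r = ofR K R L r * ofL K R L X + ofR K R L ⁅X, r⁆ := by
  have := mk_rel (EnvRel.anchor (K := K) X r)
  rw [map_mul, map_add, map_mul] at this
  exact this

theorem ofL_mul_ofL (X Y : L) :
    ofL K R L X * ofL K R L Y = ofL K R L Y * ofL K R L X + ofL K R L ⁅X, Y⁆ := by
  have := mk_rel (EnvRel.bracket (K := K) (R := R) X Y)
  rw [map_mul, map_add, map_mul] at this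
  exact this

theorem induction {p : Env K R L → Prop} (hR : ∀ r, p (ofR K R L r)) (hL : ∀ X, p (ofL K R L X))
    (hadd : ∀ a b, p a → p b → p (a + b)) (hmul : ∀ a b, p a → p b → p (a * b))
    (D : Env K R L) : p D := by
  obtain ⟨a, rfl⟩ := mk_surjective D
  induction a using FreeAlgebra.induction with
  | grade0 c => rw [AlgHom.commutes, ← AlgHom.commutes (ofR K R L)]; exact hR _
  | grade1 x =>
    rcases x with r | X
    · exact hR r
    · exact hL X
  | mul a b ha hb => rw [map_mul]; exact hmul _ _ ha hb
  | add a b ha hb => rw [map_add]; exact hadd _ _ ha hb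

/-- The universal property of `U(L, R)`. -/
noncomputable def lift {A : Type*} [Ring A] [Algebra K A] (f : R →ₐ[K] A) (g : L →+ A)
    (h₁ : ∀ r X, f r * g X = g (r • X)) (h₂ : ∀ X r, g X * f r = f r * g X + f ⁅X, r⁆)
    (h₃ : ∀ X Y, g X * g Y = g Y * g X + g ⁅X, Y⁆) : Env K R L →ₐ[K] A :=
  RingQuot.liftAlgHom K ⟨FreeAlgebra.lift K (Sum.elim f g), fun x y h => by
    cases h with
    | bracket X Y => simpa using h₃ X Y
    | anchor X r => simpa using h₂ X r
    | smul r X => simpa using h₁ r X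
    | algebraMap c => simp
    | add_left r s => simp
    | mul_left r s => simp
    | add_right X Y => simp⟩

section
variable {A : Type*} [Ring A] [Algebra K A] (f : R →ₐ[K] A) (g : L →+ A)
    (h₁ : ∀ r X, f r * g X = g (r • X)) (h₂ : ∀ X r, g X * f r = f r * g X + f ⁅X, r⁆)
    (h₃ : ∀ X Y, g X * g Y = g Y * g X + g ⁅X, Y⁆)

@[simp] theorem lift_ofR (r : R) : lift f g h₁ h₂ h₃ (ofR K R L r) = f r := by
  have : lift f g h₁ h₂ h₃ (mk K R L (FreeAlgebra.ι K (Sum.inl r))) = f r :=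
    (RingQuot.liftAlgHom_mkAlgHom_apply K _ _ _).trans (by simp)
  exact this

@[simp] theorem lift_ofL (X : L) : lift f g h₁ h₂ h₃ (ofL K R L X) = g X := by
  have : lift f g h₁ h₂ h₃ (mk K R L (FreeAlgebra.ι K (Sum.inr X))) = g X :=
    (RingQuot.liftAlgHom_mkAlgHom_apply K _ _ _).trans (by simp)
  exact this

end

/-- `U(L, R)` is an `R`-module by left multiplication. -/
noncomputable instance : Module R (Env K R L) := Module.compHom _ (ofR K R L).toRingHom

theorem smul_def (r : R) (D : Env K R L) : r • D = ofR K R L r * D := rfl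

instance : IsScalarTower K R (Env K R L) where
  smul_assoc c r D := by rw [smul_def, smul_def, map_smul, smul_mul_assoc]

instance : IsScalarTower R (Env K R L) (Env K R L) where
  smul_assoc r D E := by simp only [smul_def, smul_eq_mul, mul_assoc]

end Env
end Enveloping

section Action

variable {K R L : Type*} [CommRing K] [CommRing R] [Algebra K R] [LieRing L]
  [Module R L] [LieRingModule L R]

section One

variable {M : Type*} [AddCommGroup M] [Module R M] [Module (Env K R L) M]
  [IsScalarTower R (Env K R L) M]

theorem Env.ofR_smul (r : R) (m : M) : Env.ofR K R L r • m = r • m := by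
  have := smul_assoc r (1 : Env K R L) m
  rwa [Env.smul_def, mul_one, one_smul] at this

theorem Env.ofL_smul_smul (X : L) (r : R) (m : M) :
    Env.ofL K R L X • (r • m) = r • (Env.ofL K R L X • m) + ⁅X, r⁆ • m := by
  rw [← Env.ofR_smul (K := K) (L := L) r m, smul_smul, Env.ofL_mul_ofR, add_smul, mul_smul,
    Env.ofR_smul, Env.ofR_smul]

theorem Env.smulK_smul [Module K M] [IsScalarTower K R M] (c : K) (D : Env K R L) (m : M) :
    (c • D) • m = c • (D • m) := by
  have : c • D = (algebraMap K R c) • D := (algebraMap_smul R c D).symm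
  rw [this, smul_assoc, algebraMap_smul]

theorem Env.smul_smulK [Module K M] [IsScalarTower K R M] (D : Env K R L) (c : K) (m : M) :
    D • (c • m) = c • (D • m) := by
  have h : c • m = (c • (1 : Env K R L)) • m := by rw [Env.smulK_smul, one_smul]
  rw [h, smul_smul, mul_smul_comm, mul_one, Env.smulK_smul]

end One

section Tensor

variable {M N : Type*} [AddCommGroup M] [Module K M] [Module R M] [Module (Env K R L) M]
  [IsScalarTower K R M] [IsScalarTower R (Env K R L) M]
  [AddCommGroup N] [Module K N] [Module R N] [Module (Env K R L) N]
  [IsScalarTower K R N] [IsScalarTower R (Env K R L) N]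

/-- The operator `X ⊗ 1 + 1 ⊗ X` on the tensor product over `R` of two `U(L, R)`-modules. -/
noncomputable def leibniz (X : L) : M ⊗[R] N →+ M ⊗[R] N :=
  TensorProduct.liftAddHom
    (AddMonoidHom.mk' (fun m => AddMonoidHom.mk'
        (fun n => (Env.ofL K R L X • m) ⊗ₜ[R] n + m ⊗ₜ[R] (Env.ofL K R L X • n))
        (fun n n' => by simp only [smul_add, TensorProduct.tmul_add]; abel))
      (fun m m' => by
        ext n
        simp only [smul_add, TensorProduct.add_tmul, AddMonoidHom.mk'_apply,
          AddMonoidHom.add_apply]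
        abel))
    (fun r m n => by
      simp only [AddMonoidHom.mk'_apply, Env.ofL_smul_smul, TensorProduct.add_tmul,
        TensorProduct.tmul_add, TensorProduct.smul_tmul', TensorProduct.tmul_smul]
      abel)

@[simp] theorem leibniz_tmul (X : L) (m : M) (n : N) :
    leibniz (K := K) (R := R) X (m ⊗ₜ[R] n) =
      (Env.ofL K R L X • m) ⊗ₜ[R] n + m ⊗ₜ[R] (Env.ofL K R L X • n) := rfl

/-- The action of `U(L, R)` on the tensor product over `R` of two `U(L, R)`-modules; an element
`X` of `L` acts as `X ⊗ 1 + 1 ⊗ X`. -/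
noncomputable def tensorAct : Env K R L →ₐ[K] Module.End K (M ⊗[R] N) :=
  Env.lift (Algebra.lsmul K K (M ⊗[R] N))
    (AddMonoidHom.mk' (fun X =>
        { leibniz (K := K) (R := R) (M := M) (N := N) X with
          map_smul' := fun c t => by
            induction t with
            | zero => simp
            | add x y hx hy => simp_all [smul_add]
            | tmul m n => simp [TensorProduct.smul_tmul', Env.smul_smulK] })
      (fun X Y => by
        ext t
        induction t with
        | zero => simp
        | add x y hx hy => simp_all; abel
        | tmul m n =>
          simp [TensorProduct.add_tmul, TensorProduct.tmul_add, add_smul]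
          abel))
    (fun r X => by
      ext t
      induction t with
      | zero => simp
      | add x y hx hy => simp_all
      | tmul m n =>
        simp [← Env.ofR_mul_ofL, mul_smul, Env.ofR_smul, TensorProduct.smul_tmul'])
    (fun X r => by
      ext t
      induction t with
      | zero => simp
      | add x y hx hy => simp_all; abel
      | tmul m n =>
        simp [Env.ofL_smul_smul, TensorProduct.smul_tmul', TensorProduct.add_tmul]
        abel)
    (fun X Y => by
      ext t
      induction t with
      | zero => simp
      | add x y hx hy => simp_all; abel
      | tmul m n =>
        have h : Env.ofL K R L ⁅X, Y⁆ = Env.ofL K R L X * Env.ofL K R L Y -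
          Env.ofL K R L Y * Env.ofL K R L X := by rw [Env.ofL_mul_ofL X Y]; abel
        simp [h, sub_smul, mul_smul, TensorProduct.sub_tmul, TensorProduct.tmul_sub]
        abel)

theorem tensorAct_ofR (r : R) (t : M ⊗[R] N) : tensorAct (Env.ofR K R L r) t = r • t := by
  simp [tensorAct]

theorem tensorAct_ofL (X : L) (m : M) (n : N) :
    tensorAct (Env.ofL K R L X) (m ⊗ₜ[R] n) =
      (Env.ofL K R L X • m) ⊗ₜ[R] n + m ⊗ₜ[R] (Env.ofL K R L X • n) := by
  simp [tensorAct]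

theorem tensorAct_smul (r : R) (D : Env K R L) (t : M ⊗[R] N) :
    tensorAct (r • D) t = r • tensorAct D t := by
  rw [Env.smul_def, map_mul, Module.End.mul_apply, tensorAct_ofR]

theorem tensorAct_map {M' N' : Type*} [AddCommGroup M'] [Module K M'] [Module R M']
    [Module (Env K R L) M'] [IsScalarTower K R M'] [IsScalarTower R (Env K R L) M']
    [AddCommGroup N'] [Module K N'] [Module R N'] [Module (Env K R L) N']
    [IsScalarTower K R N'] [IsScalarTower R (Env K R L) N']
    (f : M →ₗ[R] M') (g : N →ₗ[R] N')
    (hf : ∀ (X : L) m, f (Env.ofL K R L X • m) = Env.ofL K R L X • f m)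
    (hg : ∀ (X : L) n, g (Env.ofL K R L X • n) = Env.ofL K R L X • g n)
    (D : Env K R L) (t : M ⊗[R] N) :
    TensorProduct.map f g (tensorAct D t) = tensorAct D (TensorProduct.map f g t) := by
  induction D using Env.induction generalizing t with
  | hR r => simp [tensorAct_ofR]
  | hL X =>
    induction t with
    | zero => simp
    | add x y hx hy => simp_all
    | tmul m n => simp [tensorAct_ofL, hf, hg]
  | hadd a b ha hb => simp [ha, hb]
  | hmul a b ha hb => simp [ha, hb]

theorem tensorAct_tmul_left (m : M) (hm : ∀ X : L, Env.ofL K R L X • m = 0) (D : Env K R L)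
    (n : N) : tensorAct D (m ⊗ₜ[R] n) = m ⊗ₜ[R] (D • n) := by
  induction D using Env.induction generalizing n with
  | hR r => simp [tensorAct_ofR, Env.ofR_smul]
  | hL X => simp [tensorAct_ofL, hm]
  | hadd a b ha hb => simp [ha, hb, add_smul, TensorProduct.tmul_add]
  | hmul a b ha hb => simp [ha, hb, mul_smul]

theorem tensorAct_tmul_right (n : N) (hn : ∀ X : L, Env.ofL K R L X • n = 0) (D : Env K R L)
    (m : M) : tensorAct D (m ⊗ₜ[R] n) = (D • m) ⊗ₜ[R] n := by
  induction D using Env.induction generalizing m with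
  | hR r => simp [tensorAct_ofR, Env.ofR_smul, TensorProduct.smul_tmul']
  | hL X => simp [tensorAct_ofL, hn]
  | hadd a b ha hb => simp [ha, hb, add_smul, TensorProduct.add_tmul]
  | hmul a b ha hb => simp [ha, hb, mul_smul]

theorem comm_tensorAct (D : Env K R L) (t : M ⊗[R] N) :
    TensorProduct.comm R M N (tensorAct D t) = tensorAct D (TensorProduct.comm R M N t) := by
  induction D using Env.induction generalizing t with
  | hR r => simp [tensorAct_ofR]
  | hL X =>
    induction t with
    | zero => simp
    | add x y hx hy => simp_all
    | tmul m n => simp [tensorAct_ofL, add_comm]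
  | hadd a b ha hb => simp [ha, hb]
  | hmul a b ha hb => simp [ha, hb]

end Tensor

/-- The tensor product of two `U(L, R)`-modules as a `U(L, R)`-module. -/
@[reducible] noncomputable def tensorModule (M N : Type*) [AddCommGroup M] [Module K M] [Module R M]
    [Module (Env K R L) M] [IsScalarTower K R M] [IsScalarTower R (Env K R L) M]
    [AddCommGroup N] [Module K N] [Module R N] [Module (Env K R L) N]
    [IsScalarTower K R N] [IsScalarTower R (Env K R L) N] : Module (Env K R L) (M ⊗[R] N) :=
  Module.compHom _ (tensorAct (M := M) (N := N) (K := K) (R := R) (L := L)).toRingHom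

end Action

section Coalgebra

variable {K R L : Type*} [CommRing K] [CommRing R] [Algebra K R] [LieRing L]
  [Module R L] [LieRingModule L R]

/-- The comultiplication of `U(L, R)`, with `Δ(r) = r ⊗ 1` and `Δ(X) = X ⊗ 1 + 1 ⊗ X`. -/
noncomputable def comulEnv : Env K R L →ₗ[R] Env K R L ⊗[R] Env K R L where
  toFun D := tensorAct D (1 ⊗ₜ[R] 1)
  map_add' D E := by simp
  map_smul' r D := by simp [tensorAct_smul]

theorem comulEnv_ofR (r : R) : comulEnv (Env.ofR K R L r) = Env.ofR K R L r ⊗ₜ[R] 1 := by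
  change tensorAct _ _ = _
  rw [tensorAct_ofR, TensorProduct.smul_tmul', Env.smul_def, mul_one]

theorem comulEnv_ofL (X : L) : comulEnv (Env.ofL K R L X) =
    Env.ofL K R L X ⊗ₜ[R] 1 + 1 ⊗ₜ[R] Env.ofL K R L X := by
  change tensorAct _ _ = _
  rw [tensorAct_ofL, smul_eq_mul, mul_one]

theorem comulEnv_mul (D E : Env K R L) : comulEnv (D * E) = tensorAct D (comulEnv E) := by
  change tensorAct _ _ = tensorAct _ (tensorAct _ _)
  simp

/-- The tensor product action is `D (m ⊗ n) = D₁ m ⊗ D₂ n`, where `Δ(D) = D₁ ⊗ D₂`. -/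
theorem tensorAct_tmul {M N : Type*} [AddCommGroup M] [Module K M] [Module R M]
    [Module (Env K R L) M] [IsScalarTower K R M] [IsScalarTower R (Env K R L) M]
    [AddCommGroup N] [Module K N] [Module R N] [Module (Env K R L) N]
    [IsScalarTower K R N] [IsScalarTower R (Env K R L) N] (D : Env K R L) (m : M) (n : N) :
    tensorAct D (m ⊗ₜ[R] n) =
      TensorProduct.map (LinearMap.toSpanSingleton (Env K R L) M m |>.restrictScalars R)
        (LinearMap.toSpanSingleton (Env K R L) N n |>.restrictScalars R) (comulEnv D) := by
  have := tensorAct_map (K := K) (L := L)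
    (LinearMap.toSpanSingleton (Env K R L) M m |>.restrictScalars R)
    (LinearMap.toSpanSingleton (Env K R L) N n |>.restrictScalars R)
    (fun X a => by simp [mul_smul]) (fun X a => by simp [mul_smul]) D (1 ⊗ₜ 1)
  simpa [comulEnv] using this.symm

end Coalgebra

section Counit

variable (K R L : Type*) [CommRing K] [CommRing R] [Algebra K R] [LieRing L] [LieAlgebra K L]
  [Module R L] [LieRingModule L R] [LieRinehartRing R L] [LieRinehartAlgebra K R L]

/-- The action of `U(L, R)` on `R`: `R` acts by multiplication, `L` through the anchor. -/
noncomputable def baseAct : Env K R L →ₐ[K] Module.End K R :=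
  Env.lift (Algebra.lsmul K K R)
    (AddMonoidHom.mk' (fun X => LieModule.toEnd K L R X) (fun X Y => by simp))
    (fun r X => by ext s; simp)
    (fun X r => by ext s; simp)
    (fun X Y => by ext s; simp)

@[simp] theorem baseAct_ofR (r s : R) : baseAct K R L (Env.ofR K R L r) s = r * s := by
  simp [baseAct]

@[simp] theorem baseAct_ofL (X : L) (s : R) : baseAct K R L (Env.ofL K R L X) s = ⁅X, s⁆ := by
  simp [baseAct]

noncomputable instance baseModule : Module (Env K R L) R := Module.compHom R (baseAct K R L).toRingHom

variable {K R L}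

theorem base_smul_def (D : Env K R L) (s : R) : D • s = baseAct K R L D s := rfl

instance : IsScalarTower R (Env K R L) R where
  smul_assoc r D s := by simp [base_smul_def, Env.smul_def]

variable (K R L)

/-- The counit of `U(L, R)`, `ε(D) = D(1)`. -/
noncomputable def counitEnv : Env K R L →ₗ[R] R where
  toFun D := D • (1 : R)
  map_add' D E := add_smul _ _ _
  map_smul' r D := smul_assoc _ _ _

theorem counitEnv_apply (D : Env K R L) : counitEnv K R L D = D • (1 : R) := rfl

end Counit

section CoalgebraInstance

variable {K R L : Type*} [CommRing K] [CommRing R] [Algebra K R] [LieRing L] [LieAlgebra K L]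
  [Module R L] [LieRingModule L R] [LieRinehartRing R L] [LieRinehartAlgebra K R L]

attribute [local instance] tensorModule

theorem tensor_smul_def {M N : Type*} [AddCommGroup M] [Module K M] [Module R M]
    [Module (Env K R L) M] [IsScalarTower K R M] [IsScalarTower R (Env K R L) M]
    [AddCommGroup N] [Module K N] [Module R N] [Module (Env K R L) N]
    [IsScalarTower K R N] [IsScalarTower R (Env K R L) N] (D : Env K R L) (t : M ⊗[R] N) :
    D • t = tensorAct D t := rfl

theorem tensorModule_isScalarTower {M N : Type*} [AddCommGroup M] [Module K M] [Module R M]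
    [Module (Env K R L) M] [IsScalarTower K R M] [IsScalarTower R (Env K R L) M]
    [AddCommGroup N] [Module K N] [Module R N] [Module (Env K R L) N]
    [IsScalarTower K R N] [IsScalarTower R (Env K R L) N] :
    IsScalarTower R (Env K R L) (M ⊗[R] N) where
  smul_assoc r D t := tensorAct_smul r D t

attribute [local instance] tensorModule_isScalarTower

theorem assoc_tensorAct (D : Env K R L) (t : (Env K R L ⊗[R] Env K R L) ⊗[R] Env K R L) :
    TensorProduct.assoc R _ _ _ (tensorAct D t) =
      tensorAct D (TensorProduct.assoc R _ _ _ t) := by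
  induction D using Env.induction generalizing t with
  | hR r => simp [tensorAct_ofR]
  | hL X =>
    induction t with
    | zero => simp
    | add x y hx hy => simp_all
    | tmul x c =>
      induction x with
      | zero => simp
      | add x y hx hy => simp_all [TensorProduct.add_tmul]
      | tmul a b =>
        simp [tensorAct_ofL, tensor_smul_def, TensorProduct.add_tmul, TensorProduct.tmul_add,
          add_assoc]
  | hadd a b ha hb => simp [ha, hb]
  | hmul a b ha hb => simp [ha, hb]

theorem ofL_smul_one (X : L) : Env.ofL K R L X • (1 : R) = 0 := by
  rw [base_smul_def, baseAct_ofL]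
  have := LieRinehartRing.leibniz_mul_right X (1 : R) 1
  simpa using this

theorem comulEnv_one : comulEnv (1 : Env K R L) = 1 ⊗ₜ[R] 1 := by
  change tensorAct _ _ = _
  simp

theorem counitEnv_one : counitEnv K R L 1 = 1 := one_smul _ _

noncomputable instance : Coalgebra R (Env K R L) where
  comul := comulEnv
  counit := counitEnv K R L
  coassoc := by
    ext D
    have h₁ := tensorAct_map (K := K) (L := L) (comulEnv (K := K) (R := R) (L := L))
      (LinearMap.id (R := R) (M := Env K R L)) (fun X m => comulEnv_mul _ _) (fun X m => rfl)
      D (1 ⊗ₜ 1)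
    have h₂ := tensorAct_map (K := K) (L := L) (LinearMap.id (R := R) (M := Env K R L))
      (comulEnv (K := K) (R := R) (L := L)) (fun X m => rfl) (fun X m => comulEnv_mul _ _)
      D (1 ⊗ₜ 1)
    change TensorProduct.assoc R _ _ _ (TensorProduct.map comulEnv LinearMap.id
      (tensorAct D (1 ⊗ₜ 1))) = TensorProduct.map LinearMap.id comulEnv (tensorAct D (1 ⊗ₜ 1))
    rw [h₁, h₂, assoc_tensorAct]
    simp [comulEnv_one]
  rTensor_counit_comp_comul := by
    ext D
    have h := tensorAct_map (K := K) (L := L) (counitEnv K R L)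
      (LinearMap.id (R := R) (M := Env K R L)) (fun X m => mul_smul _ _ _) (fun X m => rfl)
      D (1 ⊗ₜ 1)
    change TensorProduct.map (counitEnv K R L) LinearMap.id (tensorAct D (1 ⊗ₜ 1)) = 1 ⊗ₜ D
    rw [h, TensorProduct.map_tmul, counitEnv_one, tensorAct_tmul_left _ ofL_smul_one]
    simp
  lTensor_counit_comp_comul := by
    ext D
    have h := tensorAct_map (K := K) (L := L) (LinearMap.id (R := R) (M := Env K R L))
      (counitEnv K R L) (fun X m => rfl) (fun X m => mul_smul _ _ _)
      D (1 ⊗ₜ 1)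
    change TensorProduct.map LinearMap.id (counitEnv K R L) (tensorAct D (1 ⊗ₜ 1)) = D ⊗ₜ 1
    rw [h, TensorProduct.map_tmul, counitEnv_one, tensorAct_tmul_right _ ofL_smul_one]
    simp

theorem comul_eq (D : Env K R L) : Coalgebra.comul (R := R) D = tensorAct D (1 ⊗ₜ[R] 1) := rfl

theorem counit_eq (D : Env K R L) : Coalgebra.counit (R := R) D = D • (1 : R) := rfl

instance : Coalgebra.IsCocomm R (Env K R L) where
  comm_comp_comul := by
    ext D
    change TensorProduct.comm R _ _ (tensorAct D (1 ⊗ₜ 1)) = tensorAct D (1 ⊗ₜ 1)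
    rw [comm_tensorAct, TensorProduct.comm_tmul]

end CoalgebraInstance

section Jets

variable (K R L : Type*) [CommRing K] [CommRing R] [Algebra K R] [LieRing L] [LieAlgebra K L]
  [Module R L] [LieRingModule L R] [LieRinehartRing R L] [LieRinehartAlgebra K R L]

/-- The jet algebra `J(L, R) = Hom_R(U(L, R), R)`, where `U(L, R)` is an `R`-module by left
multiplication, with the product `(φ ψ)(D) = φ(D₁) ψ(D₂)` where `Δ(D) = D₁ ⊗ D₂`. -/
def Jets : Type _ := WithConv (Env K R L →ₗ[R] R)

namespace Jets

noncomputable instance : CommRing (Jets K R L) :=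
  inferInstanceAs (CommRing (WithConv (Env K R L →ₗ[R] R)))

noncomputable instance : Algebra K (Jets K R L) :=
  inferInstanceAs (Algebra K (WithConv (Env K R L →ₗ[R] R)))

variable {K R L}

/-- Evaluation of a jet at an element of `U(L, R)`. -/
def eval (φ : Jets K R L) : Env K R L →ₗ[R] R := WithConv.ofConv φ

/-- The jet given by a linear form on `U(L, R)`. -/
def of (f : Env K R L →ₗ[R] R) : Jets K R L := WithConv.toConv f

@[simp] theorem eval_of (f : Env K R L →ₗ[R] R) : eval (of f) = f := rfl

@[ext] theorem ext {φ ψ : Jets K R L} (h : ∀ D, eval φ D = eval ψ D) : φ = ψ :=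
  WithConv.ofConv_injective (LinearMap.ext h)

@[simp] theorem eval_add (φ ψ : Jets K R L) (D : Env K R L) :
    eval (φ + ψ) D = eval φ D + eval ψ D := rfl

@[simp] theorem eval_zero (D : Env K R L) : eval (0 : Jets K R L) D = 0 := rfl

@[simp] theorem eval_neg (φ : Jets K R L) (D : Env K R L) : eval (-φ) D = - eval φ D := rfl

@[simp] theorem eval_smulK (c : K) (φ : Jets K R L) (D : Env K R L) :
    eval (c • φ) D = c • eval φ D := rfl

@[simp] theorem eval_one (D : Env K R L) : eval (1 : Jets K R L) D = D • (1 : R) := rfl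

theorem eval_mul (φ ψ : Jets K R L) (D : Env K R L) : eval (φ * ψ) D =
    LinearMap.mul' R R (TensorProduct.map (eval φ) (eval ψ) (tensorAct D (1 ⊗ₜ[R] 1))) := rfl

variable (K R L)

/-- The second action of `U(L, R)` on jets, `(D φ)(E) = φ(E D)`. -/
noncomputable instance : Module (Env K R L) (Jets K R L) where
  smul D φ := of (eval φ ∘ₗ
    { toFun := fun E => E * D
      map_add' := fun E F => add_mul E F D
      map_smul' := fun r E => smul_mul_assoc r E D })
  one_smul φ := by ext E; change eval φ (E * 1) = _; rw [mul_one]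
  mul_smul D D' φ := by
    ext E; change eval φ (E * (D * D')) = eval φ (E * D * D'); rw [mul_assoc]
  smul_zero D := rfl
  smul_add D φ ψ := rfl
  add_smul D D' φ := by
    ext E; change eval φ (E * (D + D')) = eval φ (E * D) + eval φ (E * D'); simp [mul_add]
  zero_smul φ := by ext E; change eval φ (E * 0) = 0; simp

variable {K R L}

@[simp] theorem eval_smul (D : Env K R L) (φ : Jets K R L) (E : Env K R L) :
    eval (D • φ) E = eval φ (E * D) := rfl

theorem eval_smul_mul_smul (D D' : Env K R L) (φ ψ : Jets K R L) (E : Env K R L) :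
    eval ((D • φ) * (D' • ψ)) E =
      LinearMap.mul' R R (TensorProduct.map (eval φ) (eval ψ) (tensorAct E (D ⊗ₜ[R] D'))) := by
  rw [tensorAct_tmul, ← LinearMap.comp_apply (TensorProduct.map (eval φ) (eval ψ)),
    ← TensorProduct.map_comp]
  rfl

theorem eval_mul_mul (φ ψ : Jets K R L) (E D : Env K R L) : eval (φ * ψ) (E * D) =
    LinearMap.mul' R R (TensorProduct.map (eval φ) (eval ψ) (tensorAct E (comulEnv D))) := by
  rw [eval_mul, ← comulEnv_mul]
  rfl

theorem ofL_smul_mul (X : L) (φ ψ : Jets K R L) :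
    Env.ofL K R L X • (φ * ψ) = (Env.ofL K R L X • φ) * ψ + φ * (Env.ofL K R L X • ψ) := by
  ext E
  have h₁ := eval_smul_mul_smul (Env.ofL K R L X) 1 φ ψ E
  have h₂ := eval_smul_mul_smul 1 (Env.ofL K R L X) φ ψ E
  rw [one_smul] at h₁ h₂
  rw [eval_add, h₁, h₂, eval_smul, eval_mul_mul, comulEnv_ofL]
  simp

theorem ofR_smul_mul (r : R) (φ ψ : Jets K R L) :
    Env.ofR K R L r • (φ * ψ) = (Env.ofR K R L r • φ) * ψ := by
  ext E
  have h₁ := eval_smul_mul_smul (Env.ofR K R L r) 1 φ ψ E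
  rw [one_smul] at h₁
  rw [h₁, eval_smul, eval_mul_mul, comulEnv_ofR]

variable (K R L)

/-- The first map `R → J(L, R)`, `α₁(r)(D) = ε(r D) = r ε(D)`. -/
noncomputable def α₁ : R →ₐ[K] Jets K R L where
  __ := (algebraMap R (WithConv (Env K R L →ₗ[R] R)) : R →+* Jets K R L)
  commutes' c := by
    ext D
    change algebraMap K R c • (D • (1 : R)) = c • (D • (1 : R))
    rw [algebraMap_smul]

/-- The second map `R → J(L, R)`, `α₂(r)(D) = ε(D r) = D(r)`. -/
noncomputable def α₂ : R →ₐ[K] Jets K R L where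
  toFun r := Env.ofR K R L r • 1
  map_one' := by simp
  map_zero' := by simp
  map_add' r s := by simp [add_smul]
  map_mul' r s := by rw [map_mul, mul_smul, ← ofR_smul_mul, one_mul]
  commutes' c := by
    ext D
    rw [AlgHom.commutes, eval_smul, Algebra.algebraMap_eq_smul_one, Algebra.algebraMap_eq_smul_one,
      mul_smul_comm, mul_one, eval_smulK, eval_one, eval_one, Env.smulK_smul]

variable {K R L}

theorem α₁_apply (r : R) (D : Env K R L) : eval (α₁ K R L r) D = r * (D • (1 : R)) := rfl

theorem α₂_apply (r : R) (D : Env K R L) : eval (α₂ K R L r) D = D • r := by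
  change (D * Env.ofR K R L r) • (1 : R) = D • r
  rw [mul_smul, Env.ofR_smul, smul_eq_mul, mul_one]

/-- Jets are regarded as an `R`-algebra through the second map `α₂`. -/
noncomputable instance : Algebra R (Jets K R L) := (α₂ K R L).toRingHom.toAlgebra

theorem smulR_eq (r : R) (φ : Jets K R L) : r • φ = Env.ofR K R L r • φ := by
  rw [Algebra.smul_def]
  change Env.ofR K R L r • 1 * φ = _
  rw [← ofR_smul_mul, one_mul]

@[simp] theorem eval_smulR (r : R) (φ : Jets K R L) (D : Env K R L) :
    eval (r • φ) D = eval φ (D * Env.ofR K R L r) := by rw [smulR_eq, eval_smul]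

instance : IsScalarTower K R (Jets K R L) := IsScalarTower.of_algebraMap_eq' (α₂ K R L).comp_algebraMap.symm

instance : IsScalarTower R (Env K R L) (Jets K R L) where
  smul_assoc r D φ := by rw [smulR_eq, Env.smul_def, mul_smul]

end Jets
end Jets

section Smash

variable (K R L A : Type*) [CommRing K] [CommRing R] [Algebra K R] [LieRing L]
  [Module R L] [LieRingModule L R]
  [CommRing A] [Algebra K A] [Algebra R A] [Module (Env K R L) A]

/-- A commutative `R`-algebra `A` with an action of `U(L, R)` extending that of `R`, for which `L`
acts by derivations. -/
class EnvAlgebra : Prop extends IsScalarTower R (Env K R L) A where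
  ofL_smul_mul : ∀ (X : L) (a b : A),
    Env.ofL K R L X • (a * b) = (Env.ofL K R L X • a) * b + a * (Env.ofL K R L X • b)

namespace Smash

variable {K R L A} [IsScalarTower K R A] [EnvAlgebra K R L A]

variable (K R L A) in
/-- Left multiplication: `a ⊗ D` acts on `A ⊗_R U(L, R)` by the action of `D` on the tensor
product of `U(L, R)`-modules, followed by multiplication by `a`. -/
noncomputable def mulLeft : A ⊗[R] Env K R L →+ Module.End K (A ⊗[R] Env K R L) :=
  TensorProduct.liftAddHom
    { toFun := fun a =>
        { toFun := fun D => Algebra.lsmul K K (A ⊗[R] Env K R L) a * tensorAct D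
          map_zero' := by rw [map_zero, mul_zero]
          map_add' := fun D D' => by rw [map_add, mul_add] }
      map_zero' := by ext D : 1; simp
      map_add' := fun a b => by ext D : 1; simp [add_mul] }
    (fun r a D => by
      ext t
      change (r • a) • tensorAct D t = a • tensorAct (r • D) t
      rw [tensorAct_smul, smul_assoc, smul_comm])

theorem mulLeft_tmul (a : A) (D : Env K R L) (t : A ⊗[R] Env K R L) :
    mulLeft K R L A (a ⊗ₜ[R] D) t = a • tensorAct D t := rfl

theorem ofL_smul_one (X : L) : Env.ofL K R L X • (1 : A) = 0 := by
  have := EnvAlgebra.ofL_smul_mul (K := K) (R := R) X (1 : A) 1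
  simpa using this

theorem mulLeft_one (x : A ⊗[R] Env K R L) : mulLeft K R L A x ((1 : A) ⊗ₜ[R] 1) = x := by
  induction x with
  | zero => simp
  | tmul a D =>
    rw [mulLeft_tmul, tensorAct_tmul_left _ ofL_smul_one, TensorProduct.smul_tmul']
    simp
  | add x y hx hy => rw [map_add, LinearMap.add_apply, hx, hy]

theorem one_mulLeft (x : A ⊗[R] Env K R L) : mulLeft K R L A ((1 : A) ⊗ₜ[R] 1) x = x := by
  rw [mulLeft_tmul, map_one, one_smul, Module.End.one_apply]

theorem mulLeft_smul (a : A) (t : A ⊗[R] Env K R L) (u : A ⊗[R] Env K R L) :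
    mulLeft K R L A (a • t) u = a • mulLeft K R L A t u := by
  induction t with
  | zero => simp
  | add x y hx hy => rw [smul_add, map_add, map_add]; simp [hx, hy]
  | tmul b D =>
    rw [TensorProduct.smul_tmul']
    simp [mulLeft_tmul, mul_smul]

theorem tensorAct_ofL_smul (X : L) (b : A) (u : A ⊗[R] Env K R L) :
    tensorAct (Env.ofL K R L X) (b • u) =
      (Env.ofL K R L X • b) • u + b • tensorAct (Env.ofL K R L X) u := by
  induction u with
  | zero => simp
  | add x y hx hy => rw [smul_add, map_add, map_add, hx, hy, smul_add, smul_add]; abel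
  | tmul c E =>
    simp only [TensorProduct.smul_tmul', tensorAct_ofL, smul_eq_mul, EnvAlgebra.ofL_smul_mul,
      TensorProduct.add_tmul, smul_add]
    abel

theorem mulLeft_tensorAct (D : Env K R L) (t : A ⊗[R] Env K R L) (u : A ⊗[R] Env K R L) :
    mulLeft K R L A (tensorAct D t) u = tensorAct D (mulLeft K R L A t u) := by
  induction D using Env.induction generalizing t u with
  | hR r =>
    rw [tensorAct_ofR, tensorAct_ofR, ← algebraMap_smul A r t, mulLeft_smul, algebraMap_smul]
  | hL X =>
    induction t with
    | zero => simp
    | add x y hx hy => rw [map_add, map_add, LinearMap.add_apply, hx, hy]; simp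
    | tmul b E =>
      rw [tensorAct_ofL, map_add, LinearMap.add_apply]
      simp only [mulLeft_tmul, smul_eq_mul, map_mul, Module.End.mul_apply]
      rw [tensorAct_ofL_smul]
  | hadd a b ha hb => simp [ha, hb]
  | hmul a b ha hb => simp [ha, hb]

theorem mulLeft_mulLeft (x y u : A ⊗[R] Env K R L) :
    mulLeft K R L A (mulLeft K R L A x y) u = mulLeft K R L A x (mulLeft K R L A y u) := by
  induction x with
  | zero => simp
  | tmul a D => rw [mulLeft_tmul, mulLeft_tmul, mulLeft_smul, mulLeft_tensorAct]
  | add x x' hx hx' => simp [hx, hx']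

end Smash

/-- The tensor product `A ⊗_R U(L, R)`, for the `R`-module structure on `U(L, R)` given by left
multiplication, as a `K`-algebra with the product
`(a ⊗ D) (b ⊗ E) = a (D₁ b) ⊗ D₂ E` where `Δ(D) = D₁ ⊗ D₂`. -/
def Smash : Type _ := A ⊗[R] Env K R L

namespace Smash

noncomputable instance : AddCommGroup (Smash K R L A) :=
  inferInstanceAs (AddCommGroup (A ⊗[R] Env K R L))

noncomputable instance [IsScalarTower K R A] : Module K (Smash K R L A) :=
  inferInstanceAs (Module K (A ⊗[R] Env K R L))

variable {K R L A}

/-- The element `a ⊗ D`. -/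
noncomputable def tmul (a : A) (D : Env K R L) : Smash K R L A := (a ⊗ₜ[R] D : A ⊗[R] Env K R L)

@[elab_as_elim] theorem induction {p : Smash K R L A → Prop} (h0 : p 0) (ht : ∀ a D, p (tmul a D))
    (hadd : ∀ x y, p x → p y → p (x + y)) (x : Smash K R L A) : p x :=
  TensorProduct.induction_on x h0 ht hadd

variable [IsScalarTower K R A] [EnvAlgebra K R L A]

noncomputable instance : Mul (Smash K R L A) where
  mul x y := (mulLeft K R L A (x : A ⊗[R] Env K R L) (y : A ⊗[R] Env K R L) :)

noncomputable instance : Ring (Smash K R L A) where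
  __ := (inferInstance : AddCommGroup (Smash K R L A))
  __ := (inferInstance : Mul (Smash K R L A))
  one := tmul 1 1
  left_distrib x y z := map_add (mulLeft K R L A (x : A ⊗[R] Env K R L)) y z
  right_distrib x y z :=
    DFunLike.congr_fun (map_add (mulLeft K R L A) (x : A ⊗[R] Env K R L) y) _
  zero_mul x := DFunLike.congr_fun (map_zero (mulLeft K R L A)) _
  mul_zero x := map_zero (mulLeft K R L A (x : A ⊗[R] Env K R L))
  mul_assoc x y z := mulLeft_mulLeft (x : A ⊗[R] Env K R L) y z
  one_mul x := one_mulLeft (x : A ⊗[R] Env K R L)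
  mul_one x := mulLeft_one (x : A ⊗[R] Env K R L)

theorem one_def : (1 : Smash K R L A) = tmul 1 1 := rfl

noncomputable instance : Algebra K (Smash K R L A) :=
  Algebra.ofModule
    (fun c x y => by
      induction x using Smash.induction with
      | h0 => simp
      | ht a D =>
        exact smul_assoc c a (tensorAct D (y : A ⊗[R] Env K R L))
      | hadd x x' hx hx' => rw [smul_add, add_mul, hx, hx', add_mul, smul_add])
    (fun c x y => map_smul (mulLeft K R L A (x : A ⊗[R] Env K R L)) c y)

end Smash
end Smash

section SmashCoproduct

variable {K R L A : Type*} [CommRing K] [CommRing R] [Algebra K R] [LieRing L] [LieAlgebra K L]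
  [Module R L] [LieRingModule L R] [LieRinehartRing R L] [LieRinehartAlgebra K R L]
  [CommRing A] [Algebra K A] [Algebra R A] [Module (Env K R L) A] [IsScalarTower K R A]
  [EnvAlgebra K R L A]

/-- `(a ⊗ D) (b ⊗ E) = a (D₁ b) ⊗ D₂ E` where `Δ(D) = D₁ ⊗ D₂`. -/
theorem Smash.tmul_mul_tmul (a b : A) (D E : Env K R L) :
    Smash.tmul a D * Smash.tmul b E = (a • TensorProduct.map
      (LinearMap.toSpanSingleton (Env K R L) A b |>.restrictScalars R)
      (LinearMap.toSpanSingleton (Env K R L) (Env K R L) E |>.restrictScalars R)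
      (Coalgebra.comul (R := R) D) : A ⊗[R] Env K R L) :=
  congrArg (a • ·) (tensorAct_tmul D b E)

instance : EnvAlgebra K R L (Jets K R L) where
  ofL_smul_mul := Jets.ofL_smul_mul

end SmashCoproduct

section Morphisms

open scoped LieRinehartAlgebra

section Functoriality

variable {K R L R' L' : Type*} [CommRing K] [CommRing R] [Algebra K R] [LieRing L]
  [LieAlgebra K L] [Module R L] [LieRingModule L R]
  [CommRing R'] [Algebra K R'] [LieRing L'] [LieAlgebra K L'] [Module R' L'] [LieRingModule L' R']
  {σ : R →ₐ[K] R'} (g : L →ₗ⁅σ⁆ L')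

/-- The map `U(L, R) → U(L', R')` induced by a morphism of Lie-Rinehart algebras. -/
noncomputable def Env.map : Env K R L →ₐ[K] Env K R' L' :=
  Env.lift ((Env.ofR K R' L').comp σ)
    ((Env.ofL K R' L').comp (g.toLieHom : L →+ L'))
    (fun r X => by
      have := g.map_smul_apply' r X
      simp_all [Env.ofR_mul_ofL])
    (fun X r => by
      have := g.apply_lie' r X
      simp_all [Env.ofL_mul_ofR])
    (fun X Y => by
      have := Env.ofL_mul_ofL (K := K) (R := R') (g X) (g Y)
      simpa using this)

@[simp] theorem Env.map_ofR (r : R) : Env.map g (Env.ofR K R L r) = Env.ofR K R' L' (σ r) := by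
  simp [Env.map]

@[simp] theorem Env.map_ofL (X : L) : Env.map g (Env.ofL K R L X) = Env.ofL K R' L' (g X) := by
  simp [Env.map]

theorem Env.map_smul (r : R) (D : Env K R L) : Env.map g (r • D) = σ r • Env.map g D := by
  simp [Env.smul_def]

section
variable {M N M' N' : Type*} [AddCommGroup M] [Module R M] [AddCommGroup N] [Module R N]
  [AddCommGroup M'] [Module R' M'] [AddCommGroup N'] [Module R' N']

/-- The map of tensor products induced by two `σ`-semilinear maps. -/
noncomputable def semiMap (σ : R →+* R') (f : M →ₛₗ[σ] M') (h : N →ₛₗ[σ] N') :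
    M ⊗[R] N →+ M' ⊗[R'] N' :=
  TensorProduct.liftAddHom
    { toFun := fun m =>
        { toFun := fun n => f m ⊗ₜ[R'] h n
          map_zero' := by simp
          map_add' := fun n n' => by simp [TensorProduct.tmul_add] }
      map_zero' := by ext n : 1; simp
      map_add' := fun m m' => by ext n : 1; simp [TensorProduct.add_tmul] }
    (fun r m n => by simp [TensorProduct.smul_tmul'])

@[simp] theorem semiMap_tmul (σ : R →+* R') (f : M →ₛₗ[σ] M') (h : N →ₛₗ[σ] N') (m : M) (n : N) :
    semiMap σ f h (m ⊗ₜ[R] n) = f m ⊗ₜ[R'] h n := rfl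

theorem semiMap_smul (σ : R →+* R') (f : M →ₛₗ[σ] M') (h : N →ₛₗ[σ] N') (r : R) (t : M ⊗[R] N) :
    semiMap σ f h (r • t) = σ r • semiMap σ f h t := by
  induction t with
  | zero => simp
  | add x y hx hy => simp_all
  | tmul m n => simp [TensorProduct.smul_tmul']

variable [Module K M] [Module (Env K R L) M]
  [IsScalarTower K R M] [IsScalarTower R (Env K R L) M]
  [Module K N] [Module (Env K R L) N]
  [IsScalarTower K R N] [IsScalarTower R (Env K R L) N]
  [Module K M'] [Module (Env K R' L') M']
  [IsScalarTower K R' M'] [IsScalarTower R' (Env K R' L') M']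
  [Module K N'] [Module (Env K R' L') N']
  [IsScalarTower K R' N'] [IsScalarTower R' (Env K R' L') N']

theorem semiMap_tensorAct (f : M →ₛₗ[(σ : R →+* R')] M') (h : N →ₛₗ[(σ : R →+* R')] N')
    (hf : ∀ (X : L) m, f (Env.ofL K R L X • m) = Env.ofL K R' L' (g X) • f m)
    (hh : ∀ (X : L) n, h (Env.ofL K R L X • n) = Env.ofL K R' L' (g X) • h n)
    (D : Env K R L) (t : M ⊗[R] N) :
    semiMap _ f h (tensorAct D t) = tensorAct (Env.map g D) (semiMap _ f h t) := by
  induction D using Env.induction generalizing t with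
  | hR r => simp [tensorAct_ofR, semiMap_smul]
  | hL X =>
    induction t with
    | zero => simp
    | add x y hx hy => simp_all
    | tmul m n => simp [tensorAct_ofL, hf, hh]
  | hadd a b ha hb => simp [ha, hb]
  | hmul a b ha hb => simp [ha, hb]

end

/-- `Env.map` as a semilinear map. -/
noncomputable def Env.mapₛₗ : Env K R L →ₛₗ[(σ : R →+* R')] Env K R' L' where
  toFun := Env.map g
  map_add' := map_add _
  map_smul' := Env.map_smul g

theorem map_comul (D : Env K R L) :
    semiMap _ (Env.mapₛₗ g) (Env.mapₛₗ g) (tensorAct D (1 ⊗ₜ[R] 1)) =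
      tensorAct (Env.map g D) ((1 : Env K R' L') ⊗ₜ[R'] (1 : Env K R' L')) := by
  rw [semiMap_tensorAct g (Env.mapₛₗ g) (Env.mapₛₗ g) (fun X m => ?_) (fun X m => ?_),
    semiMap_tmul]
  · change tensorAct _ (Env.map g 1 ⊗ₜ Env.map g 1) = _
    rw [map_one]
  all_goals
    change Env.map g (_ * _) = _ * Env.map g _
    rw [map_mul, Env.map_ofL]

end Functoriality

section JetsFunctoriality

variable {K R L R' L' : Type*} [CommRing K] [CommRing R] [Algebra K R] [LieRing L]
  [LieAlgebra K L] [Module R L] [LieRingModule L R] [LieRinehartRing R L] [LieRinehartAlgebra K R L]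
  [CommRing R'] [Algebra K R'] [LieRing L'] [LieAlgebra K L'] [Module R' L'] [LieRingModule L' R']
  [LieRinehartRing R' L'] [LieRinehartAlgebra K R' L']
  {σ : R →ₐ[K] R'} (g : L →ₗ⁅σ⁆ L')

theorem Env.map_smul_base (D : Env K R L) (s : R) : σ (D • s) = Env.map g D • σ s := by
  induction D using Env.induction generalizing s with
  | hR r => simp [base_smul_def]
  | hL X => simpa [base_smul_def] using g.apply_lie' s X
  | hadd a b ha hb => simp [add_smul, ha, hb]
  | hmul a b ha hb => simp [mul_smul, ha, hb]

/-- Two jets are compatible along a morphism of Lie-Rinehart algebras if the one restricts to the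
other. -/
def Jets.Compatible (φ : Jets K R L) (φ' : Jets K R' L') : Prop :=
  ∀ D, Jets.eval φ' (Env.map g D) = σ (Jets.eval φ D)

variable {g} {φ ψ : Jets K R L} {φ' ψ' : Jets K R' L'}

theorem Jets.Compatible.add (h : Jets.Compatible g φ φ') (h' : Jets.Compatible g ψ ψ') :
    Jets.Compatible g (φ + ψ) (φ' + ψ') := fun D => by simp [h D, h' D]

theorem Jets.Compatible.neg (h : Jets.Compatible g φ φ') :
    Jets.Compatible g (-φ) (-φ') := fun D => by simp [h D]

theorem Jets.Compatible.mul (h : Jets.Compatible g φ φ') (h' : Jets.Compatible g ψ ψ') :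
    Jets.Compatible g (φ * ψ) (φ' * ψ') := fun D => by
  rw [eval_mul, eval_mul, ← map_comul g]
  generalize tensorAct D ((1 : Env K R L) ⊗ₜ[R] (1 : Env K R L)) = t
  induction t with
  | zero => simp
  | add x y hx hy => simp_all
  | tmul a b =>
    simp only [semiMap_tmul, TensorProduct.map_tmul, LinearMap.mul'_apply, map_mul, ← h a, ← h' b]
    rfl

theorem Jets.Compatible.smul (h : Jets.Compatible g φ φ') (D : Env K R L) :
    Jets.Compatible g (D • φ) (Env.map g D • φ') := fun E => by
  simp [← h (E * D)]

theorem Jets.Compatible.one : Jets.Compatible g 1 1 := fun D => by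
  simp [Env.map_smul_base g]

variable (g) in
theorem Jets.Compatible.algebraMap (c : K) :
    Jets.Compatible g (algebraMap K _ c) (algebraMap K _ c) := fun D => by
  simp [Algebra.algebraMap_eq_smul_one, Env.map_smul_base g]

variable (g) in
theorem Jets.Compatible.alpha₁ (r : R) :
    Jets.Compatible g (α₁ K R L r) (α₁ K R' L' (σ r)) := fun D => by
  simp [α₁_apply, Env.map_smul_base g]

variable (g) in
theorem Jets.Compatible.alpha₂ (r : R) :
    Jets.Compatible g (α₂ K R L r) (α₂ K R' L' (σ r)) := fun D => by
  simp [α₂_apply, Env.map_smul_base g]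

end JetsFunctoriality

end Morphisms

section Abelian

variable (K R L : Type*) [CommRing K] [CommRing R] [Algebra K R] [LieRing L] [LieAlgebra K L]
  [Module R L] [LieRingModule L R]

/-- A Lie-Rinehart algebra whose Lie bracket and anchor are zero. -/
class IsAbelian (R L : Type*) [CommRing R] [LieRing L] [LieRingModule L R] : Prop where
  lie_eq_zero : ∀ X Y : L, ⁅X, Y⁆ = 0
  anchor_eq_zero : ∀ (X : L) (r : R), ⁅X, r⁆ = 0

variable [IsAbelian R L] {K R L}

theorem Env.ofL_comm_ofR (X : L) (r : R) :
    Env.ofL K R L X * Env.ofR K R L r = Env.ofR K R L r * Env.ofL K R L X := by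
  rw [Env.ofL_mul_ofR, IsAbelian.anchor_eq_zero, map_zero, add_zero]

theorem Env.ofL_comm_ofL (X Y : L) :
    Env.ofL K R L X * Env.ofL K R L Y = Env.ofL K R L Y * Env.ofL K R L X := by
  rw [Env.ofL_mul_ofL, IsAbelian.lie_eq_zero (R := R), map_zero, add_zero]

theorem Env.mul_comm_of_isAbelian (D E : Env K R L) : D * E = E * D := by
  have h : ∀ (x : Env K R L), (∀ r, Commute (Env.ofR K R L r) x) →
      (∀ X, Commute (Env.ofL K R L X) x) → ∀ D : Env K R L, Commute D x := fun x hr hL D => by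
    induction D using Env.induction with
    | hR r => exact hr r
    | hL X => exact hL X
    | hadd a b ha hb => exact ha.add_left hb
    | hmul a b ha hb => exact ha.mul_left hb
  refine h E (fun r => (h _ (fun s => ?_) (fun X => ?_) E).symm)
    (fun X => (h _ (fun s => ?_) (fun Y => ?_) E).symm) D
  · exact (Commute.all s r).map (Env.ofR K R L)
  · exact Env.ofL_comm_ofR X r
  · exact (Env.ofL_comm_ofR X s).symm
  · exact Env.ofL_comm_ofL Y X

/-- If the bracket and the anchor are zero, then `U(L, R)` is the symmetric algebra of the
`R`-module `L`. -/
theorem Env.exists_symmetricAlgebra_equiv [IsScalarTower K R L] :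
    ∃ e : SymmetricAlgebra R L ≃+* Env K R L,
      (∀ r, e (algebraMap R _ r) = Env.ofR K R L r) ∧
      ∀ X, e (SymmetricAlgebra.ι R L X) = Env.ofL K R L X := by
  let : CommRing (Env K R L) :=
    { (inferInstance : Ring (Env K R L)) with mul_comm := Env.mul_comm_of_isAbelian }
  let : Algebra R (Env K R L) := (Env.ofR K R L).toRingHom.toAlgebra
  have : IsScalarTower K R (SymmetricAlgebra R L) := inferInstance
  let f : SymmetricAlgebra R L →ₐ[R] Env K R L := SymmetricAlgebra.lift
    { Env.ofL K R L with
      map_smul' := fun r X => (Env.ofR_mul_ofL r X).symm }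
  let h : Env K R L →ₐ[K] SymmetricAlgebra R L :=
    Env.lift (IsScalarTower.toAlgHom K R _) (SymmetricAlgebra.ι R L : L →+ SymmetricAlgebra R L)
      (fun r X => by simp [Algebra.smul_def])
      (fun X r => by simp [IsAbelian.anchor_eq_zero, mul_comm])
      (fun X Y => by simp [IsAbelian.lie_eq_zero (R := R), mul_comm])
  have hf : ∀ X, f (SymmetricAlgebra.ι R L X) = Env.ofL K R L X := fun X =>
    SymmetricAlgebra.lift_ι_apply _ _
  have hh : ∀ X, h (Env.ofL K R L X) = SymmetricAlgebra.ι R L X := fun X => Env.lift_ofL _ _ _ _ _ X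
  have hf' : ∀ r, f (algebraMap R _ r) = Env.ofR K R L r := fun r => f.commutes r
  have hh' : ∀ r, h (Env.ofR K R L r) = algebraMap R _ r := fun r => Env.lift_ofR _ _ _ _ _ r
  refine ⟨RingEquiv.ofRingHom f.toRingHom h.toRingHom ?_ ?_, hf', hf⟩
  · ext D
    change f (h D) = D
    induction D using Env.induction with
    | hR r => rw [hh', hf']
    | hL X => rw [hh, hf]
    | hadd a b ha hb => rw [map_add, map_add, ha, hb]
    | hmul a b ha hb => rw [map_mul, map_mul, ha, hb]
  · refine RingHom.ext fun x => ?_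
    change h (f x) = x
    induction x using SymmetricAlgebra.induction with
    | algebraMap r => rw [hf', hh']
    | ι X => rw [hf, hh]
    | mul a b ha hb => rw [map_mul, map_mul, ha, hb]
    | add a b ha hb => rw [map_add, map_add, ha, hb]

variable (K R L) in
/-- The component of degree `1`, `Sym(L) → L`, where `Sym(L)` is the enveloping algebra of `L` with
zero bracket and zero anchor. -/
noncomputable def degOneAct [IsScalarTower K R L] : Env K R L →ₐ[K] Module.End K (R × L) :=
  Env.lift (Algebra.lsmul K K (R × L))
    (AddMonoidHom.mk' (fun X =>
        LinearMap.inr K R L ∘ₗ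
          ((LinearMap.toSpanSingleton R L X).restrictScalars K) ∘ₗ LinearMap.fst K R L)
      (fun X Y => by ext <;> simp))
    (fun r X => by ext <;> simp [smul_comm r])
    (fun X r => by ext <;> simp [IsAbelian.anchor_eq_zero, mul_smul])
    (fun X Y => by ext <;> simp [IsAbelian.lie_eq_zero (R := R)])

variable (K R L) in
noncomputable def degOne [IsScalarTower K R L] : Env K R L →ₗ[R] L where
  toFun P := (degOneAct K R L P (1, 0)).2
  map_add' P Q := by simp
  map_smul' r P := by simp [Env.smul_def, degOneAct]

end Abelian

section Connection

variable (K R L M : Type*) [CommRing K] [CommRing R] [Algebra K R] [LieRing L] [LieAlgebra K L]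
  [Module R L] [LieRingModule L R]
  [AddCommGroup M] [Module K M] [Module R M] [IsScalarTower K R M]

/-- An `L`-connection on an `R`-module `M`. -/
structure Connection where
  /-- The `K`-linear map `m ↦ (X ↦ ∇_X m)`. -/
  toFun : M →ₗ[K] L →ₗ[R] M
  leibniz : ∀ (X : L) (r : R) (m : M), toFun (r • m) X = r • toFun m X + ⁅X, r⁆ • m

end Connection

section PBW

variable {K R L L₀ : Type*} [CommRing K] [CommRing R] [Algebra K R]
  [LieRing L] [LieAlgebra K L] [Module R L] [LieRingModule L R]
  [LieRinehartRing R L] [LieRinehartAlgebra K R L]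
  [LieRing L₀] [LieAlgebra K L₀] [Module R L₀] [LieRingModule L₀ R]
  [LieRinehartRing R L₀] [LieRinehartAlgebra K R L₀] [IsAbelian R L₀]
  (e : L₀ ≃ₗ[R] L) (nab : Connection K R L L)

/-- The extension `P ↦ P + ε ∇_X P` of `r ↦ r + ε X(r)` and `Y ↦ Y + ε ∇_X Y` to an algebra
homomorphism `Sym(L) → Sym(L)[ε]`. -/
noncomputable def symConnHom (X : L) : Env K R L₀ →ₐ[K] DualNumber (Env K R L₀) :=
  Env.lift
    { toFun := fun r => TrivSqZeroExt.inl (Env.ofR K R L₀ r) +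
        TrivSqZeroExt.inr (Env.ofR K R L₀ ⁅X, r⁆)
      map_one' := by
        have : ⁅X, (1 : R)⁆ = 0 := by
          have := LieRinehartRing.leibniz_mul_right X (1 : R) 1
          simpa using this
        simp [this]
      map_zero' := by simp
      map_add' := fun r s => by
        ext <;> simp
      map_mul' := fun r s => by
        ext <;> simp [mul_comm, ← map_mul]
      commutes' := fun c => by
        have : ⁅X, algebraMap K R c⁆ = 0 := by
          rw [← LieRinehartAlgebra.anchor_apply (R := K), Derivation.map_algebraMap]
        ext <;> simp [this, TrivSqZeroExt.algebraMap_eq_inl'] }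
    (AddMonoidHom.mk' (fun Y => TrivSqZeroExt.inl (Env.ofL K R L₀ Y) +
        TrivSqZeroExt.inr (Env.ofL K R L₀ (e.symm (nab.toFun (e Y) X))))
      (fun Y Z => by ext <;> simp))
    (fun r Y => by
      have h : e.symm (nab.toFun (r • e Y) X) =
          r • e.symm (nab.toFun (e Y) X) + ⁅X, r⁆ • Y := by
        rw [nab.leibniz]; simp
      ext
      · simp [Env.ofR_mul_ofL]
      · simp [h, Env.ofR_mul_ofL])
    (fun Y r => by
      ext <;> simp [IsAbelian.anchor_eq_zero, Env.mul_comm_of_isAbelian _ (Env.ofR K R L₀ _),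
        add_comm])
    (fun Y Z => by
      ext
      · simp [IsAbelian.lie_eq_zero (R := R), Env.ofL_comm_ofL]
      · simp [IsAbelian.lie_eq_zero (R := R)]
        rw [Env.mul_comm_of_isAbelian (Env.ofL K R L₀ Y), Env.mul_comm_of_isAbelian _ (Env.ofL K R L₀ Z), add_comm])

/-- The operator `∇_X` on `Sym(L)`, the extension of `∇_X` on `L` by the Leibniz rule. -/
noncomputable def symConn (X : L) : Env K R L₀ →ₗ[K] Env K R L₀ where
  toFun P := (symConnHom e nab X P).snd
  map_add' P Q := by simp
  map_smul' c P := by simp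

theorem symConnHom_fst (X : L) (P : Env K R L₀) : (symConnHom e nab X P).fst = P := by
  induction P using Env.induction with
  | hR r => simp [symConnHom]
  | hL Y => simp [symConnHom]
  | hadd a b ha hb => simp [ha, hb]
  | hmul a b ha hb => simp [ha, hb]

theorem symConn_mul (X : L) (P Q : Env K R L₀) :
    symConn e nab X (P * Q) = P * symConn e nab X Q + symConn e nab X P * Q := by
  simp [symConn, symConnHom_fst]

theorem symConn_ofR (X : L) (r : R) :
    symConn e nab X (Env.ofR K R L₀ r) = Env.ofR K R L₀ ⁅X, r⁆ := by
  simp [symConn, symConnHom]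

theorem symConn_ofL (X : L) (Y : L₀) :
    symConn e nab X (Env.ofL K R L₀ Y) = Env.ofL K R L₀ (e.symm (nab.toFun (e Y) X)) := by
  simp [symConn, symConnHom]

theorem symConn_smul (X : L) (r : R) (P : Env K R L₀) :
    symConn e nab X (r • P) = r • symConn e nab X P + ⁅X, r⁆ • P := by
  rw [Env.smul_def, symConn_mul, symConn_ofR]; rfl

theorem symConn_add_left (X Y : L) (P : Env K R L₀) :
    symConn e nab (X + Y) P = symConn e nab X P + symConn e nab Y P := by
  induction P using Env.induction with
  | hR r => simp [symConn_ofR]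
  | hL Z => simp [symConn_ofL]
  | hadd a b ha hb => rw [map_add, ha, hb, map_add, map_add]; abel
  | hmul a b ha hb => rw [symConn_mul, ha, hb, symConn_mul, symConn_mul, mul_add, add_mul]; abel

theorem symConn_smul_left (r : R) (X : L) (P : Env K R L₀) :
    symConn e nab (r • X) P = r • symConn e nab X P := by
  induction P using Env.induction with
  | hR s => simp [symConn_ofR, Env.smul_def]
  | hL Z => simp [symConn_ofL, Env.smul_def, Env.ofR_mul_ofL]
  | hadd a b ha hb => rw [map_add, ha, hb, map_add, smul_add]
  | hmul a b ha hb =>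
    rw [symConn_mul, ha, hb, symConn_mul, smul_add, smul_mul_assoc,
      Env.mul_comm_of_isAbelian a (r • _), smul_mul_assoc, Env.mul_comm_of_isAbelian _ a]

/-- For an `R`-linear map `Φ : Sym(L) → J(L, R)` (for the second `R`-module structure on jets),
i.e. a section of `J(L, R) ⊗_R Ŝym(L^∨)`, the map `Q ⊗ X ↦ (∇_X Φ)(Q)`, where
`∇ = ∇⁽²⁾ ⊗ 1 + 1 ⊗ ∇`. -/
noncomputable def gradient (Φ : Env K R L₀ →ₗ[R] Jets K R L) :
    Env K R L₀ ⊗[R] L₀ →+ Jets K R L :=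
  TensorProduct.liftAddHom
    { toFun := fun Q =>
        { toFun := fun X => Env.ofL K R L (e X) • Φ Q - Φ (symConn e nab (e X) Q)
          map_zero' := by
            have := symConn_smul_left e nab 0 0 Q
            simp_all
          map_add' := fun X Y => by
            rw [map_add, map_add, symConn_add_left, map_add, add_smul]; abel }
      map_zero' := by ext X : 1; simp
      map_add' := fun Q Q' => by
        ext X : 1
        simp only [map_add, smul_add, AddMonoidHom.coe_mk, ZeroHom.coe_mk, AddMonoidHom.add_apply]
        abel }
    (fun r Q X => by
      simp only [AddMonoidHom.coe_mk, ZeroHom.coe_mk]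
      rw [map_smul Φ, map_smul e, symConn_smul_left, symConn_smul, Env.ofL_smul_smul,
        ← Env.ofR_mul_ofL, mul_smul, Env.ofR_smul, map_add, map_smul Φ, map_smul Φ]
      abel)

@[simp] theorem gradient_tmul (Φ : Env K R L₀ →ₗ[R] Jets K R L) (Q : Env K R L₀) (X : L₀) :
    gradient e nab Φ (Q ⊗ₜ[R] X) =
      Env.ofL K R L (e X) • Φ Q - Φ (symConn e nab (e X) Q) := rfl

theorem gradient_smul (Φ : Env K R L₀ →ₗ[R] Jets K R L) (r : R) (t : Env K R L₀ ⊗[R] L₀) :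
    gradient e nab Φ (r • t) = r • gradient e nab Φ t := by
  induction t with
  | zero => simp
  | add x y hx hy => simp_all
  | tmul Q X =>
    rw [← TensorProduct.tmul_smul, gradient_tmul, gradient_tmul, map_smul, symConn_smul_left,
      ← Env.ofR_mul_ofL, mul_smul, Env.ofR_smul, map_smul, smul_sub]

variable (K R L₀) in
/-- The map `X₁ ⋯ Xₙ ↦ ∑ᵢ X₁ ⋯ X̂ᵢ ⋯ Xₙ ⊗ Xᵢ` from `Sym(L)` to `Sym(L) ⊗ L`. -/
noncomputable def polarization : Env K R L₀ →ₗ[R] Env K R L₀ ⊗[R] L₀ :=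
  LinearMap.lTensor _ (degOne K R L₀) ∘ₗ Coalgebra.comul

theorem degOne_ofL_mul (X : L₀) (Q : Env K R L₀) :
    degOne K R L₀ (Env.ofL K R L₀ X * Q) = (Coalgebra.counit (R := R) Q) • X := by
  have h : ∀ Q : Env K R L₀, (degOneAct K R L₀ Q (1, 0)).1 = Coalgebra.counit (R := R) Q := by
    have h' : ∀ (Q : Env K R L₀) (v : R × L₀), (degOneAct K R L₀ Q v).1 = Q • v.1 := fun Q => by
      induction Q using Env.induction with
      | hR r => intro v; simp [degOneAct, Env.ofR_smul]
      | hL X => intro v; simp [degOneAct, base_smul_def, IsAbelian.anchor_eq_zero]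
      | hadd a b ha hb => intro v; simp [ha, hb, add_smul]
      | hmul a b ha hb => intro v; simp [ha, hb, mul_smul]
    exact fun Q => h' Q _
  change (degOneAct K R L₀ _ _).2 = _
  rw [map_mul, Module.End.mul_apply, ← h Q]
  generalize degOneAct K R L₀ Q (1, 0) = v
  simp [degOneAct]

/-- Multiplication by an element of `L` on `Sym(L)`, as an `R`-linear map. -/
noncomputable def mulOfL (X : L₀) : Env K R L₀ →ₗ[R] Env K R L₀ where
  toFun P := Env.ofL K R L₀ X * P
  map_add' P Q := mul_add _ P Q
  map_smul' r P := by
    simp only [Env.smul_def, RingHom.id_apply, ← mul_assoc, Env.ofL_comm_ofR]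

theorem polarization_ofL_mul (X : L₀) (Q : Env K R L₀) :
    polarization K R L₀ (Env.ofL K R L₀ X * Q) =
      LinearMap.rTensor L₀ (mulOfL X) (polarization K R L₀ Q) + Q ⊗ₜ[R] X := by
  have h₁ : ∀ t : Env K R L₀ ⊗[R] Env K R L₀,
      LinearMap.lTensor _ (degOne K R L₀) (tensorAct (Env.ofL K R L₀ X) t) =
        LinearMap.rTensor L₀ (mulOfL X) (LinearMap.lTensor _ (degOne K R L₀) t) +
        LinearMap.lTensor _ (LinearMap.toSpanSingleton R L₀ X)
          (LinearMap.lTensor _ (Coalgebra.counit (R := R)) t) := fun t => by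
    induction t with
    | zero => simp
    | add x y hx hy => simp only [map_add, hx, hy]; abel
    | tmul a b =>
      simp only [tensorAct_ofL, map_add, LinearMap.lTensor_tmul, LinearMap.rTensor_tmul,
        smul_eq_mul, degOne_ofL_mul, LinearMap.toSpanSingleton_apply]
      rfl
  have h₂ := Coalgebra.lTensor_counit_comul (R := R) Q
  change LinearMap.lTensor _ (degOne K R L₀) (comulEnv (Env.ofL K R L₀ X * Q)) = _
  rw [comulEnv_mul, h₁]
  change _ + LinearMap.lTensor _ _ (LinearMap.lTensor _ _ (Coalgebra.comul Q)) = _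
  rw [h₂]
  simp [polarization]
  rfl

theorem polarization_prod (l : List L₀) :
    polarization K R L₀ (l.map (Env.ofL K R L₀)).prod =
      ∑ i : Fin l.length, ((l.eraseIdx i).map (Env.ofL K R L₀)).prod ⊗ₜ[R] l[i] := by
  induction l with
  | nil =>
    have : degOne K R L₀ 1 = 0 := by
      change (degOneAct K R L₀ 1 (1, 0)).2 = 0
      rw [map_one]; rfl
    change LinearMap.lTensor _ (degOne K R L₀) (comulEnv 1) = _
    rw [comulEnv_one]
    simp [this]
  | cons X l ih =>
    rw [List.map_cons, List.prod_cons, polarization_ofL_mul, ih]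
    change _ = ∑ i : Fin (l.length + 1), _
    rw [Fin.sum_univ_succ, add_comm]
    simp [mulOfL]

/-- The symmetrized connection `D` on `J(L, R) ⊗_R Ŝym(L^∨)`,
`(D Φ)(X₀ ⋯ Xₙ) = ∑ᵢ (∇_{Xᵢ} Φ)(X₀ ⋯ X̂ᵢ ⋯ Xₙ)`. -/
noncomputable def symmetrized (Φ : Env K R L₀ →ₗ[R] Jets K R L) :
    Env K R L₀ →ₗ[R] Jets K R L where
  toFun P := gradient e nab Φ (polarization K R L₀ P)
  map_add' P Q := by simp
  map_smul' r P := by simp [gradient_smul]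

theorem symmetrized_prod (Φ : Env K R L₀ →ₗ[R] Jets K R L) (l : List L₀) :
    symmetrized e nab Φ (l.map (Env.ofL K R L₀)).prod =
      ∑ i : Fin l.length,
        (Env.ofL K R L (e l[i]) • Φ ((l.eraseIdx i).map (Env.ofL K R L₀)).prod -
          Φ (symConn e nab (e l[i]) ((l.eraseIdx i).map (Env.ofL K R L₀)).prod)) := by
  change gradient e nab Φ (polarization K R L₀ _) = _
  rw [polarization_prod, map_sum]
  rfl

/-- The element `φ ⊗ 1` of `J(L, R) ⊗_R Ŝym(L^∨)`. -/
noncomputable def tensorOne (φ : Jets K R L) : Env K R L₀ →ₗ[R] Jets K R L :=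
  (LinearMap.toSpanSingleton R (Jets K R L) φ) ∘ₗ Coalgebra.counit

end PBW

section PBWValue

variable {K R L L₀ : Type*} [Field K] [CommRing R] [Algebra K R]
  [LieRing L] [LieAlgebra K L] [Module R L] [LieRingModule L R]
  [LieRinehartRing R L] [LieRinehartAlgebra K R L]
  [LieRing L₀] [LieAlgebra K L₀] [Module R L₀] [LieRingModule L₀ R]
  [LieRinehartRing R L₀] [LieRinehartAlgebra K R L₀] [IsAbelian R L₀]

/-- The value on `X₁ ⋯ Xₙ ∈ Symⁿ(L)` of the formal series `∑ₙ (1 / n!) (Dⁿ (φ ⊗ 1))(1)`. -/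
noncomputable def pbwValue (e : L₀ ≃ₗ[R] L) (nab : Connection K R L L) (φ : Jets K R L)
    (l : List L₀) : R :=
  ((l.length.factorial : K)⁻¹) •
    Jets.eval ((symmetrized e nab)^[l.length] (tensorOne φ) (l.map (Env.ofL K R L₀)).prod) 1

end PBWValue

section Sheaves

open CategoryTheory Opposite TopologicalSpace AlgebraicGeometry
open scoped LieRinehartAlgebra

section LieAlgebroids

/-- A structure of sheaf of `K`-algebras on the structure sheaf of a ringed space. -/
class SpaceOver (K : Type u) [Field K] (X : RingedSpace.{u, u}) where
  structureHom : K →+* X.presheaf.obj (op ⊤)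

/-- Sections over `U` of the structure sheaf. -/
def Fn (X : RingedSpace.{u, u}) (U : Opens X) : Type u := X.presheaf.obj (op U)

noncomputable instance (X : RingedSpace.{u, u}) (U : Opens X) : CommRing (Fn X U) :=
  inferInstanceAs (CommRing (X.presheaf.obj (op U)))

variable (K : Type u) [Field K] {X : RingedSpace.{u, u}} [SpaceOver K X]

noncomputable instance (U : Opens X) : Algebra K (Fn X U) :=
  RingHom.toAlgebra ((X.presheaf.map (homOfLE (le_top : U ≤ ⊤)).op).hom.comp
    (SpaceOver.structureHom (K := K) (X := X)))

/-- Restriction of functions. -/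
noncomputable def resFn {U V : Opens X} (h : V ≤ U) : Fn X U →ₐ[K] Fn X V where
  __ := (X.presheaf.map (homOfLE h).op).hom
  commutes' c := by
    change (X.presheaf.map (homOfLE h).op).hom ((X.presheaf.map (homOfLE (le_top : U ≤ ⊤)).op).hom _)
      = (X.presheaf.map (homOfLE (le_top : V ≤ ⊤)).op).hom _
    rw [← CommRingCat.comp_apply, ← X.presheaf.map_comp]
    rfl

theorem resFn_self {U : Opens X} (f : Fn X U) : resFn K (le_refl U) f = f := by
  change (X.presheaf.map (𝟙 (op U))).hom f = f
  rw [X.presheaf.map_id]; rfl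

theorem resFn_resFn {U V W : Opens X} (h : V ≤ U) (h' : W ≤ V) (f : Fn X U) :
    resFn K h' (resFn K h f) = resFn K (h'.trans h) f :=
  (ConcreteCategory.congr_hom (X.presheaf.map_comp (homOfLE h).op (homOfLE h').op) f).symm

/-- The structure sheaf of a ringed space, as a sheaf of rings. -/
abbrev ringSheaf (X : RingedSpace.{u, u}) : TopCat.Sheaf RingCat.{u} X.carrier :=
  (sheafCompose _ (forget₂ CommRingCat RingCat.{u})).obj X.sheaf

section Modules

variable {K} (M : SheafOfModules.{u} (ringSheaf X))

/-- Sections over `U` of a sheaf of modules. -/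
def ModSec (U : Opens X) : Type u := M.val.obj (op U)

noncomputable instance (U : Opens X) : AddCommGroup (ModSec M U) :=
  inferInstanceAs (AddCommGroup (M.val.obj (op U)))

noncomputable instance (U : Opens X) : Module (Fn X U) (ModSec M U) :=
  inferInstanceAs (Module ((ringSheaf X).obj.obj (op U)) (M.val.obj (op U)))

noncomputable instance (U : Opens X) : Module K (ModSec M U) :=
  Module.compHom _ (algebraMap K (Fn X U))

instance (U : Opens X) : IsScalarTower K (Fn X U) (ModSec M U) where
  smul_assoc c f m := by
    rw [Algebra.smul_def, mul_smul]; rfl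

/-- Restriction of sections of a sheaf of modules. -/
noncomputable def resMod {U V : Opens X} (h : V ≤ U) : ModSec M U →+ ModSec M V :=
  (M.val.map (homOfLE h).op).hom.toAddMonoidHom

theorem resMod_smul {U V : Opens X} (h : V ≤ U) (f : Fn X U) (m : ModSec M U) :
    resMod M h (f • m) = resFn K h f • resMod M h m :=
  M.val.map_smul (homOfLE h).op f m

theorem resMod_self {U : Opens X} (m : ModSec M U) : resMod M (le_refl U) m = m := by
  have : M.val.presheaf.map (𝟙 (op U)) = 𝟙 _ := M.val.presheaf.map_id _
  exact ConcreteCategory.congr_hom this m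

theorem resMod_resMod {U V W : Opens X} (h : V ≤ U) (h' : W ≤ V) (m : ModSec M U) :
    resMod M h' (resMod M h m) = resMod M (h'.trans h) m :=
  (M.val.map_comp_apply (homOfLE h).op (homOfLE h').op m).symm

end Modules

variable (X) in
/-- A Lie algebroid over a ringed space `X` over `K`: a sheaf of `𝒪_X`-modules with a structure of
Lie-Rinehart algebra on its sections over every open set, compatible with restriction. -/
structure LieAlgebroid where
  toSheaf : SheafOfModules.{u} (ringSheaf X)
  /-- The Lie bracket. -/
  bracket (U : Opens X) : ModSec toSheaf U →ₗ[K] ModSec toSheaf U →ₗ[K] ModSec toSheaf U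
  /-- The anchor. -/
  anchor (U : Opens X) : ModSec toSheaf U →ₗ[Fn X U] Derivation K (Fn X U) (Fn X U)
  bracket_self (U : Opens X) (x : ModSec toSheaf U) : bracket U x x = 0
  jacobi (U : Opens X) (x y z : ModSec toSheaf U) :
    bracket U x (bracket U y z) = bracket U (bracket U x y) z + bracket U y (bracket U x z)
  anchor_bracket (U : Opens X) (x y : ModSec toSheaf U) :
    anchor U (bracket U x y) = ⁅anchor U x, anchor U y⁆
  leibniz (U : Opens X) (x y : ModSec toSheaf U) (f : Fn X U) :
    bracket U x (f • y) = f • bracket U x y + anchor U x f • y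
  res_bracket {U V : Opens X} (h : V ≤ U) (x y : ModSec toSheaf U) :
    resMod toSheaf h (bracket U x y) = bracket V (resMod toSheaf h x) (resMod toSheaf h y)
  res_anchor {U V : Opens X} (h : V ≤ U) (x : ModSec toSheaf U) (f : Fn X U) :
    resFn K h (anchor U x f) = anchor V (resMod toSheaf h x) (resFn K h f)

variable {K}

namespace LieAlgebroid

section Sections

variable (L : LieAlgebroid K X)

/-- Sections over `U` of a Lie algebroid. -/
def Sec (U : Opens X) : Type u := ModSec L.toSheaf U

variable {L} {U : Opens X}

noncomputable instance : AddCommGroup (L.Sec U) := inferInstanceAs (AddCommGroup (ModSec L.toSheaf U))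

noncomputable instance : Module (Fn X U) (L.Sec U) :=
  inferInstanceAs (Module (Fn X U) (ModSec L.toSheaf U))

noncomputable instance : Module K (L.Sec U) := inferInstanceAs (Module K (ModSec L.toSheaf U))

instance : IsScalarTower K (Fn X U) (L.Sec U) :=
  inferInstanceAs (IsScalarTower K (Fn X U) (ModSec L.toSheaf U))

noncomputable instance : Bracket (L.Sec U) (L.Sec U) := ⟨fun x y => L.bracket U x y⟩

theorem lie_def (x y : L.Sec U) : ⁅x, y⁆ = L.bracket U x y := rfl

noncomputable instance : LieRing (L.Sec U) where
  add_lie x y z := DFunLike.congr_fun (map_add (L.bracket U) x y) z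
  lie_add x y z := map_add (L.bracket U x) y z
  lie_self x := L.bracket_self U x
  leibniz_lie x y z := L.jacobi U x y z

noncomputable instance : LieAlgebra K (L.Sec U) where
  lie_smul c x y := map_smul (L.bracket U x) c y

noncomputable instance : LieRingModule (L.Sec U) (Fn X U) where
  bracket x f := L.anchor U x f
  add_lie x y f := DFunLike.congr_fun (map_add (L.anchor U) x y) f
  lie_add x f g := map_add (L.anchor U x) f g
  leibniz_lie x y f := by
    have h := DFunLike.congr_fun (L.anchor_bracket U x y) f
    rw [Derivation.commutator_apply] at h
    exact (sub_eq_iff_eq_add.mp h.symm)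

theorem lie_fn_def (x : L.Sec U) (f : Fn X U) : ⁅x, f⁆ = L.anchor U x f := rfl

instance : LieRinehartRing (Fn X U) (L.Sec U) where
  lie_smul_eq_mul' f g x := DFunLike.congr_fun (map_smul (L.anchor U) f x) g
  leibniz_mul_right' x f g := by
    change L.anchor U x (f * g) = f * L.anchor U x g + L.anchor U x f * g
    rw [Derivation.leibniz, smul_eq_mul, smul_eq_mul, mul_comm g]
  leibniz_smul_right' x y f := L.leibniz U x y f

instance : LieRinehartAlgebra K (Fn X U) (L.Sec U) where
  smul_lie c x f := by
    rw [← algebraMap_smul (Fn X U) c x, LieRinehartRing.lie_smul_eq_mul, Algebra.smul_def]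
  lie_smul c x f := (L.anchor U x).map_smul c f

variable (L) in
/-- Restriction of sections of a Lie algebroid, as a morphism of Lie-Rinehart algebras. -/
noncomputable def res {V : Opens X} (h : V ≤ U) : L.Sec U →ₗ⁅resFn K h⁆ L.Sec V where
  toFun := resMod L.toSheaf h
  map_add' := map_add _
  map_smul' c x := by
    have := resMod_smul (K := K) L.toSheaf h (algebraMap K (Fn X U) c) x
    rw [AlgHom.commutes] at this
    exact this
  map_lie' {x y} := L.res_bracket h x y
  map_smul_apply' f x := resMod_smul (K := K) L.toSheaf h f x
  apply_lie' f x := L.res_anchor h x f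

theorem res_self (x : L.Sec U) : L.res (le_refl U) x = x := resMod_self _ x

theorem res_res {V W : Opens X} (h : V ≤ U) (h' : W ≤ V) (x : L.Sec U) :
    L.res h' (L.res h x) = L.res (h'.trans h) x := resMod_resMod _ h h' x

end Sections

variable (L : LieAlgebroid K X)

/-- The sheaf of modules of a Lie algebroid, as a Lie algebroid with zero bracket and anchor. -/
noncomputable def abelian : LieAlgebroid K X where
  toSheaf := L.toSheaf
  bracket U := 0
  anchor U := 0
  bracket_self U x := rfl
  jacobi U x y z := by simp
  anchor_bracket U x y := by simp
  leibniz U x y f := by simp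
  res_bracket h x y := by simp
  res_anchor h x f := by simp

instance (U : Opens X) : IsAbelian (Fn X U) (L.abelian.Sec U) where
  lie_eq_zero _ _ := rfl
  anchor_eq_zero _ _ := rfl

/-- The identity, between the sections of `L.abelian` and of `L`. -/
noncomputable def ofAbelian (U : Opens X) : L.abelian.Sec U ≃ₗ[Fn X U] L.Sec U :=
  LinearEquiv.refl (Fn X U) (ModSec L.toSheaf U)

/-- `L` is locally free of rank `r`: locally, there are `r` sections whose restrictions to every
smaller open set form a basis. -/
def IsLocallyFreeOfRank (r : ℕ) : Prop :=
  ∀ x : X, ∃ V : Opens X, x ∈ V ∧ ∃ e : Fin r → L.Sec V, ∀ (W : Opens X) (h : W ≤ V),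
    LinearIndependent (Fn X W) (fun i => L.res h (e i)) ∧
      Submodule.span (Fn X W) (Set.range fun i => L.res h (e i)) = ⊤

/-- An `L`-connection on the sheaf of modules `L`: a connection on the sections over every open set,
compatible with restriction. -/
structure Connection where
  onSections (U : Opens X) : LieRinehart.Connection K (Fn X U) (L.Sec U) (L.Sec U)
  res_onSections {U V : Opens X} (h : V ≤ U) (x y : L.Sec U) :
    L.res h ((onSections U).toFun y x) = (onSections V).toFun (L.res h y) (L.res h x)

end LieAlgebroid

end LieAlgebroids

section SmashMap

variable {K R L A R' L' A' : Type*} [CommRing K] [CommRing R] [Algebra K R] [LieRing L]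
  [LieAlgebra K L] [Module R L] [LieRingModule L R]
  [CommRing R'] [Algebra K R'] [LieRing L'] [LieAlgebra K L'] [Module R' L'] [LieRingModule L' R']
  [CommRing A] [Algebra K A] [Algebra R A] [Module (Env K R L) A] [IsScalarTower K R A]
  [EnvAlgebra K R L A]
  [CommRing A'] [Algebra K A'] [Algebra R' A'] [Module (Env K R' L') A'] [IsScalarTower K R' A']
  [EnvAlgebra K R' L' A']
  {σ : R →ₐ[K] R'} (g : L →ₗ⁅σ⁆ L') (f : A →ₐ[K] A')
  (hf : ∀ (r : R) (a : A), f (r • a) = σ r • f a)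
  (hL : ∀ (X : L) (a : A), f (Env.ofL K R L X • a) = Env.ofL K R' L' (g X) • f a)

/-- The map `a ⊗ D ↦ f(a) ⊗ g(D)`. -/
noncomputable def Smash.mapAux : A ⊗[R] Env K R L →+ A' ⊗[R'] Env K R' L' :=
  semiMap (σ : R →+* R') { f with map_smul' := hf } (Env.mapₛₗ g)

theorem Smash.mapAux_tmul (a : A) (D : Env K R L) :
    Smash.mapAux g f hf (a ⊗ₜ[R] D) = f a ⊗ₜ[R'] Env.map g D := rfl

theorem Smash.mapAux_tensorAct
    (hL : ∀ (X : L) (a : A), f (Env.ofL K R L X • a) = Env.ofL K R' L' (g X) • f a) (D : Env K R L) (t : A ⊗[R] Env K R L) :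
    Smash.mapAux g f hf (tensorAct D t) = tensorAct (Env.map g D) (Smash.mapAux g f hf t) :=
  semiMap_tensorAct g _ _ hL (fun X E => by
    change Env.map g (_ * _) = _ * Env.map g _
    rw [map_mul, Env.map_ofL]) D t

theorem Smash.mapAux_smul (a : A) (t : A ⊗[R] Env K R L) :
    Smash.mapAux g f hf (a • t) = f a • Smash.mapAux g f hf t := by
  induction t with
  | zero => simp
  | add x y hx hy => simp_all
  | tmul b D => simp [TensorProduct.smul_tmul', Smash.mapAux_tmul]

theorem Smash.mapAux_smulK (c : K) (t : A ⊗[R] Env K R L) :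
    Smash.mapAux g f hf (c • t) = c • Smash.mapAux g f hf t := by
  induction t with
  | zero => simp
  | add x y hx hy => simp_all
  | tmul b D => simp [TensorProduct.smul_tmul', Smash.mapAux_tmul]

theorem Smash.mapAux_mulLeft
    (hL : ∀ (X : L) (a : A), f (Env.ofL K R L X • a) = Env.ofL K R' L' (g X) • f a)
    (s t : A ⊗[R] Env K R L) :
    Smash.mapAux g f hf (Smash.mulLeft K R L A s t) =
      Smash.mulLeft K R' L' A' (Smash.mapAux g f hf s) (Smash.mapAux g f hf t) := by
  induction s with
  | zero => simp
  | add x y hx hy => simp_all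
  | tmul b D =>
    rw [Smash.mulLeft_tmul, Smash.mapAux_smul, Smash.mapAux_tensorAct g f hf hL,
      Smash.mapAux_tmul, Smash.mulLeft_tmul]

/-- The algebra homomorphism `a ⊗ D ↦ f(a) ⊗ g(D)`. -/
noncomputable def Smash.map : Smash K R L A →ₐ[K] Smash K R' L' A' :=
  AlgHom.ofLinearMap
    { toFun := fun t => (Smash.mapAux g f hf t : A' ⊗[R'] Env K R' L')
      map_add' := fun s t => map_add (Smash.mapAux g f hf) s t
      map_smul' := fun c t => Smash.mapAux_smulK g f hf c t }
    (by
      have := Smash.mapAux_tmul g f hf 1 1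
      rw [map_one, map_one] at this
      exact this)
    (fun s t => Smash.mapAux_mulLeft g f hf hL s t)

@[simp] theorem Smash.map_tmul (a : A) (D : Env K R L) :
    Smash.map g f hf hL (Smash.tmul a D) = Smash.tmul (f a) (Env.map g D) := rfl

end SmashMap

section Diff

variable {K : Type*} [CommRing K] {A : Type*} [CommRing A] [Algebra K A]

/-- Differential operators of order `< n` on a commutative `K`-algebra `A`. -/
def IsDiffOp : ℕ → Module.End K A → Prop
  | 0, D => D = 0
  | n + 1, D => ∀ a : A, IsDiffOp n (Algebra.lmul K A a * D - D * Algebra.lmul K A a)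

theorem IsDiffOp.zero : ∀ n, IsDiffOp n (0 : Module.End K A)
  | 0 => rfl
  | n + 1 => fun a => by simpa using IsDiffOp.zero n

theorem IsDiffOp.add : ∀ {n} {D E : Module.End K A}, IsDiffOp n D → IsDiffOp n E →
    IsDiffOp n (D + E)
  | 0, D, E, hD, hE => by
    have hD : D = 0 := hD
    have hE : E = 0 := hE
    rw [hD, hE, add_zero]; rfl
  | n + 1, D, E, hD, hE => fun a => by
    have := (hD a).add (hE a)
    rwa [show Algebra.lmul K A a * (D + E) - (D + E) * Algebra.lmul K A a =
      (Algebra.lmul K A a * D - D * Algebra.lmul K A a) +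
      (Algebra.lmul K A a * E - E * Algebra.lmul K A a) by noncomm_ring]

theorem IsDiffOp.succ : ∀ {n} {D : Module.End K A}, IsDiffOp n D → IsDiffOp (n + 1) D
  | 0, D, hD => fun a => by
    have hD : D = 0 := hD
    rw [hD]
    simpa using IsDiffOp.zero 0
  | n + 1, D, hD => fun a => (hD a).succ

theorem IsDiffOp.mono {n m : ℕ} (h : n ≤ m) {D : Module.End K A} (hD : IsDiffOp n D) :
    IsDiffOp m D := by
  induction m, h using Nat.le_induction with
  | base => exact hD
  | succ m _ ih => exact ih.succ

theorem IsDiffOp.mul : ∀ {n m} {D E : Module.End K A}, IsDiffOp n D → IsDiffOp m E →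
    IsDiffOp (n + m) (D * E)
  | 0, m, D, E, hD, hE => by
    have hD : D = 0 := hD
    rw [hD, zero_mul]; exact IsDiffOp.zero _
  | n + 1, 0, D, E, hD, hE => by
    have hE : E = 0 := hE
    rw [hE, mul_zero]; exact IsDiffOp.zero _
  | n + 1, m + 1, D, E, hD, hE => fun a => by
    have h₁ : IsDiffOp (n + 1 + m) _ := ((hD a).mul hE).mono (by omega)
    have h₂ : IsDiffOp (n + 1 + m) _ := hD.mul (hE a)
    have := h₁.add h₂
    rwa [show Algebra.lmul K A a * (D * E) - D * E * Algebra.lmul K A a =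
      (Algebra.lmul K A a * D - D * Algebra.lmul K A a) * E +
      D * (Algebra.lmul K A a * E - E * Algebra.lmul K A a) by
        rw [sub_mul, mul_sub]; simp only [mul_assoc]; abel]

theorem IsDiffOp.algebraMap (c : K) : IsDiffOp 1 (algebraMap K (Module.End K A) c) := fun a => by
  change _ = _
  rw [Algebra.commutes, sub_self]

end Diff

section JetSheaf

variable {K : Type u} [Field K] {X : RingedSpace.{u, u}} [SpaceOver K X]

namespace LieAlgebroid

variable (L : LieAlgebroid K X)

/-- The universal enveloping algebra of the sections over `V`. -/
abbrev Univ (V : Opens X) : Type u := Env K (Fn X V) (L.Sec V)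

theorem map_res_self {V : Opens X} (D : L.Univ V) : Env.map (L.res (le_refl V)) D = D := by
  induction D using Env.induction with
  | hR r => rw [Env.map_ofR, resFn_self]
  | hL x => rw [Env.map_ofL, res_self]
  | hadd a b ha hb => rw [map_add, ha, hb]
  | hmul a b ha hb => rw [map_mul, ha, hb]

theorem map_res_res {U V W : Opens X} (h : V ≤ U) (h' : W ≤ V) (D : L.Univ U) :
    Env.map (L.res h') (Env.map (L.res h) D) = Env.map (L.res (h'.trans h)) D := by
  induction D using Env.induction with
  | hR r => simp only [Env.map_ofR, resFn_resFn]
  | hL x => simp only [Env.map_ofL, res_res]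
  | hadd a b ha hb => simp only [map_add, ha, hb]
  | hmul a b ha hb => simp only [map_mul, ha, hb]

/-- Families of jets on the open subsets of `V`, compatible with restriction. -/
noncomputable def jetSubalgebra (V : Opens X) :
    Subalgebra K (∀ W : {W : Opens X // W ≤ V}, Jets K (Fn X W.1) (L.Sec W.1)) where
  carrier := {φ | ∀ (W W' : {W : Opens X // W ≤ V}) (h : W'.1 ≤ W.1),
    Jets.Compatible (L.res h) (φ W) (φ W')}
  mul_mem' hφ hψ W W' h := (hφ W W' h).mul (hψ W W' h)
  add_mem' hφ hψ W W' h := (hφ W W' h).add (hψ W W' h)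
  algebraMap_mem' c W W' h := Jets.Compatible.algebraMap (L.res h) c

/-- Sections over `V` of the sheaf of jets `J(L) = Hom_{𝒪_X}(U(L), 𝒪_X)`: compatible families of
elements of `J(L(W), 𝒪_X(W))` for `W ⊆ V`. -/
def Jet (V : Opens X) : Type u := L.jetSubalgebra V

namespace Jet

variable {L} {V : Opens X}

noncomputable instance : CommRing (L.Jet V) := inferInstanceAs (CommRing (L.jetSubalgebra V))
noncomputable instance : Algebra K (L.Jet V) := inferInstanceAs (Algebra K (L.jetSubalgebra V))

/-- The value on `W ⊆ V` of a section over `V`. -/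
noncomputable def val {W : Opens X} (h : W ≤ V) : L.Jet V →ₐ[K] Jets K (Fn X W) (L.Sec W) :=
  (Pi.evalAlgHom K _ (⟨W, h⟩ : {W : Opens X // W ≤ V})).comp (L.jetSubalgebra V).val

theorem ext {φ ψ : L.Jet V} (h : ∀ (W : Opens X) (hW : W ≤ V), val hW φ = val hW ψ) : φ = ψ :=
  Subtype.ext (funext fun W => h W.1 W.2)

theorem val_compatible (φ : L.Jet V) {W W' : Opens X} (hW : W ≤ V) (h : W' ≤ W) :
    Jets.Compatible (L.res h) (val hW φ) (val (h.trans hW) φ) :=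
  φ.2 ⟨W, hW⟩ ⟨W', h.trans hW⟩ h

/-- The section with given values. -/
def mk (φ : ∀ W : Opens X, W ≤ V → Jets K (Fn X W) (L.Sec W))
    (hφ : ∀ (W W' : Opens X) (hW : W ≤ V) (h : W' ≤ W),
      Jets.Compatible (L.res h) (φ W hW) (φ W' (h.trans hW))) : L.Jet V :=
  ⟨fun W => φ W.1 W.2, fun W W' h => hφ W.1 W'.1 W.2 h⟩

@[simp] theorem val_mk (φ : ∀ W : Opens X, W ≤ V → Jets K (Fn X W) (L.Sec W))
    (hφ : ∀ (W W' : Opens X) (hW : W ≤ V) (h : W' ≤ W),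
      Jets.Compatible (L.res h) (φ W hW) (φ W' (h.trans hW))) {W : Opens X} (hW : W ≤ V) :
    val hW (mk φ hφ) = φ W hW := rfl

/-- Restriction of sections of the sheaf of jets. -/
noncomputable def res {V' : Opens X} (h : V' ≤ V) : L.Jet V →ₐ[K] L.Jet V' where
  toFun φ := mk (fun W hW => val (hW.trans h) φ) (fun W W' hW h' => val_compatible φ (hW.trans h) h')
  map_one' := rfl
  map_zero' := rfl
  map_add' φ ψ := rfl
  map_mul' φ ψ := rfl
  commutes' c := rfl

@[simp] theorem val_res {V' W : Opens X} (h : V' ≤ V) (hW : W ≤ V') (φ : L.Jet V) :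
    val hW (res h φ) = val (hW.trans h) φ := rfl

/-- The second action of `U(L)` on `J(L)`. -/
noncomputable instance : Module (L.Univ V) (L.Jet V) where
  smul D φ := mk (fun W hW => Env.map (L.res hW) D • val hW φ) (fun W W' hW h => by
    rw [← L.map_res_res hW h D]
    exact (val_compatible φ hW h).smul _)
  one_smul φ := ext fun W hW => by
    change Env.map (L.res hW) 1 • val hW φ = _
    rw [map_one, one_smul]
  mul_smul D D' φ := ext fun W hW => by
    change Env.map (L.res hW) (D * D') • val hW φ =
      Env.map (L.res hW) D • (Env.map (L.res hW) D' • val hW φ)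
    rw [map_mul, mul_smul]
  smul_zero D := ext fun W hW => smul_zero (Env.map (L.res hW) D)
  smul_add D φ ψ := ext fun W hW => smul_add (Env.map (L.res hW) D) (val hW φ) (val hW ψ)
  add_smul D D' φ := ext fun W hW => by
    change Env.map (L.res hW) (D + D') • val hW φ =
      Env.map (L.res hW) D • val hW φ + Env.map (L.res hW) D' • val hW φ
    rw [map_add, add_smul]
  zero_smul φ := ext fun W hW => by
    change Env.map (L.res hW) 0 • val hW φ = 0
    rw [map_zero, zero_smul]

@[simp] theorem val_smul {W : Opens X} (hW : W ≤ V) (D : L.Univ V) (φ : L.Jet V) :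
    val hW (D • φ) = Env.map (L.res hW) D • val hW φ := rfl

theorem res_smul {V' : Opens X} (h : V' ≤ V) (D : L.Univ V) (φ : L.Jet V) :
    res h (D • φ) = Env.map (L.res h) D • res h φ := ext fun W hW => by
  simp [L.map_res_res]

variable (L V)

/-- The first map `𝒪_X → J(L)`. -/
noncomputable def α₁ : Fn X V →ₐ[K] L.Jet V where
  toFun f := mk (fun W hW => Jets.α₁ K _ _ (resFn K hW f)) (fun W W' hW h => by
    rw [← resFn_resFn K hW h]
    exact Jets.Compatible.alpha₁ _ _)
  map_one' := ext fun W hW => by simp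
  map_zero' := ext fun W hW => by simp
  map_add' f g := ext fun W hW => by simp
  map_mul' f g := ext fun W hW => by simp
  commutes' c := ext fun W hW => by simp

/-- The second map `𝒪_X → J(L)`. -/
noncomputable def α₂ : Fn X V →ₐ[K] L.Jet V where
  toFun f := mk (fun W hW => Jets.α₂ K _ _ (resFn K hW f)) (fun W W' hW h => by
    rw [← resFn_resFn K hW h]
    exact Jets.Compatible.alpha₂ _ _)
  map_one' := ext fun W hW => by simp
  map_zero' := ext fun W hW => by simp
  map_add' f g := ext fun W hW => by simp
  map_mul' f g := ext fun W hW => by simp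
  commutes' c := ext fun W hW => by simp

variable {L V}

@[simp] theorem val_α₁ {W : Opens X} (hW : W ≤ V) (f : Fn X V) :
    val hW (α₁ L V f) = Jets.α₁ K _ _ (resFn K hW f) := rfl

@[simp] theorem val_α₂ {W : Opens X} (hW : W ≤ V) (f : Fn X V) :
    val hW (α₂ L V f) = Jets.α₂ K _ _ (resFn K hW f) := rfl

/-- `J(L)` is regarded as a sheaf of `𝒪_X`-algebras through the second map. -/
noncomputable instance : Algebra (Fn X V) (L.Jet V) := (α₂ L V).toRingHom.toAlgebra

instance : IsScalarTower K (Fn X V) (L.Jet V) :=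
  IsScalarTower.of_algebraMap_eq' (α₂ L V).comp_algebraMap.symm

theorem val_smulFn {W : Opens X} (hW : W ≤ V) (f : Fn X V) (φ : L.Jet V) :
    val hW (f • φ) = resFn K hW f • val hW φ := by
  rw [Algebra.smul_def, map_mul, Algebra.smul_def]
  rfl

theorem res_smulFn {V' : Opens X} (h : V' ≤ V) (f : Fn X V) (φ : L.Jet V) :
    res h (f • φ) = resFn K h f • res h φ := ext fun W hW => by
  rw [val_res, val_smulFn, val_smulFn, resFn_resFn, val_res]

instance : EnvAlgebra K (Fn X V) (L.Sec V) (L.Jet V) where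
  smul_assoc f D φ := ext fun W hW => by
    rw [val_smulFn, val_smul, val_smul, Env.map_smul, smul_assoc]
  ofL_smul_mul x φ ψ := ext fun W hW => by
    simp [Jets.ofL_smul_mul]

end Jet

/-- The sheaf of jets `J(L)`, as a presheaf of `K`-algebras. -/
noncomputable def jetSheaf : (Opens X)ᵒᵖ ⥤ AlgCat.{u} K where
  obj V := AlgCat.of K (L.Jet V.unop)
  map i := AlgCat.ofHom (Jet.res i.unop.le)
  map_id V := rfl
  map_comp i j := rfl

/-- The sections over `V` of the presheaf tensor product `J(L) ⊗ U(L)`. -/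
abbrev JU (V : Opens X) : Type u := Smash K (Fn X V) (L.Sec V) (L.Jet V)

/-- Restriction maps of the presheaf `J(L) ⊗ U(L)`. -/
noncomputable def resJU {V V' : Opens X} (h : V' ≤ V) : L.JU V →ₐ[K] L.JU V' :=
  Smash.map (L.res h) (Jet.res h) (Jet.res_smulFn h) (fun x φ => by
    rw [Jet.res_smul, Env.map_ofL])

/-- The presheaf `V ↦ J(L)(V) ⊗_{𝒪_X(V)} U(L(V), 𝒪_X(V))` of `K`-algebras, where `J(L)` is an
`𝒪_X`-module through `α₂`. -/
noncomputable def presheafJU : (Opens X)ᵒᵖ ⥤ AlgCat.{u} K where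
  obj V := AlgCat.of K (L.JU V.unop)
  map i := AlgCat.ofHom (L.resJU i.unop.le)
  map_id V := by
    refine AlgCat.hom_ext _ (AlgHom.ext fun t => ?_)
    induction t using Smash.induction with
    | h0 => exact map_zero _
    | ht φ D => exact congrArg (Smash.tmul φ) (L.map_res_self D)
    | hadd s t hs ht => exact (map_add _ s t).trans (congrArg₂ _ hs ht)
  map_comp i j := by
    refine AlgCat.hom_ext _ (AlgHom.ext fun t => ?_)
    induction t using Smash.induction with
    | h0 => exact (map_zero _).trans (map_zero _).symm
    | ht φ D => exact congrArg (Smash.tmul _) (L.map_res_res i.unop.le j.unop.le D).symm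
    | hadd s t hs ht =>
      exact (map_add _ s t).trans ((congrArg₂ _ hs ht).trans (map_add _ s t).symm)

/-- The sheaf of algebras `J(L) ⊗_{𝒪_{X₂}} U(L)`. -/
noncomputable def sheafJU : (Opens X)ᵒᵖ ⥤ AlgCat.{u} K :=
  sheafify (Opens.grothendieckTopology X) L.presheafJU

/-- The section `φ ⊗ D` of `J(L) ⊗_{𝒪_{X₂}} U(L)`. -/
noncomputable def tmul {V : Opens X} (φ : L.Jet V) (D : L.Univ V) : L.sheafJU.obj (op V) :=
  ((toSheafify (Opens.grothendieckTopology X) L.presheafJU).app (op V)).hom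
    (Smash.tmul φ D : L.JU V)

/-- Sections over `V` of the sheaf `Diff_{𝒪_{X₁}}(J(L))` of differential operators on the sheaf of
algebras `J(L)`, as families of endomorphisms of the sections over the open subsets of `V` which
are linear over `𝒪_X` (acting through `α₁`), compatible with restriction, and locally of finite
order. -/
noncomputable def diffSubalgebra (V : Opens X) :
    Subalgebra K (∀ W : {W : Opens X // W ≤ V}, Module.End K (L.Jet W.1)) where
  carrier := {D |
    (∀ (W : {W : Opens X // W ≤ V}) (f : Fn X W.1) (φ : L.Jet W.1),
      D W (Jet.α₁ L W.1 f * φ) = Jet.α₁ L W.1 f * D W φ) ∧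
    (∀ (W W' : {W : Opens X // W ≤ V}) (h : W'.1 ≤ W.1) (φ : L.Jet W.1),
      Jet.res h (D W φ) = D W' (Jet.res h φ)) ∧
    (∀ x ∈ V, ∃ V' : Opens X, x ∈ V' ∧ ∃ n, ∀ W : {W : Opens X // W ≤ V}, W.1 ≤ V' →
      IsDiffOp n (D W))}
  mul_mem' := by
    rintro D E ⟨hD₁, hD₂, hD₃⟩ ⟨hE₁, hE₂, hE₃⟩
    refine ⟨fun W f φ => ?_, fun W W' h φ => ?_, fun x hx => ?_⟩
    · simp [hD₁, hE₁]
    · simp [hD₂ W W' h, hE₂ W W' h]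
    · obtain ⟨V₁, hx₁, n, hn⟩ := hD₃ x hx
      obtain ⟨V₂, hx₂, m, hm⟩ := hE₃ x hx
      exact ⟨V₁ ⊓ V₂, ⟨hx₁, hx₂⟩, n + m, fun W hW =>
        (hn W (hW.trans inf_le_left)).mul (hm W (hW.trans inf_le_right))⟩
  add_mem' := by
    rintro D E ⟨hD₁, hD₂, hD₃⟩ ⟨hE₁, hE₂, hE₃⟩
    refine ⟨fun W f φ => ?_, fun W W' h φ => ?_, fun x hx => ?_⟩
    · simp [hD₁, hE₁, mul_add]
    · simp [hD₂ W W' h, hE₂ W W' h]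
    · obtain ⟨V₁, hx₁, n, hn⟩ := hD₃ x hx
      obtain ⟨V₂, hx₂, m, hm⟩ := hE₃ x hx
      exact ⟨V₁ ⊓ V₂, ⟨hx₁, hx₂⟩, n + m, fun W hW =>
        ((hn W (hW.trans inf_le_left)).mono (by omega)).add
          ((hm W (hW.trans inf_le_right)).mono (by omega))⟩
  algebraMap_mem' c := by
    refine ⟨fun W f φ => ?_, fun W W' h φ => ?_, fun x hx => ⟨V, hx, 1, fun W hW => ?_⟩⟩
    · simp
    · simp
    · exact IsDiffOp.algebraMap c

/-- Sections over `V` of `Diff_{𝒪_{X₁}}(J(L))`. -/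
abbrev Diff (V : Opens X) : Type u := L.diffSubalgebra V

variable {L} in
/-- The action on sections over `W ⊆ V` of a differential operator on `V`. -/
noncomputable def Diff.val {V W : Opens X} (h : W ≤ V) :
    L.Diff V →ₐ[K] Module.End K (L.Jet W) :=
  (Pi.evalAlgHom K (fun W : {W : Opens X // W ≤ V} => Module.End K (L.Jet W.1)) ⟨W, h⟩).comp
    (L.diffSubalgebra V).val

variable {L} in
/-- Restriction of differential operators. -/
noncomputable def Diff.res {V V' : Opens X} (h : V' ≤ V) : L.Diff V →ₐ[K] L.Diff V' where
  toFun D := ⟨fun W => D.1 ⟨W.1, W.2.trans h⟩,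
    fun W f φ => D.2.1 ⟨W.1, W.2.trans h⟩ f φ,
    fun W W' h' φ => D.2.2.1 ⟨W.1, W.2.trans h⟩ ⟨W'.1, W'.2.trans h⟩ h' φ,
    fun x hx => by
      obtain ⟨V₁, hx₁, n, hn⟩ := D.2.2.2 x (h hx)
      exact ⟨V₁, hx₁, n, fun W hW => hn ⟨W.1, W.2.trans h⟩ hW⟩⟩
  map_one' := rfl
  map_zero' := rfl
  map_add' D E := rfl
  map_mul' D E := rfl
  commutes' c := rfl

/-- The sheaf of algebras `Diff_{𝒪_{X₁}}(J(L))`. -/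
noncomputable def diffSheaf : (Opens X)ᵒᵖ ⥤ AlgCat.{u} K where
  obj V := AlgCat.of K (L.Diff V.unop)
  map i := AlgCat.ofHom (Diff.res i.unop.le)
  map_id V := rfl
  map_comp i j := rfl

end LieAlgebroid

end JetSheaf

section DegOne

variable {K R L R' L' : Type*} [CommRing K] [CommRing R] [Algebra K R] [LieRing L]
  [LieAlgebra K L] [Module R L] [LieRingModule L R] [IsAbelian R L] [IsScalarTower K R L]
  [CommRing R'] [Algebra K R'] [LieRing L'] [LieAlgebra K L'] [Module R' L'] [LieRingModule L' R']
  [IsAbelian R' L'] [IsScalarTower K R' L']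
  {σ : R →ₐ[K] R'} (g : L →ₗ⁅σ⁆ L')

theorem degOne_map (P : Env K R L) : degOne K R' L' (Env.map g P) = g (degOne K R L P) := by
  have h : ∀ v : R × L, degOneAct K R' L' (Env.map g P) (σ v.1, g v.2) =
      (σ (degOneAct K R L P v).1, g (degOneAct K R L P v).2) := by
    induction P using Env.induction with
    | hR r =>
      intro v
      have := g.map_smul_apply' r v.2
      simp_all [degOneAct]
    | hL x =>
      intro v
      have := g.map_smul_apply' v.1 x
      simp_all [degOneAct]
    | hadd a b ha hb => intro v; simp [ha, hb]
    | hmul a b ha hb => intro v; simp [ha, hb]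
  have := congrArg Prod.snd (h (1, 0))
  simp only [map_one, map_zero] at this
  exact this

end DegOne

section SymHat

variable {K : Type u} [Field K] {X : RingedSpace.{u, u}} [SpaceOver K X]

namespace LieAlgebroid

variable (L : LieAlgebroid K X)

/-- Linear forms on `L` over the open subsets of `V`, compatible with restriction. -/
def dualSubgroup (V : Opens X) :
    AddSubgroup (∀ W : {W : Opens X // W ≤ V}, L.Sec W.1 →ₗ[Fn X W.1] Fn X W.1) where
  carrier := {ξ | ∀ (W W' : {W : Opens X // W ≤ V}) (h : W'.1 ≤ W.1) (x : L.Sec W.1),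
    resFn K h (ξ W x) = ξ W' (L.res h x)}
  add_mem' hξ hη W W' h x := by simp [hξ W W' h, hη W W' h]
  zero_mem' W W' h x := by simp
  neg_mem' hξ W W' h x := by simp [hξ W W' h]

/-- Sections over `V` of the dual sheaf `L^∨ = Hom_{𝒪_X}(L, 𝒪_X)`. -/
def Dual (V : Opens X) : Type u := L.dualSubgroup V

namespace Dual

variable {L} {V : Opens X}

noncomputable instance : AddCommGroup (L.Dual V) := inferInstanceAs (AddCommGroup (L.dualSubgroup V))

/-- The linear form on the sections over `W ⊆ V`. -/
def val {W : Opens X} (h : W ≤ V) (ξ : L.Dual V) : L.Sec W →ₗ[Fn X W] Fn X W := ξ.1 ⟨W, h⟩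

theorem ext {ξ η : L.Dual V} (h : ∀ (W : Opens X) (hW : W ≤ V), val hW ξ = val hW η) : ξ = η :=
  Subtype.ext (funext fun W => h W.1 W.2)

theorem res_val (ξ : L.Dual V) {W W' : Opens X} (hW : W ≤ V) (h : W' ≤ W) (x : L.Sec W) :
    resFn K h (val hW ξ x) = val (h.trans hW) ξ (L.res h x) :=
  ξ.2 ⟨W, hW⟩ ⟨W', h.trans hW⟩ h x

noncomputable instance : Module (Fn X V) (L.Dual V) where
  smul f ξ := ⟨fun W => resFn K W.2 f • ξ.1 W, fun W W' h x => by
    have := ξ.2 W W' h x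
    simp [this, resFn_resFn]⟩
  one_smul ξ := ext fun W hW => by
    change resFn K hW 1 • val hW ξ = _
    rw [map_one, one_smul]
  mul_smul f g ξ := ext fun W hW => by
    change resFn K hW (f * g) • val hW ξ = resFn K hW f • resFn K hW g • val hW ξ
    rw [map_mul, mul_smul]
  smul_zero f := ext fun W hW => smul_zero (resFn K hW f)
  smul_add f ξ η := ext fun W hW => smul_add (resFn K hW f) (val hW ξ) (val hW η)
  add_smul f g ξ := ext fun W hW => by
    change resFn K hW (f + g) • val hW ξ = resFn K hW f • val hW ξ + resFn K hW g • val hW ξ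
    rw [map_add, add_smul]
  zero_smul ξ := ext fun W hW => by
    change resFn K hW 0 • val hW ξ = 0
    rw [map_zero, zero_smul]

end Dual

/-- Sections over `V` of the completed symmetric algebra of `L^∨`, the sheaf of jets of `L` with zero
bracket and zero anchor. -/
abbrev SymHat (V : Opens X) : Type u := L.abelian.Jet V

/-- The map `L^∨ → Ŝym(L^∨)`; a linear form on `L` is extended by zero to the components of
`Sym(L)` of degree different from `1`. -/
noncomputable def dualToSymHat (V : Opens X) : L.Dual V →ₗ[Fn X V] L.SymHat V where
  toFun ξ := Jet.mk
    (fun W hW => Jets.of (ξ.val hW ∘ₗ (L.ofAbelian W).toLinearMap ∘ₗ degOne K _ _))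
    (fun W W' hW h P => by
      simp only [Jets.eval_of, LinearMap.comp_apply, degOne_map]
      exact (ξ.res_val hW h _).symm)
  map_add' ξ η := Jet.ext fun W hW => rfl
  map_smul' f ξ := Jet.ext fun W hW => Jets.ext fun P => by
    rw [RingHom.id_apply, Jet.val_smulFn, Jets.eval_smulR, Env.mul_comm_of_isAbelian,
      ← Env.smul_def]
    exact ((ξ.val hW ∘ₗ (L.ofAbelian W).toLinearMap ∘ₗ degOne K _ _).map_smul
      (resFn K hW f) P).symm

/-- The map `Sym(L^∨) → Ŝym(L^∨)`. -/
noncomputable def symToSymHat (V : Opens X) :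
    SymmetricAlgebra (Fn X V) (L.Dual V) →ₐ[Fn X V] L.SymHat V :=
  SymmetricAlgebra.lift (L.dualToSymHat V)

/-- The ideal of `Sym(L^∨)` of elements without constant term. -/
noncomputable def augIdeal (V : Opens X) : Ideal (SymmetricAlgebra (Fn X V) (L.Dual V)) :=
  Ideal.span (Set.range (SymmetricAlgebra.ι (Fn X V) (L.Dual V)))

end LieAlgebroid

end SymHat

end Sheaves

end LieRinehart

open CategoryTheory Opposite TopologicalSpace AlgebraicGeometry LieRinehart

namespace LieRinehart

/-! ### An action of `U(L, R)` on polynomials when `L` is free -/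

section PBWAction

variable {K R L : Type*} [CommRing K] [CommRing R] [Algebra K R] [LieRing L] [LieAlgebra K L]
  [Module R L] [LieRingModule L R] [LieRinehartRing R L] [LieRinehartAlgebra K R L]

/-! The heart is local: `L` is free over `R` with basis `e_1, …, e_r`. Jets are filtered by order of
vanishing on products of elements of `L`, and everything follows from three properties of this
filtration: it is separated, it is complete, and its leading terms are homogeneous polynomials in
`r` coordinates.

The coordinates are jets `ξ_k` with `ξ_k(1) = 0` and `ξ_k(e_i) = δ_ik`. To know that they exist one
lets `U(L, R)` act on the free `R`-module of polynomials, as in the classical proof of the PBW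
theorem, and reads off the coefficient of `x_k` in `D · 1` (`exists_dual_jets`). By the Leibniz
rule, `ξ^b` vanishes to order `|b|` and pairs diagonally with the ordered monomials of degree `|b|`,
with nonzero integers on the diagonal (`IsDual.eval_jetMon`). In characteristic zero these integers
are invertible. Hence the ordered monomials are a basis of `U(L, R)`, jets can be prescribed freely
on them, and a jet has a Taylor expansion in the `ξ_k` (`IsDual.exists_approx`).

For `j_∇`: the commutators of the symmetrized connection `D` with contractions are derivations of
the convolution product, which forces `D` to be a derivation (`isConvDer_symDer`). The exponential
of a derivation is multiplicative (`expJet_mul`), and `D` kills `α₁(f) ⊗ 1`. On `Y_1 ⋯ Y_n`, the jet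
`D^n(φ ⊗ 1)` is `n! Y_1 ⋯ Y_n` applied to `φ`, up to operators of lower order
(`exists_iterate_symDer_eq`). So `j_∇` is the identity on leading terms, and completeness makes it
bijective.

For differential operators: `J ⊗ U` acts on `J`, faithfully because jets dual to the monomials
isolate the leading terms of the coefficients (`IsDual.act_injective`). An `α₁`-linear operator of
order `< n` is determined by its values on `ξ^b` for `|b| < n` (`IsDual.eq_zero_of_isDiffOp`). All
such values are attained, since this amounts to a linear system over the jets whose matrix is the
identity modulo jets without constant term (`IsDual.exists_act_eq`). Conjugation by `j_∇` then gives
the third conclusion, and the case of zero bracket and anchor gives the Weyl algebra.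

To pass to sheaves, over an open set with a frame the sections of the sheaf of jets are the jets of
the sections (`IsFrame.valEquiv`). Jets and differential operators glue, so local bijectivity
suffices: for `j_∇` by gluing unique preimages, for `J ⊗ U` because a locally bijective map to a
sheaf induces an isomorphism from the sheafification. The completion statement says that the powers
of the augmentation ideal are induced by the order of vanishing and that polynomials are dense. -/

theorem anchor_one (X : L) : ⁅X, (1 : R)⁆ = 0 := by
  have := LieRinehartRing.leibniz_mul_right X (1 : R) 1
  simpa using this

theorem anchor_algebraMap (X : L) (c : K) : ⁅X, algebraMap K R c⁆ = 0 := by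
  rw [← LieRinehartAlgebra.anchor_apply (R := K), Derivation.map_algebraMap]

namespace PBWAction

open Finsupp

variable {r : ℕ}

/-- The free `R`-module on the monomials in `r` variables. -/
abbrev Poly (R : Type*) [CommRing R] (r : ℕ) : Type _ := Multiset (Fin r) →₀ R

variable (e : Module.Basis (Fin r) R L)

/-- The operator on `Poly R r` given by `X`, when the values `T i s` of the basis elements on the
monomials are prescribed, extended by `X (a m) = a X(m) + X(a) m`. -/
noncomputable def op (T : Fin r → Multiset (Fin r) → Poly R r) (X : L) : Poly R r →+ Poly R r :=
  Finsupp.liftAddHom fun s => AddMonoidHom.mk'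
    (fun a => a • e.constr R (fun i => T i s) X + single s ⁅X, a⁆)
    (fun a b => by rw [lie_add, single_add, add_smul]; abel)

variable {e} {T : Fin r → Multiset (Fin r) → Poly R r}

theorem op_single (X : L) (s : Multiset (Fin r)) (a : R) :
    op e T X (single s a) = a • e.constr R (fun i => T i s) X + single s ⁅X, a⁆ := by
  simp [op]

theorem op_basis_single (i : Fin r) (s : Multiset (Fin r)) :
    op e T (e i) (single s 1) = T i s := by
  rw [op_single, anchor_one, single_zero, add_zero, one_smul, Module.Basis.constr_basis]

theorem op_smul_right (X : L) (f : R) (m : Poly R r) :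
    op e T X (f • m) = f • op e T X m + ⁅X, f⁆ • m := by
  induction m using Finsupp.induction_linear with
  | zero => simp
  | add x y hx hy => rw [smul_add, map_add, map_add, hx, hy]; simp only [smul_add]; abel
  | single s a =>
    rw [smul_single, op_single, op_single, smul_eq_mul, LieRinehartRing.leibniz_mul_right]
    simp only [smul_add, smul_single, single_add, mul_smul, smul_eq_mul]
    abel

theorem op_add_left (X Y : L) (m : Poly R r) :
    op e T (X + Y) m = op e T X m + op e T Y m := by
  induction m using Finsupp.induction_linear with
  | zero => simp
  | add x y hx hy => rw [map_add, map_add, map_add, hx, hy]; abel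
  | single s a => simp only [op_single, map_add, add_lie, smul_add, single_add]; abel

theorem op_smul_left (f : R) (X : L) (m : Poly R r) :
    op e T (f • X) m = f • op e T X m := by
  induction m using Finsupp.induction_linear with
  | zero => simp
  | add x y hx hy => rw [map_add, map_add, hx, hy, smul_add]
  | single s a =>
    simp only [op_single, map_smul, LieRinehartRing.lie_smul_eq_mul, smul_add, smul_single,
      smul_eq_mul, smul_comm a f]

theorem op_neg_left (X : L) (m : Poly R r) : op e T (-X) m = - op e T X m := by
  rw [← neg_one_smul R X, op_smul_left, neg_one_smul]

theorem op_sub_left (X Y : L) (m : Poly R r) :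
    op e T (X - Y) m = op e T X m - op e T Y m := by
  rw [sub_eq_add_neg, op_add_left, op_neg_left, sub_eq_add_neg]

variable (R r) in
/-- Combinations of monomials of degree at most `n`. -/
noncomputable def deg (n : ℕ) : Submodule R (Poly R r) :=
  Submodule.span R ((fun s => single s 1) '' {s : Multiset (Fin r) | s.card ≤ n})

theorem single_mem_deg {n : ℕ} {s : Multiset (Fin r)} (h : s.card ≤ n) :
    single s (1 : R) ∈ deg R r n := Submodule.subset_span ⟨s, h, rfl⟩

theorem deg_mono {n m : ℕ} (h : n ≤ m) : deg R r n ≤ deg R r m :=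
  Submodule.span_mono (Set.image_mono fun _ hs => le_trans hs h)

theorem deg_induction {n : ℕ} (p : Poly R r → Prop) (h0 : p 0)
    (hadd : ∀ x y, p x → p y → p (x + y))
    (hsmul : ∀ (f : R) x, x ∈ deg R r n → p x → p (f • x))
    (hs : ∀ s : Multiset (Fin r), s.card ≤ n → p (single s 1)) {m : Poly R r}
    (hm : m ∈ deg R r n) : p m := by
  induction hm using Submodule.span_induction with
  | mem x hx => obtain ⟨s, h, rfl⟩ := hx; exact hs s h
  | zero => exact h0
  | add x y _ _ hx hy => exact hadd x y hx hy
  | smul a x hm hx => exact hsmul a x hm hx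

theorem mem_deg (m : Poly R r) : ∃ n, m ∈ deg R r n := by
  induction m using Finsupp.induction_linear with
  | zero => exact ⟨0, zero_mem _⟩
  | add x y hx hy =>
    obtain ⟨n, hn⟩ := hx
    obtain ⟨m, hm⟩ := hy
    exact ⟨max n m, add_mem (deg_mono (le_max_left _ _) hn) (deg_mono (le_max_right _ _) hm)⟩
  | single s a =>
    refine ⟨s.card, ?_⟩
    have := (deg R r s.card).smul_mem a (single_mem_deg le_rfl)
    rwa [smul_single, smul_eq_mul, mul_one] at this

theorem constr_mem {n : ℕ} {g : Fin r → Poly R r} (hg : ∀ i, g i ∈ deg R r n) (X : L) :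
    e.constr R g X ∈ deg R r n := by
  rw [Module.Basis.constr_apply_fintype]
  exact Submodule.sum_mem _ fun i _ => Submodule.smul_mem _ _ (hg i)

theorem op_mem (hT : ∀ i s, T i s ∈ deg R r (s.card + 1)) (X : L) {n : ℕ} {m : Poly R r}
    (hm : m ∈ deg R r n) : op e T X m ∈ deg R r (n + 1) := by
  refine deg_induction (fun m => op e T X m ∈ deg R r (n + 1)) (by simp) (fun x y hx hy => ?_)
    (fun f x hm hx => ?_) (fun s hs => ?_) hm
  · rw [map_add]; exact add_mem hx hy
  · rw [op_smul_right]
    exact add_mem (Submodule.smul_mem _ _ hx)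
      (Submodule.smul_mem _ _ (deg_mono (Nat.le_succ n) hm))
  · rw [op_single, anchor_one, single_zero, add_zero, one_smul]
    exact constr_mem (fun i => deg_mono (by omega) (hT i s)) X

theorem op_congr {T' : Fin r → Multiset (Fin r) → Poly R r} {n : ℕ}
    (h : ∀ i (s : Multiset (Fin r)), s.card ≤ n → T i s = T' i s) (X : L) {m : Poly R r}
    (hm : m ∈ deg R r n) : op e T X m = op e T' X m := by
  refine deg_induction (fun m => op e T X m = op e T' X m) (by simp) (fun x y hx hy => ?_)
    (fun f x hm hx => ?_) (fun s hs => ?_) hm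
  · rw [map_add, map_add, hx, hy]
  · rw [op_smul_right, op_smul_right, hx]
  · rw [op_single, op_single]
    simp only [h _ s hs]

/-- This is the case distinction of the recursion: either `x_i x^s` is already in order, or the
least index `j` of `s` is split off. -/
theorem le_or_exists_cons (i : Fin r) (s : Multiset (Fin r)) :
    (∀ b ∈ s, i ≤ b) ∨ ∃ j t, s = j ::ₘ t ∧ (∀ b ∈ t, j ≤ b) ∧ j < i := by
  by_cases h : ∀ b ∈ s, i ≤ b
  · exact Or.inl h
  · push Not at h
    obtain ⟨b, hb, hbi⟩ := h
    obtain ⟨j, hj, hmin⟩ := s.toFinset.exists_min_image id ⟨b, Multiset.mem_toFinset.2 hb⟩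
    have hjs := Multiset.mem_toFinset.1 hj
    refine Or.inr ⟨j, s.erase j, (Multiset.cons_erase hjs).symm, fun c hc => ?_, ?_⟩
    · exact hmin c (Multiset.mem_toFinset.2 (Multiset.mem_of_mem_erase hc))
    · exact lt_of_le_of_lt (hmin b (Multiset.mem_toFinset.2 hb)) hbi

variable (e) in
/-- Approximations to the value of the `i`-th basis element of `L` on a monomial, correct in degree
at most `n`. -/
noncomputable def tab : ℕ → Fin r → Multiset (Fin r) → Poly R r
  | 0, i, s => single (i ::ₘ s) 1
  | n + 1, i, s =>
    match s.sort (· ≤ ·) with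
    | [] => single (i ::ₘ s) 1
    | j :: l =>
      -- The rule is `e_i (e_j x^l) = e_j (e_i x^l) + [e_i, e_j] x^l`. The leading part `x_i x^l` of
      -- `e_i x^l` is treated apart: `e_j` must send it to `x_i x_j x^l`, whose degree is too high
      -- for the table at level `n`.
      if j < i then single (i ::ₘ s) 1 +
        (op e (tab n) (e j) (tab n i (l : Multiset (Fin r)) -
          single (i ::ₘ (l : Multiset (Fin r))) 1) +
        op e (tab n) ⁅e i, e j⁆ (single (l : Multiset (Fin r)) 1))
      else single (i ::ₘ s) 1

theorem tab_of_le {i : Fin r} {s : Multiset (Fin r)} (h : ∀ b ∈ s, i ≤ b) (n : ℕ) :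
    tab e n i s = single (i ::ₘ s) 1 := by
  cases n with
  | zero => rfl
  | succ n =>
    rw [tab]
    split
    · rfl
    · rename_i j l hl
      have : j ∈ s := by
        rw [← Multiset.mem_sort (r := (· ≤ ·)), hl]; exact List.mem_cons_self
      rw [if_neg (not_lt.2 (h j this))]

theorem tab_succ_cons {i j : Fin r} {t : Multiset (Fin r)} (h : ∀ b ∈ t, j ≤ b) (hij : j < i)
    (n : ℕ) : tab e (n + 1) i (j ::ₘ t) = single (i ::ₘ j ::ₘ t) 1 +
      (op e (tab e n) (e j) (tab e n i t - single (i ::ₘ t) 1) +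
        op e (tab e n) ⁅e i, e j⁆ (single t 1)) := by
  rw [tab, Multiset.sort_cons j t _ h]
  simp only [if_pos hij, Multiset.sort_eq]

/-- The leading term of `e_i x^s` is `x_i x^s`. Knowing that the remainder has degree at most `|s|`
is what keeps the recursion within the range where the previous table is correct. -/
theorem tab_mem (n : ℕ) : ∀ (i : Fin r) (s : Multiset (Fin r)),
    tab e n i s - single (i ::ₘ s) 1 ∈ deg R r s.card ∧ tab e n i s ∈ deg R r (s.card + 1) := by
  suffices h : ∀ (i : Fin r) (s : Multiset (Fin r)),
      tab e n i s - single (i ::ₘ s) 1 ∈ deg R r s.card from fun i s => ⟨h i s, by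
    have := add_mem (deg_mono (Nat.le_succ _) (h i s))
      (single_mem_deg (R := R) (s := i ::ₘ s) (n := s.card + 1) (by simp))
    rwa [sub_add_cancel] at this⟩
  induction n with
  | zero => intro i s; simp [tab]
  | succ n ih =>
    have ih' : ∀ (i : Fin r) (s : Multiset (Fin r)), tab e n i s ∈ deg R r (s.card + 1) :=
      fun i s => by
        have := add_mem (deg_mono (Nat.le_succ _) (ih i s))
          (single_mem_deg (R := R) (s := i ::ₘ s) (n := s.card + 1) (by simp))
        rwa [sub_add_cancel] at this
    intro i s
    obtain h | ⟨j, t, rfl, ht, hji⟩ := le_or_exists_cons i s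
    · rw [tab_of_le h, sub_self]; exact zero_mem _
    · rw [tab_succ_cons ht hji, add_sub_cancel_left, Multiset.card_cons]
      exact add_mem (op_mem ih' _ (ih i t)) (op_mem ih' _ (single_mem_deg le_rfl))

/-- A value in degree `c + 1` only uses values in degree at most `c`, so recursion deeper than the
degree changes nothing. -/
theorem tab_stable (c : ℕ) : ∀ n, c ≤ n → ∀ (i : Fin r) (s : Multiset (Fin r)), s.card ≤ c →
    tab e n i s = tab e c i s := by
  induction c with
  | zero =>
    intro n _ i s hs
    have : s = 0 := by simpa using hs
    subst this
    rw [tab_of_le (by simp), tab_of_le (by simp)]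
  | succ c ih =>
    intro n hn i s hs
    obtain ⟨m, rfl⟩ : ∃ m, n = m + 1 := ⟨n - 1, by omega⟩
    obtain h | ⟨j, t, rfl, ht, hji⟩ := le_or_exists_cons i s
    · rw [tab_of_le h, tab_of_le h]
    · have htc : t.card ≤ c := by simpa using hs
      rw [tab_succ_cons ht hji, tab_succ_cons ht hji, ih m (by omega) i t htc,
        op_congr (ih m (by omega)) _ (deg_mono htc (tab_mem c i t).1),
        op_congr (ih m (by omega)) _ (single_mem_deg htc)]

variable (e) in
/-- The action of `L` on `Poly R r`. -/
noncomputable def act (X : L) : Poly R r →+ Poly R r := op e (fun i s => tab e s.card i s) X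

theorem act_eq {n : ℕ} (X : L) {m : Poly R r} (hm : m ∈ deg R r n) :
    act e X m = op e (tab e n) X m :=
  op_congr (fun i s hs => (tab_stable _ n hs i s le_rfl).symm) X hm

theorem act_single_sub_mem (i : Fin r) (s : Multiset (Fin r)) :
    act e (e i) (single s 1) - single (i ::ₘ s) 1 ∈ deg R r s.card := by
  rw [act, op_basis_single]; exact (tab_mem _ i s).1

theorem act_of_le {i : Fin r} {s : Multiset (Fin r)} (h : ∀ b ∈ s, i ≤ b) :
    act e (e i) (single s 1) = single (i ::ₘ s) 1 := by
  rw [act, op_basis_single, tab_of_le h]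

/-- The recursion in its intended form: as `j` is at most every index of `x_i x^t`, applying `e_j`
to that leading part just produces a monomial. -/
theorem act_cons {i j : Fin r} {t : Multiset (Fin r)} (h : ∀ b ∈ t, j ≤ b) (hij : j < i) :
    act e (e i) (single (j ::ₘ t) 1) =
      act e (e j) (act e (e i) (single t 1)) + act e ⁅e i, e j⁆ (single t 1) := by
  have hj : ∀ b ∈ i ::ₘ t, j ≤ b := by
    intro b hb
    obtain rfl | hb := Multiset.mem_cons.1 hb
    · exact hij.le
    · exact h b hb
  have h₁ : act e (e i) (single t 1) = single (i ::ₘ t) 1 +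
      (tab e t.card i t - single (i ::ₘ t) 1) := by
    rw [act, op_basis_single]; abel
  have h₂ : act e (e i) (single (j ::ₘ t) 1) = tab e (t.card + 1) i (j ::ₘ t) := by
    rw [act, op_basis_single, Multiset.card_cons]
  rw [h₂, h₁, map_add, act_of_le hj, act_eq _ (tab_mem _ i t).1, act_eq _ (single_mem_deg le_rfl),
    tab_succ_cons h hij, Multiset.cons_swap, add_assoc]

/-- `X` and `Y` act on `m` compatibly with the bracket. -/
def Rel (e : Module.Basis (Fin r) R L) (X Y : L) (m : Poly R r) : Prop :=
  act e X (act e Y m) - act e Y (act e X m) = act e ⁅X, Y⁆ m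

theorem act_smul_right (X : L) (f : R) (m : Poly R r) :
    act e X (f • m) = f • act e X m + ⁅X, f⁆ • m := op_smul_right X f m

theorem act_smul_left (X : L) (f : R) (m : Poly R r) :
    act e (f • X) m = f • act e X m := op_smul_left f X m

theorem act_add_left (X Y : L) (m : Poly R r) :
    act e (X + Y) m = act e X m + act e Y m := op_add_left X Y m

theorem act_sub_left (X Y : L) (m : Poly R r) :
    act e (X - Y) m = act e X m - act e Y m := op_sub_left X Y m

theorem act_neg_left (X : L) (m : Poly R r) : act e (-X) m = - act e X m := op_neg_left X m

theorem act_zero_left (m : Poly R r) : act e (0 : L) m = 0 := by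
  rw [← sub_self (0 : L), act_sub_left, sub_self]

theorem Rel.add {X Y : L} {m m' : Poly R r} (h : Rel e X Y m) (h' : Rel e X Y m') :
    Rel e X Y (m + m') := by
  unfold Rel at *
  simp only [map_add, ← h, ← h']; abel

/-- The cross terms `X(f) Y m` and `Y(f) X m` cancel, and the second derivatives of `f` combine to
`[X, Y](f)` because the anchor respects brackets. -/
theorem Rel.smul {X Y : L} {m : Poly R r} (h : Rel e X Y m) (f : R) : Rel e X Y (f • m) := by
  unfold Rel at *
  simp only [act_smul_right, map_add, ← h, lie_lie, smul_sub, sub_smul]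
  abel

theorem Rel.symm {X Y : L} {m : Poly R r} (h : Rel e X Y m) : Rel e Y X m := by
  unfold Rel at *
  rw [← lie_skew, act_neg_left, ← h, neg_sub]

theorem Rel.add_left {X X' Y : L} {m : Poly R r} (h : Rel e X Y m) (h' : Rel e X' Y m) :
    Rel e (X + X') Y m := by
  unfold Rel at *
  simp only [act_add_left, map_add, add_lie, ← h, ← h']; abel

/-- In `[f X, Y] = f [X, Y] - Y(f) X` the last term matches the derivative of `f` when `Y` acts on
`f (X m)`. -/
theorem Rel.smul_left {X Y : L} {m : Poly R r} (h : Rel e X Y m) (f : R) :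
    Rel e (f • X) Y m := by
  unfold Rel at *
  have : ⁅f • X, Y⁆ = f • ⁅X, Y⁆ - ⁅Y, f⁆ • X := by
    rw [← lie_skew, LieRinehartRing.leibniz_smul_right, ← lie_skew X Y]
    simp only [neg_add_rev, smul_neg]; abel
  rw [this, act_sub_left, act_smul_left, act_smul_left, act_smul_left, act_smul_left,
    act_smul_right, ← h, smul_sub]
  abel

theorem Rel.of_basis_left {Y : L} {m : Poly R r} (h : ∀ i, Rel e (e i) Y m) (X : L) :
    Rel e X Y m := by
  rw [← e.sum_repr X]
  refine Finset.sum_induction _ (fun X => Rel e X Y m) (fun _ _ => Rel.add_left) ?_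
    (fun i _ => (h i).smul_left _)
  simp [Rel, act_zero_left]

theorem Rel.of_basis {m : Poly R r} (h : ∀ i j, Rel e (e i) (e j) m) (X Y : L) : Rel e X Y m :=
  Rel.of_basis_left (fun i => (Rel.of_basis_left (fun j => h j i) Y).symm) X

theorem rel_of_deg {n : ℕ} (h : ∀ s : Multiset (Fin r), s.card ≤ n → ∀ X Y, Rel e X Y (single s 1))
    {m : Poly R r} (hm : m ∈ deg R r n) (X Y : L) : Rel e X Y m :=
  deg_induction (fun m => Rel e X Y m) (by simp [Rel]) (fun _ _ => Rel.add)
    (fun f _ _ h => h.smul f) (fun s hs => h s hs X Y) hm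

theorem rel_of_le {i j : Fin r} {s : Multiset (Fin r)} (hij : j < i) (h : ∀ b ∈ s, j ≤ b) :
    Rel e (e i) (e j) (single s 1) := by
  unfold Rel
  rw [act_of_le h, act_cons h hij, add_sub_cancel_left]

/-- Induction on the degree. If `j` is at most all indices of `s`, the relation for `e_i, e_j` with
`j < i` is the defining recursion. Otherwise `x^s = e_k x^t` with `k < j < i`; moving `e_k` to the
left reduces the claim to relations on `x^t` and the Jacobi identity. -/
theorem rel_single (n : ℕ) : ∀ s : Multiset (Fin r), s.card ≤ n → ∀ X Y,
    Rel e X Y (single s 1) := by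
  induction n with
  | zero =>
    intro s hs
    have : s = 0 := by simpa using hs
    subst this
    refine Rel.of_basis fun i j => ?_
    rcases lt_trichotomy i j with h | rfl | h
    · exact (rel_of_le h (by simp)).symm
    · simp [Rel, act_zero_left]
    · exact rel_of_le h (by simp)
  | succ n ih =>
    have key : ∀ s : Multiset (Fin r), s.card ≤ n + 1 → ∀ i j : Fin r, j < i →
        Rel e (e i) (e j) (single s 1) := by
      intro s hs i j hij
      obtain h | ⟨k, t, rfl, ht, hkj⟩ := le_or_exists_cons j s
      · exact rel_of_le hij h
      have htc : t.card ≤ n := by simpa using hs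
      have IH : ∀ X Y, Rel e X Y (single t 1) := fun X Y => rel_of_deg ih (single_mem_deg htc) X Y
      -- Although `e_b x^t` may have degree `n + 1`, its leading part `x_b x^t` is covered by
      -- `rel_of_le` since `k` is at most all its indices; the remainder has lower degree.
      have h₁ : ∀ a b : Fin r, k < a → k < b → Rel e (e a) (e k) (act e (e b) (single t 1)) := by
        intro a b ha hb
        have h₂ : act e (e b) (single t 1) = single (b ::ₘ t) 1 +
          (act e (e b) (single t 1) - single (b ::ₘ t) 1) := by abel
        rw [h₂]
        refine (rel_of_le ha fun c hc => ?_).add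
          (rel_of_deg ih (deg_mono htc (act_single_sub_mem b t)) _ _)
        obtain rfl | hc := Multiset.mem_cons.1 hc
        · exact hb.le
        · exact ht c hc
      have e₀ : single (k ::ₘ t) 1 = act e (e k) (single t 1) := (act_of_le ht).symm
      have e₁ := h₁ i j (hkj.trans hij) hkj
      have e₂ := h₁ j i hkj (hkj.trans hij)
      have e₃ := IH (e j) (e k)
      have e₄ := IH (e i) (e k)
      have e₅ := IH (e i) (e j)
      have e₆ := IH (e i) ⁅e j, e k⁆
      have e₇ := IH (e j) ⁅e i, e k⁆
      have e₈ := IH ⁅e i, e j⁆ (e k)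
      -- The only use of the Jacobi identity of `L`.
      have e₉ : act e ⁅⁅e i, e j⁆, e k⁆ (single t 1) = act e ⁅e i, ⁅e j, e k⁆⁆ (single t 1) -
          act e ⁅e j, ⁅e i, e k⁆⁆ (single t 1) := by rw [lie_lie, act_sub_left]
      rw [e₀]
      unfold Rel at *
      rw [sub_eq_iff_eq_add] at *
      rw [e₃, e₄, map_add, map_add, e₁, e₂, e₆, e₇, e₈, e₉, e₅, map_add]
      abel
    intro s hs
    refine Rel.of_basis fun i j => ?_
    rcases lt_trichotomy i j with h | rfl | h
    · exact (key s hs j i h).symm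
    · simp [Rel, act_zero_left]
    · exact key s hs i j h

theorem rel (X Y : L) (m : Poly R r) : Rel e X Y m := by
  obtain ⟨n, hn⟩ := mem_deg m
  exact rel_of_deg (rel_single n) hn X Y

variable (K e) in
/-- The action of `L` on `Poly R r` by `K`-linear maps. -/
noncomputable def actHom (X : L) : Module.End K (Poly R r) :=
  { act e X with
    map_smul' := fun c m => by
      have := act_smul_right (e := e) X (algebraMap K R c) m
      rwa [anchor_algebraMap, zero_smul, add_zero, algebraMap_smul, algebraMap_smul] at this }

theorem actHom_apply (X : L) (m : Poly R r) : actHom K e X m = act e X m := rfl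

variable (K e) in
/-- The action of `U(L, R)` on `Poly R r`. -/
noncomputable def envAct : Env K R L →ₐ[K] Module.End K (Poly R r) :=
  Env.lift (Algebra.lsmul K K (Poly R r))
    (AddMonoidHom.mk' (actHom K e) (fun X Y => LinearMap.ext fun m => by
      rw [LinearMap.add_apply, actHom_apply, actHom_apply, actHom_apply, act_add_left]))
    (fun f X => LinearMap.ext fun m => by
      rw [AddMonoidHom.mk'_apply, Module.End.mul_apply,
        Algebra.lsmul_coe, actHom_apply, actHom_apply, act_smul_left])
    (fun X f => LinearMap.ext fun m => by
      rw [AddMonoidHom.mk'_apply, Module.End.mul_apply, LinearMap.add_apply, Module.End.mul_apply,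
        Algebra.lsmul_coe, Algebra.lsmul_coe, actHom_apply, actHom_apply]
      exact act_smul_right X f m)
    (fun X Y => LinearMap.ext fun m => by
      have := rel (e := e) X Y m
      unfold Rel at this
      rw [sub_eq_iff_eq_add, add_comm] at this
      rw [AddMonoidHom.mk'_apply,
        Module.End.mul_apply, LinearMap.add_apply, Module.End.mul_apply]
      simp only [actHom_apply]
      exact this)

end PBWAction

/-- If `L` is free with basis `e`, there are jets without constant term whose values on `L` are the
coordinates with respect to `e`. -/
theorem exists_dual_jets {r : ℕ} (e : Module.Basis (Fin r) R L) : ∃ ξ : Fin r → Jets K R L,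
    (∀ k, Jets.eval (ξ k) 1 = 0) ∧
    ∀ k i, Jets.eval (ξ k) (Env.ofL K R L (e i)) = if i = k then 1 else 0 := by
  classical
  refine ⟨fun k => Jets.of
    -- The coefficient of `x_k` in `D · 1`.
    { toFun := fun D => PBWAction.envAct K e D (Finsupp.single 0 1) {k}
      map_add' := fun D E => by simp
      map_smul' := fun f D => by simp [Env.smul_def, PBWAction.envAct] }, fun k => ?_,
    fun k i => ?_⟩
  · change PBWAction.envAct K e 1 (Finsupp.single 0 1) {k} = 0
    simp
  · have : PBWAction.envAct K e (Env.ofL K R L (e i)) (Finsupp.single 0 1) =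
        Finsupp.single (i ::ₘ 0) 1 := by
      rw [PBWAction.envAct, Env.lift_ofL]
      exact PBWAction.act_of_le (by simp)
    change PBWAction.envAct K e (Env.ofL K R L (e i)) (Finsupp.single 0 1) {k} = _
    rw [this, Finsupp.single_apply]
    simp

end PBWAction

end LieRinehart

namespace LieRinehart

/-! ### The order filtration of `U(L, R)` -/

section Filtration

variable (K R : Type*) {L : Type*} [CommRing K] [CommRing R] [Algebra K R] [LieRing L]
  [Module R L] [LieRingModule L R]

/-- The product in `U(L, R)` of a list of elements of `L`. -/
noncomputable def lprod (l : List L) : Env K R L := (l.map (Env.ofL K R L)).prod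

variable {K R}

@[simp] theorem lprod_nil : lprod K R ([] : List L) = 1 := rfl

@[simp] theorem lprod_cons (X : L) (l : List L) :
    lprod K R (X :: l) = Env.ofL K R L X * lprod K R l := by simp [lprod]

@[simp] theorem lprod_append (l l' : List L) :
    lprod K R (l ++ l') = lprod K R l * lprod K R l' := by simp [lprod]

variable (K R L) in
/-- The `R`-submodule of `U(L, R)` spanned by the products of fewer than `n` elements of `L`. -/
noncomputable def filt (n : ℕ) : Submodule R (Env K R L) :=
  Submodule.span R (lprod K R '' {l : List L | l.length < n})

theorem lprod_mem_filt {l : List L} {n : ℕ} (h : l.length < n) : lprod K R l ∈ filt K R L n :=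
  Submodule.subset_span ⟨l, h, rfl⟩

theorem filt_mono {n m : ℕ} (h : n ≤ m) : filt K R L n ≤ filt K R L m :=
  Submodule.span_mono (Set.image_mono fun _ hl => lt_of_lt_of_le hl h)

theorem ofL_mul_smul (X : L) (f : R) (D : Env K R L) :
    Env.ofL K R L X * (f • D) = f • (Env.ofL K R L X * D) + ⁅X, f⁆ • D := by
  simp only [Env.smul_def]
  rw [← mul_assoc, Env.ofL_mul_ofR, add_mul, mul_assoc]

theorem ofL_mul_mem_filt (X : L) {n : ℕ} {D : Env K R L} (h : D ∈ filt K R L n) :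
    Env.ofL K R L X * D ∈ filt K R L (n + 1) := by
  induction h using Submodule.span_induction with
  | mem D hD =>
    obtain ⟨l, hl, rfl⟩ := hD
    rw [← lprod_cons]
    exact lprod_mem_filt (by simpa using hl)
  | zero => simp
  | add D E _ _ hD hE => rw [mul_add]; exact add_mem hD hE
  | smul f D hD hD' =>
    rw [ofL_mul_smul]
    exact add_mem (Submodule.smul_mem _ _ hD')
      (Submodule.smul_mem _ _ (filt_mono (Nat.le_succ n) hD))

/-- Since `filt n` bounds the order strictly, order at most `n` appears as `filt (n + 1)`; this
keeps the indices additive. -/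
theorem mul_mem_filt {n m : ℕ} {D E : Env K R L} (hD : D ∈ filt K R L (n + 1))
    (hE : E ∈ filt K R L m) : D * E ∈ filt K R L (n + m) := by
  induction hD using Submodule.span_induction with
  | mem D hD =>
    obtain ⟨l, hl, rfl⟩ := hD
    have : ∀ l : List L, lprod K R l * E ∈ filt K R L (l.length + m) := fun l => by
      induction l with
      | nil => simpa using hE
      | cons X l ih =>
        rw [lprod_cons, mul_assoc, List.length_cons, add_right_comm]
        exact ofL_mul_mem_filt X ih
    have hl : l.length < n + 1 := hl
    exact filt_mono (by omega) (this l)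
  | zero => simp
  | add D E _ _ hD hE => rw [add_mul]; exact add_mem hD hE
  | smul f D _ hD => rw [smul_mul_assoc]; exact Submodule.smul_mem _ _ hD

theorem exists_mem_filt (D : Env K R L) : ∃ n, D ∈ filt K R L (n + 1) := by
  induction D using Env.induction with
  | hR f =>
    refine ⟨0, ?_⟩
    have := (filt K R L 1).smul_mem f (lprod_mem_filt (l := []) (by simp))
    rwa [lprod_nil, Env.smul_def, mul_one] at this
  | hL X =>
    refine ⟨1, ?_⟩
    have := lprod_mem_filt (K := K) (R := R) (l := [X]) (n := 2) (by simp)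
    rwa [lprod_cons, lprod_nil, mul_one] at this
  | hadd a b ha hb =>
    obtain ⟨n, hn⟩ := ha
    obtain ⟨m, hm⟩ := hb
    exact ⟨max n m, add_mem (filt_mono (by omega) hn) (filt_mono (by omega) hm)⟩
  | hmul a b ha hb =>
    obtain ⟨n, hn⟩ := ha
    obtain ⟨m, hm⟩ := hb
    exact ⟨n + m, by rw [add_assoc]; exact mul_mem_filt hn hm⟩

/-- An additive predicate which holds for the multiples of products of elements of `L` holds for
all elements of `U(L, R)`. -/
theorem Env.induction_lprod {p : Env K R L → Prop} (hadd : ∀ a b, p a → p b → p (a + b))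
    (hs : ∀ (f : R) l, p (f • lprod K R l)) (D : Env K R L) : p D := by
  obtain ⟨n, hn⟩ := exists_mem_filt D
  -- The scalar must be carried along, because `p` is not assumed stable under multiplication by
  -- `R`.
  suffices h : ∀ f : R, p (f • D) by simpa using h 1
  induction hn using Submodule.span_induction with
  | mem D hD => obtain ⟨l, _, rfl⟩ := hD; exact fun f => hs f l
  | zero => intro f; simpa using hs 0 []
  | add D E _ _ hD hE => intro f; rw [smul_add]; exact hadd _ _ (hD f) (hE f)
  | smul g D _ hD => intro f; rw [smul_smul]; exact hD _

/-- Exchanging two neighbours costs their bracket, which is a product with one factor fewer. So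
products commute to leading order. -/
theorem lprod_sub_mem_of_perm {l l' : List L} (h : l.Perm l') :
    lprod K R l - lprod K R l' ∈ filt K R L l.length := by
  induction h with
  | nil => simp
  | @cons X l l' _ ih => rw [lprod_cons, lprod_cons, ← mul_sub]; exact ofL_mul_mem_filt X ih
  | swap X Y l =>
    have : lprod K R (Y :: X :: l) - lprod K R (X :: Y :: l) = lprod K R (⁅Y, X⁆ :: l) := by
      simp only [lprod_cons]
      rw [← mul_assoc, Env.ofL_mul_ofL Y X, add_mul, mul_assoc, add_sub_cancel_left]
    rw [this]
    exact lprod_mem_filt (by simp)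
  | @trans l₁ l₂ l₃ h₁ _ ih₁ ih₂ =>
    rw [← sub_add_sub_cancel _ (lprod K R l₂)]
    rw [← h₁.length_eq] at ih₂
    exact add_mem ih₁ ih₂

end Filtration

/-! ### The filtration of jets by order of vanishing -/

section JetFiltration

variable {K R L : Type*} [CommRing K] [CommRing R] [Algebra K R] [LieRing L] [LieAlgebra K L]
  [Module R L] [LieRingModule L R] [LieRinehartRing R L] [LieRinehartAlgebra K R L]

namespace Jets

theorem eval_mul_one (φ ψ : Jets K R L) : eval (φ * ψ) 1 = eval φ 1 * eval ψ 1 := by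
  simp [eval_mul]

theorem eval_alpha₁_mul (f : R) (φ : Jets K R L) (D : Env K R L) :
    eval (α₁ K R L f * φ) D = f * eval φ D := by
  have : α₁ K R L f * φ = of (f • eval φ) :=
    (Algebra.smul_def (A := WithConv (Env K R L →ₗ[R] R)) f (WithConv.toConv (eval φ))).symm
  rw [this]; rfl

/-- The jet `φ` vanishes on products of fewer than `n` elements of `L`. -/
def Vanish (n : ℕ) (φ : Jets K R L) : Prop :=
  ∀ l : List L, l.length < n → eval φ (lprod K R l) = 0

theorem Vanish.eval_eq_zero {n : ℕ} {φ : Jets K R L} (h : Vanish n φ) {D : Env K R L}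
    (hD : D ∈ filt K R L n) : eval φ D = 0 := by
  have : filt K R L n ≤ LinearMap.ker (eval φ) := by
    refine Submodule.span_le.2 ?_
    rintro _ ⟨l, hl, rfl⟩
    exact h l hl
  exact this hD

theorem Vanish.mono {n m : ℕ} {φ : Jets K R L} (h : Vanish n φ) (hm : m ≤ n) : Vanish m φ :=
  fun l hl => h l (by omega)

theorem Vanish.add {n : ℕ} {φ ψ : Jets K R L} (h : Vanish n φ) (h' : Vanish n ψ) :
    Vanish n (φ + ψ) := fun l hl => by rw [eval_add, h l hl, h' l hl, add_zero]

theorem eval_sub (φ ψ : Jets K R L) (D : Env K R L) :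
    eval (φ - ψ) D = eval φ D - eval ψ D := by
  rw [sub_eq_add_neg, eval_add, eval_neg, sub_eq_add_neg]

theorem eval_sum {ι : Type*} (s : Finset ι) (φ : ι → Jets K R L) (D : Env K R L) :
    eval (∑ i ∈ s, φ i) D = ∑ i ∈ s, eval (φ i) D := by
  classical
  induction s using Finset.induction_on with
  | empty => simp
  | insert i s hi ih => rw [Finset.sum_insert hi, eval_add, ih, Finset.sum_insert hi]

theorem vanish_zero (φ : Jets K R L) : Vanish 0 φ := fun l hl => by omega

theorem vanish_one {φ : Jets K R L} (h : eval φ 1 = 0) : Vanish 1 φ := fun l hl => by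
  have : l = [] := by simpa using hl
  rw [this]; exact h

/-- Acting by `X` is right multiplication of the argument, which costs one order. For `n = 0` the
truncated subtraction is harmless, as the claim is empty. -/
theorem Vanish.ofL_smul {n : ℕ} {φ : Jets K R L} (h : Vanish n φ) (X : L) :
    Vanish (n - 1) (Env.ofL K R L X • φ) := fun l hl => by
  have := h (l ++ [X]) (by simp; omega)
  rwa [lprod_append, lprod_cons, lprod_nil, mul_one] at this

/-- The last factor acts on jets as a derivation. This is why the following inductions peel lists
from the right. -/
theorem eval_mul_lprod_append (φ ψ : Jets K R L) (l : List L) (X : L) :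
    eval (φ * ψ) (lprod K R (l ++ [X])) =
      eval ((Env.ofL K R L X • φ) * ψ) (lprod K R l) +
        eval (φ * (Env.ofL K R L X • ψ)) (lprod K R l) := by
  rw [← eval_add, ← ofL_smul_mul, eval_smul, lprod_append, lprod_cons, lprod_nil, mul_one]

/-- Each factor of a product of fewer than `m + n` elements differentiates either `φ` or `ψ`, so one
of the two is differentiated too few times to become nonzero at `1`. -/
theorem Vanish.mul {m n : ℕ} {φ ψ : Jets K R L} (h : Vanish m φ) (h' : Vanish n ψ) :
    Vanish (m + n) (φ * ψ) := by
  intro l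
  induction l using List.reverseRecOn generalizing m n φ ψ with
  | nil =>
    intro hl
    rw [lprod_nil, eval_mul_one]
    rcases Nat.eq_zero_or_pos m with rfl | hm
    · rw [show eval ψ 1 = 0 from h' [] (by simpa using hl), mul_zero]
    · rw [show eval φ 1 = 0 from h [] (by simpa using hm), zero_mul]
  | append_singleton l X ih =>
    intro hl
    rw [List.length_append, List.length_singleton] at hl
    rw [eval_mul_lprod_append, ih (h.ofL_smul X) h' (by omega), ih h (h'.ofL_smul X) (by omega),
      add_zero]

/-- All `n` factors must go to `ψ`: once one of them differentiates `φ`, fewer than `n` remain for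
`ψ`. Thus only the constant term of `φ` enters the leading term of the product. -/
theorem eval_mul_of_vanish {n : ℕ} (φ : Jets K R L) {ψ : Jets K R L} (h : Vanish n ψ)
    {l : List L} (hl : l.length = n) :
    eval (φ * ψ) (lprod K R l) = eval φ 1 * eval ψ (lprod K R l) := by
  induction l using List.reverseRecOn generalizing n ψ with
  | nil => rw [lprod_nil, eval_mul_one]
  | append_singleton l X ih =>
    rw [List.length_append, List.length_singleton] at hl
    rw [eval_mul_lprod_append, (vanish_zero (Env.ofL K R L X • φ)).mul h l (by omega), zero_add,
      ih (h.ofL_smul X) (by omega), eval_smul, lprod_append, lprod_cons, lprod_nil, mul_one]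

variable (K R L) in
/-- The ideal of jets vanishing on products of fewer than `n` elements of `L`. -/
def vanishing (n : ℕ) : Ideal (Jets K R L) where
  carrier := {φ | Vanish n φ}
  add_mem' h h' := h.add h'
  zero_mem' l hl := rfl
  smul_mem' φ ψ h := by
    have := (vanish_zero φ).mul h
    rwa [zero_add] at this

/-- The filtration of jets is separated because that of `U(L, R)` is exhaustive. -/
theorem eq_zero_of_vanish {φ : Jets K R L} (h : ∀ n, Vanish n φ) : φ = 0 := by
  ext D
  obtain ⟨n, hn⟩ := exists_mem_filt D
  exact (h _).eval_eq_zero hn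

end Jets

end JetFiltration

/-- A filtered additive map from a complete to a separated filtered group which is surjective on
the graded pieces is surjective. -/
theorem surjective_of_filtered {A B : Type*} [AddCommGroup A] [AddCommGroup B]
    (FA : ℕ → AddSubgroup A) (FB : ℕ → AddSubgroup B) (f : A →+ B)
    (hA : ∀ a : ℕ → A, (∀ n, a (n + 1) - a n ∈ FA n) → ∃ x, ∀ n, x - a n ∈ FA n)
    (hB : ∀ b, (∀ n, b ∈ FB n) → b = 0) (hB0 : ∀ b, b ∈ FB 0)
    (hf : ∀ n, ∀ a ∈ FA n, f a ∈ FB n)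
    (hgr : ∀ n, ∀ b ∈ FB n, ∃ a ∈ FA n, b - f a ∈ FB (n + 1)) : Function.Surjective f := by
  intro b
  choose! g hg hg' using hgr
  let a : ℕ → A := fun n => Nat.rec 0 (fun n x => x + g n (b - f x)) n
  have ha : ∀ n, b - f (a n) ∈ FB n := fun n => by
    induction n with
    | zero => exact hB0 _
    | succ n ih =>
      have : b - f (a (n + 1)) = b - f (a n) - f (g n (b - f (a n))) := by
        change b - f (a n + g n (b - f (a n))) = _
        rw [map_add]; abel
      rw [this]
      exact hg' n _ ih
  obtain ⟨x, hx⟩ := hA a fun n => by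
    change a n + g n (b - f (a n)) - a n ∈ FA n
    rw [add_sub_cancel_left]
    exact hg n _ (ha n)
  refine ⟨x, (sub_eq_zero.1 (hB _ fun n => ?_)).symm⟩
  have := sub_mem (ha n) (hf n _ (hx n))
  rwa [map_sub, sub_sub_sub_cancel_right] at this

end LieRinehart

namespace LieRinehart

theorem isUnit_natCast (K : Type*) {R : Type*} [Field K] [CharZero K] [CommRing R] [Algebra K R]
    {n : ℕ} (h : n ≠ 0) : IsUnit (n : R) := by
  have : IsUnit (n : K) := (Nat.cast_ne_zero.2 h).isUnit
  simpa using this.map (algebraMap K R)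

/-! ### Ordered monomials in a basis, and monomials in dual jets -/

section Monomials

variable {K R L : Type*} [Field K] [CharZero K] [CommRing R] [Algebra K R] [LieRing L]
  [LieAlgebra K L] [Module R L] [LieRingModule L R] [LieRinehartRing R L]
  [LieRinehartAlgebra K R L] {r : ℕ}

variable (K R) in
/-- The ordered monomial with exponents `b` in the elements `e i` of `L`. -/
noncomputable def mon (e : Fin r → L) (b : Multiset (Fin r)) : Env K R L :=
  lprod K R ((b.sort (· ≤ ·)).map e)

theorem mon_zero (e : Fin r → L) : mon K R e 0 = 1 := by simp [mon]

theorem mon_mem_filt (e : Fin r → L) {b : Multiset (Fin r)} {n : ℕ} (h : b.card < n) :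
    mon K R e b ∈ filt K R L n := lprod_mem_filt (by simpa using h)

theorem lprod_map_sub_mon_mem (e : Fin r → L) (l : List (Fin r)) :
    lprod K R (l.map e) - mon K R e (l : Multiset (Fin r)) ∈ filt K R L l.length := by
  have : ((l : Multiset (Fin r)).sort (· ≤ ·)).Perm l := by
    rw [← Multiset.coe_eq_coe, Multiset.sort_eq]
  have := lprod_sub_mem_of_perm (K := K) (R := R) (this.symm.map e)
  rwa [List.length_map] at this

variable (e : Module.Basis (Fin r) R L)

/-- A basis element times an ordered monomial is an ordered monomial up to shorter products, and
these are handled by induction on the order. -/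
theorem filt_le_span (n : ℕ) :
    filt K R L n ≤ Submodule.span R (mon K R e '' {b : Multiset (Fin r) | b.card < n}) := by
  induction n with
  | zero =>
    refine Submodule.span_le.2 ?_
    rintro _ ⟨l, hl, rfl⟩
    exact absurd hl (Nat.not_lt_zero _)
  | succ n ih =>
    have hmono : Submodule.span R (mon K R e '' {b : Multiset (Fin r) | b.card < n}) ≤
        Submodule.span R (mon K R e '' {b : Multiset (Fin r) | b.card < n + 1}) :=
      Submodule.span_mono (Set.image_mono fun b hb => Nat.lt_succ_of_lt hb)
    have key : ∀ (X : L) (D : Env K R L),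
        D ∈ Submodule.span R (mon K R e '' {b : Multiset (Fin r) | b.card < n}) →
        Env.ofL K R L X * D ∈
          Submodule.span R (mon K R e '' {b : Multiset (Fin r) | b.card < n + 1}) := by
      intro X D hD
      induction hD using Submodule.span_induction with
      | mem D hD =>
        obtain ⟨b, hb, rfl⟩ := hD
        have hb : b.card < n := hb
        rw [← e.sum_repr X, map_sum, Finset.sum_mul]
        refine Submodule.sum_mem _ fun i _ => ?_
        rw [← Env.ofR_mul_ofL, mul_assoc, ← Env.smul_def]
        refine Submodule.smul_mem _ _ ?_
        have h := lprod_map_sub_mon_mem (K := K) (R := R) e (i :: b.sort (· ≤ ·))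
        rw [List.map_cons, lprod_cons, ← Multiset.cons_coe, Multiset.sort_eq, List.length_cons,
          Multiset.length_sort] at h
        rw [mon, ← sub_add_cancel (Env.ofL K R L (e i) * _) (mon K R e (i ::ₘ b))]
        refine add_mem (hmono (ih (filt_mono (by omega) h))) (Submodule.subset_span ⟨_, ?_, rfl⟩)
        simpa using hb
      | zero => simp
      | add D E _ _ hD hE => rw [mul_add]; exact add_mem hD hE
      | smul f D hD' hD =>
        rw [ofL_mul_smul]
        exact add_mem (Submodule.smul_mem _ _ hD) (Submodule.smul_mem _ _ (hmono hD'))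
    refine Submodule.span_le.2 ?_
    rintro _ ⟨l, hl, rfl⟩
    cases l with
    | nil => exact Submodule.subset_span ⟨0, by simp, mon_zero _⟩
    | cons X l =>
      rw [lprod_cons]
      refine key X _ (ih (lprod_mem_filt ?_))
      simpa using hl

theorem span_mon : Submodule.span R (Set.range (mon K R e)) = ⊤ := by
  refine eq_top_iff.2 fun D _ => ?_
  obtain ⟨n, hn⟩ := exists_mem_filt D
  exact Submodule.span_mono (Set.image_subset_range _ _) (filt_le_span e _ hn)

open Jets

theorem Jets.vanish_iff_mon {n : ℕ} {φ : Jets K R L} :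
    Vanish n φ ↔ ∀ b : Multiset (Fin r), b.card < n → eval φ (mon K R e b) = 0 := by
  refine ⟨fun h b hb => h.eval_eq_zero (mon_mem_filt e hb), fun h l hl => ?_⟩
  have : filt K R L n ≤ LinearMap.ker (eval φ) := (filt_le_span e n).trans <| by
    refine Submodule.span_le.2 ?_
    rintro _ ⟨b, hb, rfl⟩
    exact h b hb
  exact this (lprod_mem_filt hl)

/-- To leading order exactly one factor differentiates `ξ` and the others differentiate `ψ`. The
factor must be an `e_k`, whence the multiplicity. The function `F` expresses that leading values of
`ψ` depend only on the multiset of indices. -/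
theorem Jets.eval_mul_lprod_map {ξ : Jets K R L} {k : Fin r} (h₀ : eval ξ 1 = 0)
    (he : ∀ i, eval ξ (Env.ofL K R L (e i)) = if i = k then 1 else 0)
    {n : ℕ} {ψ : Jets K R L} (hψ : Vanish n ψ) (F : Multiset (Fin r) → R)
    (hF : ∀ l : List (Fin r), l.length = n → eval ψ (lprod K R (l.map e)) = F l)
    (l : List (Fin r)) (hl : l.length = n + 1) :
    eval (ξ * ψ) (lprod K R (l.map e)) =
      (l : Multiset (Fin r)).count k * F ((l : Multiset (Fin r)).erase k) := by
  induction l using List.reverseRecOn generalizing n ψ F with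
  | nil => simp at hl
  | append_singleton l i ih =>
    rw [List.length_append, List.length_singleton, add_left_inj] at hl
    rw [List.map_append, List.map_singleton, eval_mul_lprod_append,
      eval_mul_of_vanish _ hψ (by simpa using hl), eval_smul, one_mul, he, hF l hl,
      ← Multiset.coe_add, Multiset.coe_singleton, Multiset.add_comm, Multiset.singleton_add]
    -- The last factor differentiates `ψ`, which replaces `F` by `s ↦ F (i ::ₘ s)`. For `n = 0` no
    -- factor is left and `ξ(1) = 0` decides.
    have h₂ : eval (ξ * (Env.ofL K R L (e i) • ψ)) (lprod K R (l.map e)) =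
        (l : Multiset (Fin r)).count k * F (i ::ₘ (l : Multiset (Fin r)).erase k) := by
      cases n with
      | zero =>
        have : l = [] := by simpa using hl
        subst this
        rw [List.map_nil, lprod_nil, eval_mul_one, h₀]; simp
      | succ n =>
        refine ih (hψ.ofL_smul _) (fun s => F (i ::ₘ s)) (fun l' hl' => ?_) hl
        have := hF (l' ++ [i]) (by simpa using hl')
        rw [← Multiset.coe_add, Multiset.coe_singleton, Multiset.add_comm,
          Multiset.singleton_add] at this
        rw [← this, eval_smul]
        simp
    rw [h₂]
    by_cases hik : i = k
    · subst hik
      rw [if_pos rfl, Multiset.count_cons_self, Multiset.erase_cons_head]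
      by_cases hi : i ∈ (l : Multiset (Fin r))
      · rw [Multiset.cons_erase hi]; push_cast; ring
      · rw [Multiset.count_eq_zero.2 hi]; simp
    · rw [if_neg hik, Multiset.count_cons_of_ne (Ne.symm hik), Multiset.erase_cons_tail _ hik]
      simp

/-- Jets without constant term dual to a basis of `L`. -/
structure IsDual (e : Module.Basis (Fin r) R L) (ξ : Fin r → Jets K R L) : Prop where
  eval_one : ∀ k, eval (ξ k) 1 = 0
  eval_ofL : ∀ k i, eval (ξ k) (Env.ofL K R L (e i)) = if i = k then 1 else 0

variable {e} {ξ : Fin r → Jets K R L} (hξ : IsDual e ξ)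

/-- The monomials in the jets `ξ`. -/
noncomputable def jetMon (ξ : Fin r → Jets K R L) (b : Multiset (Fin r)) : Jets K R L :=
  (b.map ξ).prod

theorem jetMon_cons (k : Fin r) (b : Multiset (Fin r)) :
    jetMon ξ (k ::ₘ b) = ξ k * jetMon ξ b := by simp [jetMon]

theorem IsDual.vanish_jetMon (hξ : IsDual e ξ) (b : Multiset (Fin r)) :
    Vanish b.card (jetMon ξ b) := by
  induction b using Multiset.induction with
  | empty => exact vanish_zero _
  | cons k b ih =>
    rw [jetMon_cons, Multiset.card_cons, add_comm]
    exact (vanish_one (hξ.eval_one k)).mul ih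

/-- Adding an index `k` multiplies the constant by the new multiplicity of `k`, so `c` is the
product of the factorials of the multiplicities. Only `c ≠ 0` is needed. -/
theorem IsDual.eval_jetMon (hξ : IsDual e ξ) (b : Multiset (Fin r)) : ∃ c : ℕ, c ≠ 0 ∧
    ∀ l : List (Fin r), l.length = b.card →
      eval (jetMon ξ b) (lprod K R (l.map e)) = if (l : Multiset (Fin r)) = b then (c : R) else 0 := by
  induction b using Multiset.induction with
  | empty =>
    refine ⟨1, one_ne_zero, fun l hl => ?_⟩
    have : l = [] := by simpa using hl
    subst this
    simp [jetMon]
  | cons k b ih =>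
    obtain ⟨c, hc, ih⟩ := ih
    refine ⟨(k ::ₘ b).count k * c, mul_ne_zero (by simp) hc, fun l hl => ?_⟩
    rw [jetMon_cons, Jets.eval_mul_lprod_map e (hξ.eval_one k) (hξ.eval_ofL k) (hξ.vanish_jetMon b)
      (fun s => if s = b then (c : R) else 0) ih l (by simpa using hl)]
    by_cases hk : k ∈ (l : Multiset (Fin r))
    · have : (l : Multiset (Fin r)).erase k = b ↔ (l : Multiset (Fin r)) = k ::ₘ b := by
        constructor
        · rintro rfl; rw [Multiset.cons_erase hk]
        · intro h; rw [h, Multiset.erase_cons_head]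
      simp only [this]
      split_ifs with h
      · rw [h]; push_cast; ring
      · simp
    · have : (l : Multiset (Fin r)) ≠ k ::ₘ b := fun h => hk (h ▸ Multiset.mem_cons_self k b)
      rw [Multiset.count_eq_zero.2 hk, if_neg this]
      simp

theorem IsDual.exists_pairing (hξ : IsDual e ξ) : ∃ c : Multiset (Fin r) → ℕ, (∀ b, c b ≠ 0) ∧
    ∀ a b : Multiset (Fin r), a.card = b.card →
      eval (jetMon ξ b) (mon K R e a) = if a = b then (c b : R) else 0 := by
  choose c hc hc' using hξ.eval_jetMon
  refine ⟨c, hc, fun a b hab => ?_⟩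
  have := hc' b (a.sort (· ≤ ·)) (by simpa using hab)
  rwa [Multiset.sort_eq] at this

/-- The pairing is triangular with units on the diagonal: a relation is paired with `ξ^b` for `b` of
maximal degree in its support, which kills all other terms. -/
theorem IsDual.linearIndependent (hξ : IsDual e ξ) : LinearIndependent R (mon K R e) := by
  obtain ⟨c, hc, hpair⟩ := hξ.exists_pairing
  rw [linearIndependent_iff]
  intro f hf
  by_contra hne
  obtain ⟨b, hb, hmax⟩ := f.support.exists_max_image Multiset.card
    (Finsupp.support_nonempty_iff.2 hne)
  have h := congrArg (eval (jetMon ξ b)) hf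
  rw [Finsupp.linearCombination_apply, Finsupp.sum, map_sum, map_zero, Finset.sum_eq_single b] at h
  · rw [map_smul, hpair b b rfl, if_pos rfl, smul_eq_mul] at h
    exact Finsupp.mem_support_iff.1 hb ((isUnit_natCast K (hc b)).mul_left_eq_zero.1 h)
  · intro a ha hab
    rw [map_smul]
    rcases (hmax a ha).lt_or_eq with hlt | heq
    · rw [(hξ.vanish_jetMon b).eval_eq_zero (mon_mem_filt e hlt), smul_zero]
    · rw [hpair a b heq, if_neg hab, smul_zero]
  · intro h; exact absurd hb h

/-- The basis of `U(L, R)` of ordered monomials. -/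
noncomputable def IsDual.basis (hξ : IsDual e ξ) : Module.Basis (Multiset (Fin r)) R (Env K R L) :=
  Module.Basis.mk hξ.linearIndependent (span_mon e).ge

@[simp] theorem IsDual.basis_apply (hξ : IsDual e ξ) (b : Multiset (Fin r)) :
    hξ.basis b = mon K R e b := Module.Basis.mk_apply _ _ _

theorem IsDual.exists_eval_eq (hξ : IsDual e ξ) (f : Multiset (Fin r) → R) :
    ∃ φ : Jets K R L, ∀ b, eval φ (mon K R e b) = f b :=
  ⟨of (hξ.basis.constr R f), fun b => by
    rw [eval_of, ← hξ.basis_apply, Module.Basis.constr_basis]⟩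

/-- The ring of jets is complete. -/
theorem IsDual.exists_limit (hξ : IsDual e ξ) (φ : ℕ → Jets K R L)
    (h : ∀ n, Vanish n (φ (n + 1) - φ n)) : ∃ ψ, ∀ n, Vanish n (ψ - φ n) := by
  -- The values on a product of `d` elements no longer change from stage `d + 1` on.
  obtain ⟨ψ, hψ⟩ := hξ.exists_eval_eq fun b => eval (φ (b.card + 1)) (mon K R e b)
  refine ⟨ψ, fun n => (vanish_iff_mon e).2 fun b hb => ?_⟩
  have : ∀ m k, k ≤ m → Vanish k (φ m - φ k) := fun m k hkm => by
    induction m, hkm using Nat.le_induction with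
    | base => rw [sub_self]; exact (vanishing K R L k).zero_mem
    | succ m hm ih =>
      rw [← sub_add_sub_cancel _ (φ m)]
      exact ((h m).mono hm).add ih
  have := (vanish_iff_mon e).1 (this n (b.card + 1) hb) b (by omega)
  rw [eval_sub, hψ, ← neg_eq_zero, neg_sub, ← eval_sub, this]

/-- A jet vanishing up to order `n` agrees, to the next order, with a combination of monomials of
degree `n`. -/
theorem IsDual.exists_approx (hξ : IsDual e ξ) {n : ℕ} {φ : Jets K R L} (h : Vanish n φ) :
    ∃ g : Sym (Fin r) n → R,
      Vanish (n + 1) (φ - ∑ b : Sym (Fin r) n, α₁ K R L (g b) * jetMon ξ b) := by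
  obtain ⟨c, hc, hpair⟩ := hξ.exists_pairing
  choose d hd using fun b => (isUnit_natCast K (R := R) (hc b)).exists_left_inv
  -- Taylor coefficients: the value on the ordered monomial divided by the pairing constant.
  refine ⟨fun b => eval φ (mon K R e b) * d b, (vanish_iff_mon e).2 fun a ha => ?_⟩
  rw [eval_sub, eval_sum]
  simp only [eval_alpha₁_mul]
  rcases (Nat.lt_succ_iff.1 ha).lt_or_eq with hlt | heq
  · rw [h.eval_eq_zero (mon_mem_filt e hlt), Finset.sum_eq_zero, sub_zero]
    intro b _
    rw [(hξ.vanish_jetMon b).eval_eq_zero (mon_mem_filt e (hlt.trans_eq b.card_coe.symm)), mul_zero]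
  · rw [Finset.sum_eq_single (Sym.mk a heq)]
    · change _ - eval φ (mon K R e a) * d a * eval (jetMon ξ a) (mon K R e a) = 0
      rw [hpair a a rfl, if_pos rfl, mul_assoc, hd, mul_one, sub_self]
    · intro b _ hb
      rw [hpair a b (heq.trans b.card_coe.symm), if_neg, mul_zero]
      rintro rfl
      exact hb rfl
    · simp

/-- A jet without constant term is a combination of the jets `ξ k`. -/
theorem IsDual.exists_eq_sum (hξ : IsDual e ξ) {φ : Jets K R L} (h : eval φ 1 = 0) :
    ∃ g : Fin r → Jets K R L, φ = ∑ k, ξ k * g k := by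
  -- The claim is that `g ↦ ∑ ξ_k g_k` maps onto the jets without constant term. Multiplication by
  -- `ξ_k` raises the order by one, so the filtration of the target is shifted by one.
  let B : AddSubgroup (Jets K R L) := (vanishing K R L 1).toAddSubgroup
  let f : (Fin r → Jets K R L) →+ B := AddMonoidHom.mk'
    (fun g => ⟨∑ k, ξ k * g k, (vanishing K R L 1).sum_mem fun k _ =>
      Ideal.mul_mem_right _ _ (vanish_one (hξ.eval_one k))⟩)
    (fun g g' => Subtype.ext (by simp [mul_add, Finset.sum_add_distrib]))
  have hf : ∀ g, (f g : Jets K R L) = ∑ k, ξ k * g k := fun g => rfl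
  have hsurj : Function.Surjective f := by
    refine surjective_of_filtered
      (fun n => AddSubgroup.pi Set.univ fun _ => (vanishing K R L n).toAddSubgroup)
      (fun n => (vanishing K R L (n + 1)).toAddSubgroup.comap B.subtype) f ?_ ?_ ?_ ?_ ?_
    · intro a ha
      choose x hx using fun k => hξ.exists_limit (fun n => a n k) fun n => ha n k trivial
      exact ⟨x, fun n k _ => hx k n⟩
    · intro b hb
      exact Subtype.ext (eq_zero_of_vanish fun n => Vanish.mono (hb n) (Nat.le_succ n))
    · intro b
      change Vanish (0 + 1) (b : Jets K R L)
      rw [zero_add]; exact b.2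
    · intro n a ha
      refine (vanishing K R L (n + 1)).sum_mem fun k _ => ?_
      have := (vanish_one (hξ.eval_one k)).mul (ha k trivial)
      rwa [add_comm] at this
    · rintro n ⟨φ, hφ⟩ hb
      obtain ⟨g, hg⟩ := hξ.exists_approx (φ := φ) hb
      have : ∀ b : Sym (Fin r) (n + 1), ∃ k, k ∈ (b : Multiset (Fin r)) :=
        fun b => Sym.exists_mem b
      -- Each monomial of positive degree is attributed to one of its variables, which is then
      -- divided out.
      choose k hk using this
      refine ⟨fun j => ∑ b : Sym (Fin r) (n + 1),
        if k b = j then α₁ K R L (g b) * jetMon ξ ((b : Multiset (Fin r)).erase (k b)) else 0,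
        fun j _ => (vanishing K R L n).sum_mem fun b _ => ?_, ?_⟩
      · split_ifs
        · refine Ideal.mul_mem_left _ _ ?_
          have := hξ.vanish_jetMon ((b : Multiset (Fin r)).erase (k b))
          have hcard : ((b : Multiset (Fin r)).erase (k b)).card = n := by
            rw [Multiset.card_erase_of_mem (hk b), b.card_coe]; rfl
          rwa [hcard] at this
        · exact zero_mem _
      · change Vanish (n + 1 + 1) (φ - (f _ : Jets K R L))
        rw [hf]
        convert hg using 2
        simp only [Finset.mul_sum]
        rw [Finset.sum_comm]
        refine Finset.sum_congr rfl fun b _ => ?_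
        rw [Finset.sum_eq_single (k b)]
        · rw [if_pos rfl, mul_left_comm, ← jetMon_cons, Multiset.cons_erase (hk b)]
        · intro j _ hj; rw [if_neg (Ne.symm hj), mul_zero]
        · simp
  obtain ⟨g, hg⟩ := hsurj ⟨φ, vanish_one h⟩
  exact ⟨g, by rw [← hf, hg]⟩

end Monomials

end LieRinehart

namespace LieRinehart

/-! ### The action of `A ⊗ U(L, R)` on `A` by differential operators -/

section SmashAction

variable {K R L A : Type*} [CommRing K] [CommRing R] [Algebra K R] [LieRing L]
  [Module R L] [LieRingModule L R]
  [CommRing A] [Algebra K A] [Algebra R A] [Module (Env K R L) A] [IsScalarTower K R A]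
  [EnvAlgebra K R L A]

namespace Smash

/-- The action of `U(L, R)` on `A` by `K`-linear maps. -/
noncomputable def envEnd : Env K R L →ₐ[K] Module.End K A :=
  AlgHom.ofLinearMap
    { toFun := fun D =>
        { toFun := fun a => D • a
          map_add' := fun a b => smul_add D a b
          map_smul' := fun c a => Env.smul_smulK D c a }
      map_add' := fun D E => LinearMap.ext fun a => add_smul D E a
      map_smul' := fun c D => LinearMap.ext fun a => Env.smulK_smul c D a }
    (LinearMap.ext fun a => one_smul _ a) (fun D E => LinearMap.ext fun a => mul_smul D E a)

/-- The action of `A ⊗ U(L, R)` on `A`, as an additive map. -/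
noncomputable def actAux : A ⊗[R] Env K R L →+ Module.End K A :=
  TensorProduct.liftAddHom
    { toFun := fun a =>
        { toFun := fun D => Algebra.lmul K A a * envEnd D
          map_zero' := by rw [map_zero, mul_zero]
          map_add' := fun D D' => by rw [map_add, mul_add] }
      map_zero' := by ext D : 1; simp
      map_add' := fun a b => by ext D : 1; simp [add_mul] }
    (fun f a D => LinearMap.ext fun b => by
      change (f • a) * (D • b) = a * ((f • D) • b)
      rw [smul_assoc f D b, Algebra.mul_smul_comm, Algebra.smul_mul_assoc])

theorem actAux_tmul (a : A) (D : Env K R L) (b : A) : actAux (a ⊗ₜ[R] D) b = a * (D • b) := rfl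

theorem actAux_smul (a : A) (t : A ⊗[R] Env K R L) (b : A) :
    actAux (a • t) b = a * actAux t b := by
  induction t with
  | zero => simp
  | add x y hx hy => rw [smul_add, map_add, map_add]; simp [hx, hy, mul_add]
  | tmul c D => rw [TensorProduct.smul_tmul', actAux_tmul, actAux_tmul, smul_eq_mul, mul_assoc]

/-- For `D = X` and `t = c ⊗ E` this is the Leibniz rule for `X` on the product `c · E(b)`. It is
what makes the action multiplicative. -/
theorem actAux_tensorAct (D : Env K R L) (t : A ⊗[R] Env K R L) (b : A) :
    actAux (tensorAct D t) b = D • actAux t b := by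
  induction D using Env.induction generalizing t with
  | hR f =>
    rw [tensorAct_ofR, ← algebraMap_smul A f t, actAux_smul, Env.ofR_smul, Algebra.smul_def]
  | hL X =>
    induction t with
    | zero => simp
    | add x y hx hy => simp only [map_add, LinearMap.add_apply, hx, hy, smul_add]
    | tmul c E =>
      rw [tensorAct_ofL, map_add, LinearMap.add_apply, actAux_tmul, actAux_tmul, actAux_tmul,
        EnvAlgebra.ofL_smul_mul, smul_eq_mul, mul_smul]
  | hadd a b ha hb => rw [map_add, LinearMap.add_apply, map_add, LinearMap.add_apply, ha, hb, add_smul]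
  | hmul a b ha hb => rw [map_mul, Module.End.mul_apply, ha, hb, mul_smul]

theorem actAux_smulK (c : K) (t : A ⊗[R] Env K R L) (b : A) :
    actAux (c • t) b = c • actAux t b := by
  induction t with
  | zero => simp
  | add x y hx hy => rw [smul_add, map_add, map_add]; simp [hx, hy]
  | tmul a D => rw [TensorProduct.smul_tmul', actAux_tmul, actAux_tmul, smul_mul_assoc]

theorem actAux_mulLeft (s t : A ⊗[R] Env K R L) (b : A) :
    actAux (mulLeft K R L A s t) b = actAux s (actAux t b) := by
  induction s with
  | zero => simp
  | add x y hx hy => simp only [map_add, LinearMap.add_apply, hx, hy]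
  | tmul a D => rw [mulLeft_tmul, actAux_smul, actAux_tensorAct, actAux_tmul]

variable (K R L A) in
/-- The action of the algebra `A ⊗ U(L, R)` on `A`, `(a ⊗ D)(b) = a D(b)`. -/
noncomputable def act : Smash K R L A →ₐ[K] Module.End K A :=
  AlgHom.ofLinearMap
    { toFun := fun t => actAux (t : A ⊗[R] Env K R L)
      map_add' := fun s t => map_add actAux s t
      map_smul' := fun c t => LinearMap.ext fun b => actAux_smulK c (t : A ⊗[R] Env K R L) b }
    (LinearMap.ext fun b => by
      change (1 : A) * ((1 : Env K R L) • b) = b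
      rw [one_mul, one_smul])
    (fun s t => LinearMap.ext fun b =>
      actAux_mulLeft (s : A ⊗[R] Env K R L) (t : A ⊗[R] Env K R L) b)

@[simp] theorem act_tmul (a : A) (D : Env K R L) (b : A) :
    act K R L A (tmul a D) b = a * (D • b) := rfl

end Smash

theorem IsDiffOp.lmul_mul {K A : Type*} [CommRing K] [CommRing A] [Algebra K A] (c : A) :
    ∀ {n} {D : Module.End K A}, IsDiffOp n D → IsDiffOp n (Algebra.lmul K A c * D)
  | 0, D, hD => by
    have hD : D = 0 := hD
    rw [hD, mul_zero]; rfl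
  | n + 1, D, hD => fun a => by
    have := (hD a).lmul_mul c
    rwa [mul_sub, ← mul_assoc, ← mul_assoc, ← map_mul, mul_comm c a, map_mul, mul_assoc,
      mul_assoc] at this

theorem IsDiffOp.neg {K A : Type*} [CommRing K] [CommRing A] [Algebra K A] {n : ℕ}
    {D : Module.End K A} (hD : IsDiffOp n D) : IsDiffOp n (-D) := by
  have e : Algebra.lmul K A (-1) * D = -D := LinearMap.ext fun a => neg_one_mul (D a)
  rw [← e]; exact hD.lmul_mul (-1)

theorem IsDiffOp.sub {K A : Type*} [CommRing K] [CommRing A] [Algebra K A] {n : ℕ}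
    {D E : Module.End K A} (hD : IsDiffOp n D) (hE : IsDiffOp n E) : IsDiffOp n (D - E) := by
  rw [sub_eq_add_neg]; exact hD.add hE.neg

theorem IsDiffOp.sum {K A ι : Type*} [CommRing K] [CommRing A] [Algebra K A] {n : ℕ}
    {D : ι → Module.End K A} (s : Finset ι) (hD : ∀ i, IsDiffOp n (D i)) :
    IsDiffOp n (∑ i ∈ s, D i) :=
  Finset.sum_induction _ (IsDiffOp n) (fun _ _ => IsDiffOp.add) (IsDiffOp.zero n) fun i _ => hD i

/-- The identity `[a, X D] = X [a, D] - X(a) D` bounds the order by induction. -/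
theorem IsDiffOp.envEnd_ofL_mul (X : L) : ∀ {n} {D : Module.End K A}, IsDiffOp n D →
    IsDiffOp (n + 1) (Smash.envEnd (Env.ofL K R L X) * D)
  | 0, D, hD => by
    have hD : D = 0 := hD
    rw [hD, mul_zero]; exact IsDiffOp.zero _
  | n + 1, D, hD => fun a => by
    have h₁ := (hD a).envEnd_ofL_mul X
    have h₂ := hD.lmul_mul (Env.ofL K R L X • a)
    have := h₁.sub h₂
    have e : ∀ b : A, Env.ofL K R L X • (a * b) =
        (Env.ofL K R L X • a) * b + a * (Env.ofL K R L X • b) := EnvAlgebra.ofL_smul_mul X a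
    convert this using 1
    ext b
    change a * (Env.ofL K R L X • D b) - Env.ofL K R L X • D (a * b) =
      Env.ofL K R L X • (a * D b - D (a * b)) - (Env.ofL K R L X • a) * D b
    rw [smul_sub, e]; ring

/-- Both filtrations use strict bounds, so the indices agree without a shift. -/
theorem isDiffOp_envEnd {n : ℕ} {D : Env K R L} (hD : D ∈ filt K R L n) :
    IsDiffOp n (Smash.envEnd D : Module.End K A) := by
  induction hD using Submodule.span_induction with
  | mem D hD =>
    obtain ⟨l, hl, rfl⟩ := hD
    have : ∀ l : List L, IsDiffOp (l.length + 1) (Smash.envEnd (lprod K R l) : Module.End K A) :=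
      fun l => by
      induction l with
      | nil => intro a; rw [lprod_nil, map_one, mul_one, one_mul, sub_self]; rfl
      | cons X l ih => rw [lprod_cons, map_mul]; exact ih.envEnd_ofL_mul X
    exact (this l).mono hl
  | zero => rw [map_zero]; exact IsDiffOp.zero n
  | add D E _ _ hD hE => rw [map_add]; exact hD.add hE
  | smul f D _ hD =>
    have : (Smash.envEnd (f • D) : Module.End K A) =
        Algebra.lmul K A (algebraMap R A f) * Smash.envEnd D := LinearMap.ext fun a => by
      change (f • D) • a = algebraMap R A f * (D • a)
      rw [smul_assoc, Algebra.smul_def]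
    rw [this]
    exact hD.lmul_mul _

theorem isDiffOp_act_tmul (a : A) {n : ℕ} {D : Env K R L} (hD : D ∈ filt K R L n) :
    IsDiffOp n (Smash.act K R L A (Smash.tmul a D)) := (isDiffOp_envEnd hD).lmul_mul a

end SmashAction

/-! ### Differential operators on the jets of a free Lie–Rinehart algebra -/

section JetOperators

open Jets

variable {K R L : Type*} [Field K] [CharZero K] [CommRing R] [Algebra K R] [LieRing L]
  [LieAlgebra K L] [Module R L] [LieRingModule L R] [LieRinehartRing R L]
  [LieRinehartAlgebra K R L] {r : ℕ} {e : Module.Basis (Fin r) R L} {ξ : Fin r → Jets K R L}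

/-- An element is a finite sum of `φ_b ⊗ e^b`. If it acts as zero, all `φ_b` vanish to every order:
applying the sum to a jet dual to `e^b` and comparing values on products of length `n` leaves only
the leading term of `φ_b`. -/
theorem IsDual.act_injective (hξ : IsDual e ξ) :
    Function.Injective (Smash.act K R L (Jets K R L)) := by
  rw [injective_iff_map_eq_zero]
  intro t ht
  let B := hξ.basis.baseChange (Jets K R L)
  let φ : Multiset (Fin r) →₀ Jets K R L := B.repr (t : Jets K R L ⊗[R] Env K R L)
  have h : ∀ ψ : Jets K R L, ∑ b ∈ φ.support, φ b * (mon K R e b • ψ) = 0 := fun ψ => by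
    have h₁ : (t : Jets K R L ⊗[R] Env K R L) = ∑ b ∈ φ.support, φ b ⊗ₜ[R] mon K R e b := by
      have := B.linearCombination_repr (t : Jets K R L ⊗[R] Env K R L)
      rw [Finsupp.linearCombination_apply, Finsupp.sum] at this
      rw [← this]
      refine Finset.sum_congr rfl fun b _ => ?_
      rw [Module.Basis.baseChange_apply, hξ.basis_apply, TensorProduct.smul_tmul', smul_eq_mul,
        mul_one]
    have h₂ : Smash.actAux (t : Jets K R L ⊗[R] Env K R L) ψ = 0 := DFunLike.congr_fun ht ψ
    rw [h₁, map_sum, LinearMap.sum_apply] at h₂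
    exact h₂
  have hv : ∀ n b, Vanish n (φ b) := fun n => by
    induction n with
    | zero => exact fun b => vanish_zero _
    | succ n ih =>
      intro b l hl
      rcases (Nat.lt_succ_iff.1 hl).lt_or_eq with hlt | heq
      · exact ih b l hlt
      -- By this choice the constant term of `e^a • ψ` is `1` for `a = b` and `0` otherwise.
      obtain ⟨ψ, hψ⟩ := hξ.exists_eval_eq fun a => if a = b then 1 else 0
      have := congrArg (fun χ => eval χ (lprod K R l)) (h ψ)
      simp only [eval_sum, eval_zero] at this
      by_cases hb : b ∈ φ.support
      · rw [Finset.sum_eq_single b] at this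
        · rwa [mul_comm, eval_mul_of_vanish _ (ih b) heq, eval_smul, one_mul, hψ, if_pos rfl,
            one_mul] at this
        · intro a _ hab
          rw [mul_comm, eval_mul_of_vanish _ (ih a) heq, eval_smul, one_mul, hψ, if_neg hab,
            zero_mul]
        · intro h; exact absurd hb h
      · rw [Finsupp.notMem_support_iff.1 hb, eval_zero]
  have hφ : φ = 0 := Finsupp.ext fun b => eq_zero_of_vanish fun n => hv n b
  exact B.repr.map_eq_zero_iff.1 hφ

/-- A differential operator of order less than `n`, linear with respect to the first module
structure, is determined by its values on the monomials of degree less than `n`. -/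
theorem IsDual.eq_zero_of_isDiffOp (hξ : IsDual e ξ) (n : ℕ) : ∀ (D : Module.End K (Jets K R L)),
    (∀ f φ, D (α₁ K R L f * φ) = α₁ K R L f * D φ) → IsDiffOp n D →
    (∀ b : Multiset (Fin r), b.card < n → D (jetMon ξ b) = 0) → D = 0 := by
  induction n with
  | zero => exact fun D _ hD _ => hD
  | succ n ih =>
    intro D hlin hD h
    -- The commutator with `ξ_k` has smaller order, and on monomials of degree less than `n` it
    -- involves `D` only in degree at most `n`. So it is zero by induction.
    have hcomm : ∀ k φ, D (ξ k * φ) = ξ k * D φ := fun k => by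
      have := ih _ (fun f φ => ?_) (hD (ξ k)) (fun b hb => ?_)
      · intro φ
        have := DFunLike.congr_fun this φ
        exact (sub_eq_zero.1 this).symm
      · change ξ k * D (α₁ K R L f * φ) - D (ξ k * (α₁ K R L f * φ)) =
          α₁ K R L f * (ξ k * D φ - D (ξ k * φ))
        rw [mul_left_comm, hlin, hlin]; ring
      · change ξ k * D (jetMon ξ b) - D (ξ k * jetMon ξ b) = 0
        rw [h b (by omega), ← jetMon_cons, h _ (by simpa using hb), mul_zero, sub_zero]
    have h1 : D 1 = 0 := h 0 (by simp)
    -- Continuity of `D` is not assumed. Instead every jet is a constant plus `∑ ξ_k g_k`; `D` kills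
    -- the constant and passes through `ξ_k`, so each round gains one order of vanishing.
    have key : ∀ m φ, Vanish m (D φ) := fun m => by
      induction m with
      | zero => exact fun φ => vanish_zero _
      | succ m ihm =>
        intro φ
        have h₀ : eval (φ - α₁ K R L (eval φ 1)) 1 = 0 := by
          rw [eval_sub, α₁_apply, one_smul, mul_one, sub_self]
        obtain ⟨g, hg⟩ := hξ.exists_eq_sum h₀
        have : D φ = ∑ k, ξ k * D (g k) := by
          rw [sub_eq_iff_eq_add] at hg
          have e₁ : D (α₁ K R L (eval φ 1)) = 0 := by
            have := hlin (eval φ 1) 1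
            rwa [h1, mul_zero, mul_one] at this
          rw [hg, map_add, e₁, add_zero, map_sum]
          simp only [hcomm]
        rw [this]
        refine (vanishing K R L (m + 1)).sum_mem fun k _ => ?_
        have := (vanish_one (hξ.eval_one k)).mul (ihm (g k))
        rwa [add_comm] at this
    exact LinearMap.ext fun φ => eq_zero_of_vanish fun m => key m φ

/-- The values in the top degree are matched first by ordered monomials of that degree. An operator
of lower order then corrects the remaining values, and it does not disturb the top ones since `ξ^b`
vanishes to order `|b|`. -/
theorem IsDual.exists_eval_jetMon_eq (hξ : IsDual e ξ) (n : ℕ) : ∀ t : Multiset (Fin r) → R,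
    ∃ D ∈ filt K R L n, ∀ b : Multiset (Fin r), b.card < n → eval (jetMon ξ b) D = t b := by
  obtain ⟨c, hc, hpair⟩ := hξ.exists_pairing
  choose d hd using fun b => (isUnit_natCast K (R := R) (hc b)).exists_left_inv
  induction n with
  | zero => exact fun t => ⟨0, zero_mem _, fun b hb => by omega⟩
  | succ n ih =>
    intro t
    let D₁ : Env K R L := ∑ a : Sym (Fin r) n, (t a * d a) • mon K R e a
    obtain ⟨D₂, hD₂, h₂⟩ := ih fun b => t b - eval (jetMon ξ b) D₁
    refine ⟨D₁ + D₂, add_mem (Submodule.sum_mem _ fun a _ => Submodule.smul_mem _ _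
      (mon_mem_filt e (Nat.lt_succ_of_le a.card_coe.le))) (filt_mono (Nat.le_succ n) hD₂),
      fun b hb => ?_⟩
    rcases (Nat.lt_succ_iff.1 hb).lt_or_eq with hlt | heq
    · rw [map_add, h₂ b hlt]; ring
    · rw [map_add, (hξ.vanish_jetMon b).eval_eq_zero (D := D₂) (by rw [heq]; exact hD₂), add_zero, map_sum,
        Finset.sum_eq_single (Sym.mk b heq)]
      · change eval (jetMon ξ b) ((t b * d b) • mon K R e b) = _
        rw [map_smul, hpair b b rfl, if_pos rfl, smul_eq_mul, mul_assoc, hd, mul_one]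
      · intro a _ ha
        rw [map_smul, hpair a b (a.card_coe.trans heq.symm), if_neg, smul_zero]
        rintro rfl
        exact ha rfl
      · simp

theorem Jets.smul_alpha₁_mul (D : Env K R L) (f : R) (φ : Jets K R L) :
    D • (α₁ K R L f * φ) = α₁ K R L f * (D • φ) := by
  ext E; simp [eval_alpha₁_mul]

theorem Jets.act_alpha₁_mul (t : Smash K R L (Jets K R L)) (f : R) (φ : Jets K R L) :
    Smash.act K R L _ t (α₁ K R L f * φ) = α₁ K R L f * Smash.act K R L _ t φ := by
  induction t using Smash.induction with
  | h0 => simp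
  | ht ψ D => rw [Smash.act_tmul, Smash.act_tmul, Jets.smul_alpha₁_mul, mul_left_comm]
  | hadd x y hx hy => rw [map_add, LinearMap.add_apply, LinearMap.add_apply, hx, hy, mul_add]

/-- The differential operators on jets which are linear with respect to the first module structure
come from `J(L, R) ⊗ U(L, R)`. -/
theorem IsDual.exists_act_eq (hξ : IsDual e ξ) {n : ℕ} {D : Module.End K (Jets K R L)}
    (hlin : ∀ f φ, D (α₁ K R L f * φ) = α₁ K R L f * D φ) (hD : IsDiffOp n D) :
    ∃ t, Smash.act K R L (Jets K R L) t = D := by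
  -- A finite index set for the monomials of degree less than `n`.
  let I := (k : Fin n) × Sym (Fin r) k
  let m : I → Multiset (Fin r) := fun i => i.2
  have hm : ∀ i, (m i).card < n := fun i => i.2.card_coe.trans_lt i.1.2
  have hm' : Function.Injective m := by
    rintro ⟨k, s⟩ ⟨k', s'⟩ h
    have h : (s : Multiset (Fin r)) = s' := h
    have : k = k' := Fin.ext (by rw [← s.card_coe, ← s'.card_coe, h])
    subst this
    rw [Sym.coe_injective h]
  choose v hv hv' using fun i : I => hξ.exists_eval_jetMon_eq n fun b => if b = m i then 1 else 0
  let F : AddSubgroup (I → Jets K R L) := ⊤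
  -- The values on the monomials `ξ^{m_j}` of the operator with coefficients `φ_i` along `v_i`.
  let f : (I → Jets K R L) →+ (I → Jets K R L) := AddMonoidHom.mk'
    (fun φ j => ∑ i, φ i * (v i • jetMon ξ (m j)))
    (fun φ ψ => funext fun j => by simp [add_mul, Finset.sum_add_distrib])
  let FA : ℕ → AddSubgroup (I → Jets K R L) := fun k =>
    AddSubgroup.pi Set.univ fun _ => (vanishing K R L k).toAddSubgroup
  -- The matrix `v_i • ξ^{m_j}` has constant terms `δ_ij`. Thus `b` itself solves the system for `b`
  -- to leading order, and completeness does the rest.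
  have hf : Function.Surjective f := by
    refine surjective_of_filtered FA FA f (fun a ha => ?_) (fun b hb => ?_) (fun b j _ => ?_)
      (fun k a ha j _ => ?_) (fun k b hb => ⟨b, hb, fun j _ => ?_⟩)
    · choose x hx using fun j => hξ.exists_limit (fun k => a k j) fun k => ha k j trivial
      exact ⟨x, fun k j _ => hx j k⟩
    · exact funext fun j => eq_zero_of_vanish fun k => hb k j trivial
    · exact vanish_zero _
    · exact (vanishing K R L k).sum_mem fun i _ => Ideal.mul_mem_right _ _ (ha i trivial)
    · intro l hl
      change eval (b j - ∑ i, b i * (v i • jetMon ξ (m j))) _ = 0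
      have hbk : ∀ i, Vanish k (b i) := fun i => hb i trivial
      rcases (Nat.lt_succ_iff.1 hl).lt_or_eq with hlt | heq
      · exact ((vanishing K R L k).sub_mem (hbk j) ((vanishing K R L k).sum_mem fun i _ =>
          Ideal.mul_mem_right _ _ (hbk i))) l hlt
      · rw [eval_sub, eval_sum, Finset.sum_eq_single j]
        · rw [mul_comm, eval_mul_of_vanish _ (hbk j) heq, eval_smul, one_mul, hv' j _ (hm j),
            if_pos rfl, one_mul, sub_self]
        · intro i _ hij
          rw [mul_comm, eval_mul_of_vanish _ (hbk i) heq, eval_smul, one_mul, hv' i _ (hm j),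
            if_neg (fun h => hij (hm' h.symm)), zero_mul]
        · simp
  obtain ⟨φ, hφ⟩ := hf fun j => D (jetMon ξ (m j))
  refine ⟨∑ i, Smash.tmul (φ i) (v i), (sub_eq_zero.1
    (hξ.eq_zero_of_isDiffOp n (_ - _) (fun g ψ => ?_) (IsDiffOp.sub ?_ hD) fun b hb => ?_))⟩
  · rw [LinearMap.sub_apply, LinearMap.sub_apply, Jets.act_alpha₁_mul, hlin, mul_sub]
  · rw [map_sum]
    exact IsDiffOp.sum _ fun i => isDiffOp_act_tmul _ (hv i)
  · have := congrFun hφ (⟨⟨b.card, hb⟩, Sym.mk b rfl⟩ : I)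
    change ∑ i, φ i * (v i • jetMon ξ b) = D (jetMon ξ b) at this
    rw [map_sum, LinearMap.sub_apply, LinearMap.sum_apply, ← this, sub_eq_zero]
    rfl

end JetOperators

end LieRinehart

namespace LieRinehart

/-! ### Derivations of the convolution product -/

section Contraction

variable {K R L L₀ : Type*} [CommRing K] [CommRing R] [Algebra K R]
  [LieRing L] [LieAlgebra K L] [Module R L] [LieRingModule L R]
  [LieRinehartRing R L] [LieRinehartAlgebra K R L]
  [LieRing L₀] [LieAlgebra K L₀] [Module R L₀] [LieRingModule L₀ R]
  [LieRinehartRing R L₀] [LieRinehartAlgebra K R L₀] [IsAbelian R L₀]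

/-- The convolution product of two linear maps from `Sym(L)` to jets. -/
noncomputable def conv (Φ Ψ : Env K R L₀ →ₗ[R] Jets K R L) : Env K R L₀ →ₗ[R] Jets K R L :=
  LinearMap.mul' R (Jets K R L) ∘ₗ TensorProduct.map Φ Ψ ∘ₗ comulEnv

theorem conv_apply (Φ Ψ : Env K R L₀ →ₗ[R] Jets K R L) (P : Env K R L₀) :
    conv Φ Ψ P = LinearMap.mul' R (Jets K R L) (TensorProduct.map Φ Ψ (comulEnv P)) := rfl

theorem conv_one (Φ Ψ : Env K R L₀ →ₗ[R] Jets K R L) : conv Φ Ψ 1 = Φ 1 * Ψ 1 := by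
  rw [conv_apply, comulEnv_one, TensorProduct.map_tmul, LinearMap.mul'_apply]

theorem conv_add (Φ Ψ Ψ' : Env K R L₀ →ₗ[R] Jets K R L) :
    conv Φ (Ψ + Ψ') = conv Φ Ψ + conv Φ Ψ' := by
  ext1 P
  simp [conv_apply, TensorProduct.map_add_right]

theorem add_conv (Φ Φ' Ψ : Env K R L₀ →ₗ[R] Jets K R L) :
    conv (Φ + Φ') Ψ = conv Φ Ψ + conv Φ' Ψ := by
  ext1 P
  simp [conv_apply, TensorProduct.map_add_left]

theorem zero_conv (Ψ : Env K R L₀ →ₗ[R] Jets K R L) : conv (0 : Env K R L₀ →ₗ[R] Jets K R L) Ψ = 0 := by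
  have := add_conv 0 0 Ψ
  simpa using this

theorem conv_zero (Ψ : Env K R L₀ →ₗ[R] Jets K R L) : conv Ψ (0 : Env K R L₀ →ₗ[R] Jets K R L) = 0 := by
  have := conv_add Ψ 0 0
  simpa using this

/-- The contraction of a linear map on `Sym(L)` with an element of `L`. -/
noncomputable def contr (Y : L₀) : (Env K R L₀ →ₗ[R] Jets K R L) →+ (Env K R L₀ →ₗ[R] Jets K R L) :=
  AddMonoidHom.mk' (fun Φ => Φ ∘ₗ mulOfL Y) fun _ _ => rfl

theorem contr_apply (Y : L₀) (Φ : Env K R L₀ →ₗ[R] Jets K R L) (P : Env K R L₀) :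
    contr Y Φ P = Φ (Env.ofL K R L₀ Y * P) := rfl

/-- Contractions are derivations because `Y` is primitive for the comultiplication. -/
theorem contr_conv (Y : L₀) (Φ Ψ : Env K R L₀ →ₗ[R] Jets K R L) :
    contr Y (conv Φ Ψ) = conv (contr Y Φ) Ψ + conv Φ (contr Y Ψ) := by
  ext1 P
  rw [contr_apply, LinearMap.add_apply, conv_apply, conv_apply, conv_apply, comulEnv_mul]
  generalize comulEnv P = t
  induction t with
  | zero => simp
  | add x y hx hy => simp only [map_add, hx, hy]; abel
  | tmul a b =>
    simp only [tensorAct_ofL, map_add, TensorProduct.map_tmul, LinearMap.mul'_apply, contr_apply,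
      smul_eq_mul]

theorem linearMap_ext_lprod {M : Type*} [AddCommGroup M] [Module R M] {Φ Ψ : Env K R L₀ →ₗ[R] M}
    (h : ∀ l : List L₀, Φ (lprod K R l) = Ψ (lprod K R l)) : Φ = Ψ := by
  ext1 P
  induction P using Env.induction_lprod with
  | hadd a b ha hb => rw [map_add, map_add, ha, hb]
  | hs f l => rw [map_smul, map_smul, h]

/-- `T` is a derivation for the convolution product. -/
def IsConvDer (T : (Env K R L₀ →ₗ[R] Jets K R L) →+ (Env K R L₀ →ₗ[R] Jets K R L)) : Prop :=
  ∀ Φ Ψ, T (conv Φ Ψ) = conv (T Φ) Ψ + conv Φ (T Ψ)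

theorem isConvDer_contr (Y : L₀) :
    IsConvDer (contr Y : (Env K R L₀ →ₗ[R] Jets K R L) →+ (Env K R L₀ →ₗ[R] Jets K R L)) :=
  contr_conv Y

theorem IsConvDer.add {S T : (Env K R L₀ →ₗ[R] Jets K R L) →+ (Env K R L₀ →ₗ[R] Jets K R L)}
    (hS : IsConvDer S) (hT : IsConvDer T) : IsConvDer (S + T) := fun Φ Ψ => by
  simp only [AddMonoidHom.add_apply, hS Φ Ψ, hT Φ Ψ, add_conv, conv_add]
  abel

theorem IsConvDer.neg {T : (Env K R L₀ →ₗ[R] Jets K R L) →+ (Env K R L₀ →ₗ[R] Jets K R L)}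
    (hT : IsConvDer T) : IsConvDer (-T) := fun Φ Ψ => by
  have h₁ : conv (T Φ) Ψ + conv (-T Φ) Ψ = 0 := by rw [← add_conv, add_neg_cancel, zero_conv]
  have h₂ : conv Φ (T Ψ) + conv Φ (-T Ψ) = 0 := by rw [← conv_add, add_neg_cancel, conv_zero]
  simp only [AddMonoidHom.neg_apply, hT Φ Ψ]
  rw [neg_add, ← eq_neg_of_add_eq_zero_right h₁, ← eq_neg_of_add_eq_zero_right h₂]

/-- An operator whose commutators with contractions are derivations is a derivation. -/
theorem isConvDer_of_contr {T : (Env K R L₀ →ₗ[R] Jets K R L) →+ (Env K R L₀ →ₗ[R] Jets K R L)}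
    (S : L₀ → (Env K R L₀ →ₗ[R] Jets K R L) →+ (Env K R L₀ →ₗ[R] Jets K R L))
    (hS : ∀ Y, IsConvDer (S Y)) (hT : ∀ Y Φ, contr Y (T Φ) = T (contr Y Φ) + S Y Φ)
    (h1 : ∀ Φ Ψ, T (conv Φ Ψ) 1 = T Φ 1 * Ψ 1 + Φ 1 * T Ψ 1) : IsConvDer T := by
  suffices h : ∀ (l : List L₀) Φ Ψ, T (conv Φ Ψ) (lprod K R l) =
      (conv (T Φ) Ψ + conv Φ (T Ψ)) (lprod K R l) from
    fun Φ Ψ => linearMap_ext_lprod fun l => h l Φ Ψ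
  intro l
  -- A contraction strips the first factor of `l`. The induction must run over all `Φ` and `Ψ` at
  -- once, since contracting changes them; only the value at `1` has to be assumed.
  induction l with
  | nil => intro Φ Ψ; rw [lprod_nil, h1, LinearMap.add_apply, conv_one, conv_one]
  | cons Y l ih =>
    intro Φ Ψ
    rw [lprod_cons, ← contr_apply, ← contr_apply, hT, map_add, contr_conv, contr_conv, contr_conv,
      map_add, hS Y, hT, hT]
    simp only [LinearMap.add_apply, ih, conv_add, add_conv]
    abel

end Contraction

/-! ### The symmetrized connection is a derivation -/

section Symmetrized

variable {K R L L₀ : Type*} [CommRing K] [CommRing R] [Algebra K R]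
  [LieRing L] [LieAlgebra K L] [Module R L] [LieRingModule L R]
  [LieRinehartRing R L] [LieRinehartAlgebra K R L]
  [LieRing L₀] [LieAlgebra K L₀] [Module R L₀] [LieRingModule L₀ R]
  [LieRinehartRing R L₀] [LieRinehartAlgebra K R L₀] [IsAbelian R L₀]
  (e : L₀ ≃ₗ[R] L) (nab : Connection K R L L)

theorem symConn_one (Y : L) : symConn e nab Y 1 = 0 := by
  have := symConn_mul e nab Y 1 1
  simpa using this

/-- The connection `∇⁽²⁾ ⊗ 1 + 1 ⊗ ∇` in the direction of `Y`. -/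
noncomputable def covDer (Y : L) :
    (Env K R L₀ →ₗ[R] Jets K R L) →+ (Env K R L₀ →ₗ[R] Jets K R L) :=
  AddMonoidHom.mk' (fun Φ =>
    { toFun := fun P => Env.ofL K R L Y • Φ P - Φ (symConn e nab Y P)
      map_add' := fun P Q => by rw [map_add, map_add, map_add, smul_add]; abel
      map_smul' := fun f P => by
        rw [map_smul, symConn_smul, Env.ofL_smul_smul, map_add, map_smul, map_smul,
          RingHom.id_apply, smul_sub]
        abel })
    fun Φ Ψ => by
      ext1 P
      change _ • (Φ P + Ψ P) - (Φ _ + Ψ _) = (_ • Φ P - _) + (_ • Ψ P - _)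
      rw [smul_add]; abel

theorem covDer_apply (Y : L) (Φ : Env K R L₀ →ₗ[R] Jets K R L) (P : Env K R L₀) :
    covDer e nab Y Φ P = Env.ofL K R L Y • Φ P - Φ (symConn e nab Y P) := rfl

/-- The commutator with contraction by `Z` is minus contraction by `∇_Y Z`, which is a derivation;
at `1` the claim is the Leibniz rule on jets. -/
theorem isConvDer_covDer (Y : L) : IsConvDer (covDer e nab Y : (Env K R L₀ →ₗ[R] Jets K R L) →+ _) := by
  refine isConvDer_of_contr (fun Z => -contr (K := K) (R := R) (L := L) (e.symm (nab.toFun (e Z) Y)))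
    (fun Z => (isConvDer_contr _).neg) (fun Z Φ => ?_) (fun Φ Ψ => ?_)
  · ext1 P
    simp only [contr_apply, covDer_apply, LinearMap.add_apply, AddMonoidHom.neg_apply,
      LinearMap.neg_apply, symConn_mul, symConn_ofL, map_add]
    abel
  · simp only [covDer_apply, symConn_one, map_zero, sub_zero, conv_one, Jets.ofL_smul_mul]

/-- The map `P ⊗ X ↦ (∇_X Y) P`. -/
noncomputable def torsionMul (Y : L₀) : Env K R L₀ ⊗[R] L₀ →ₗ[R] Env K R L₀ :=
  TensorProduct.lift
    { toFun := fun P =>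
        { toFun := fun X => Env.ofL K R L₀ (e.symm (nab.toFun (e Y) (e X))) * P
          map_add' := fun X X' => by simp [add_mul]
          map_smul' := fun f X => by
            simp [← Env.ofR_mul_ofL, Env.smul_def, mul_assoc] }
      map_add' := fun P Q => by ext X; simp [mul_add]
      map_smul' := fun f P => by
        ext X
        exact (mulOfL _).map_smul f P }

theorem torsionMul_tmul (Y X : L₀) (P : Env K R L₀) : torsionMul e nab Y (P ⊗ₜ[R] X) =
    Env.ofL K R L₀ (e.symm (nab.toFun (e Y) (e X))) * P := rfl

/-- The contraction with the derivation `X ↦ ∇_X Y` of `Sym(L)`. -/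
noncomputable def contrDer (Y : L₀) :
    (Env K R L₀ →ₗ[R] Jets K R L) →+ (Env K R L₀ →ₗ[R] Jets K R L) :=
  AddMonoidHom.mk' (fun Φ => Φ ∘ₗ torsionMul e nab Y ∘ₗ polarization K R L₀) fun _ _ => rfl

theorem contrDer_apply (Y : L₀) (Φ : Env K R L₀ →ₗ[R] Jets K R L) (P : Env K R L₀) :
    contrDer e nab Y Φ P = Φ (torsionMul e nab Y (polarization K R L₀ P)) := rfl

theorem polarization_one : polarization K R L₀ 1 = 0 := by
  have := polarization_prod (K := K) (R := R) ([] : List L₀)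
  simpa using this

theorem torsionMul_rTensor (Y Z : L₀) (t : Env K R L₀ ⊗[R] L₀) :
    torsionMul e nab Y (LinearMap.rTensor L₀ (mulOfL Z) t) =
      Env.ofL K R L₀ Z * torsionMul e nab Y t := by
  induction t with
  | zero => simp
  | add x y hx hy => simp only [map_add, hx, hy, mul_add]
  | tmul P X =>
    rw [LinearMap.rTensor_tmul, torsionMul_tmul, torsionMul_tmul]
    change _ * (Env.ofL K R L₀ Z * P) = _
    rw [← mul_assoc, Env.ofL_comm_ofL, mul_assoc]

/-- The commutator with contraction by `Z` is contraction by `∇_Z Y`, and everything vanishes at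
`1`. -/
theorem isConvDer_contrDer (Y : L₀) :
    IsConvDer (contrDer e nab Y : (Env K R L₀ →ₗ[R] Jets K R L) →+ _) := by
  refine isConvDer_of_contr (fun Z => contr (e.symm (nab.toFun (e Y) (e Z))))
    (fun Z => isConvDer_contr _) (fun Z Φ => ?_) (fun Φ Ψ => ?_)
  · ext1 P
    simp only [contr_apply, contrDer_apply, LinearMap.add_apply, polarization_ofL_mul, map_add,
      torsionMul_rTensor, torsionMul_tmul]
  · simp only [contrDer_apply, polarization_one, map_zero, mul_zero, zero_mul, add_zero]

/-- `symmetrized` as an additive map. -/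
noncomputable def symDer : (Env K R L₀ →ₗ[R] Jets K R L) →+ (Env K R L₀ →ₗ[R] Jets K R L) :=
  AddMonoidHom.mk' (symmetrized e nab) fun Φ Ψ => linearMap_ext_lprod fun l => by
    rw [LinearMap.add_apply, lprod, symmetrized_prod, symmetrized_prod, symmetrized_prod,
      ← Finset.sum_add_distrib]
    refine Finset.sum_congr rfl fun i _ => ?_
    simp only [LinearMap.add_apply, smul_add]
    abel

theorem symDer_apply (Φ : Env K R L₀ →ₗ[R] Jets K R L) : symDer e nab Φ = symmetrized e nab Φ := rfl

theorem symmetrized_one (Φ : Env K R L₀ →ₗ[R] Jets K R L) : symmetrized e nab Φ 1 = 0 := by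
  have := symmetrized_prod e nab Φ []
  simpa using this

/-- By the Leibniz rule `∇_X (Y P) = Y ∇_X P + (∇_X Y) P`; the second summand is the correction
term. -/
theorem gradient_rTensor (Φ : Env K R L₀ →ₗ[R] Jets K R L) (Y : L₀) (t : Env K R L₀ ⊗[R] L₀) :
    gradient e nab Φ (LinearMap.rTensor L₀ (mulOfL Y) t) =
      gradient e nab (contr Y Φ) t - Φ (torsionMul e nab Y t) := by
  induction t with
  | zero => simp
  | add x y hx hy => simp only [map_add, hx, hy]; abel
  | tmul P X =>
    rw [LinearMap.rTensor_tmul, gradient_tmul, gradient_tmul, torsionMul_tmul, contr_apply,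
      contr_apply]
    change _ - Φ (symConn e nab (e X) (Env.ofL K R L₀ Y * P)) = _
    rw [symConn_mul, symConn_ofL, map_add, sub_sub]
    rfl

/-- Contracting `D Φ` with `Y` gives `D` of the contraction, plus `∇_Y Φ`, minus the contraction of
`Φ` with `X ↦ ∇_X Y`. The last two operators are already known to be derivations. -/
theorem isConvDer_symDer : IsConvDer (symDer e nab : (Env K R L₀ →ₗ[R] Jets K R L) →+ _) := by
  refine isConvDer_of_contr (fun Y => covDer e nab (e Y) + -contrDer e nab Y)
    (fun Y => (isConvDer_covDer e nab _).add (isConvDer_contrDer e nab _).neg)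
    (fun Y Φ => ?_) (fun Φ Ψ => ?_)
  · ext1 P
    rw [contr_apply]
    change gradient e nab Φ (polarization K R L₀ (Env.ofL K R L₀ Y * P)) =
      gradient e nab (contr Y Φ) (polarization K R L₀ P) + (covDer e nab (e Y) Φ P +
        -contrDer e nab Y Φ P)
    rw [polarization_ofL_mul, map_add, gradient_rTensor, gradient_tmul, covDer_apply,
      contrDer_apply]
    abel
  · simp only [symDer_apply, symmetrized_one, zero_mul, mul_zero, add_zero]

theorem iterate_conv (n : ℕ) (Φ Ψ : Env K R L₀ →ₗ[R] Jets K R L) :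
    (symDer e nab)^[n] (conv Φ Ψ) = ∑ p ∈ Finset.HasAntidiagonal.antidiagonal n,
      n.choose p.1 • conv ((symDer e nab)^[p.1] Φ) ((symDer e nab)^[p.2] Ψ) := by
  induction n with
  | zero => simp
  | succ n ih =>
    rw [Function.iterate_succ_apply', ih, map_sum, Finset.sum_antidiagonal_choose_succ_nsmul
      (fun a b => conv ((symDer e nab)^[a] Φ) ((symDer e nab)^[b] Ψ)), ← Finset.sum_add_distrib]
    refine Finset.sum_congr rfl fun p hp => ?_
    rw [map_nsmul, isConvDer_symDer e nab, smul_add, Function.iterate_succ_apply',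
      Function.iterate_succ_apply', add_comm,
      Nat.choose_symm_of_eq_add (Finset.HasAntidiagonal.mem_antidiagonal.1 hp).symm]

theorem tensorOne_one (φ : Jets K R L) :
    (tensorOne φ : Env K R L₀ →ₗ[R] Jets K R L) 1 = φ := by
  change Coalgebra.counit (R := R) (1 : Env K R L₀) • φ = φ
  rw [counit_eq, one_smul, one_smul]

theorem contr_tensorOne (φ : Jets K R L) (Y : L₀) :
    contr Y (tensorOne φ : Env K R L₀ →ₗ[R] Jets K R L) = 0 := by
  ext1 P
  change Coalgebra.counit (R := R) (Env.ofL K R L₀ Y * P) • φ = 0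
  rw [counit_eq, mul_smul, base_smul_def, baseAct_ofL, IsAbelian.anchor_eq_zero, zero_smul]

/-- All contractions of both sides are zero, so only the values at `1` need comparison. -/
theorem tensorOne_mul (φ ψ : Jets K R L) :
    (tensorOne (φ * ψ) : Env K R L₀ →ₗ[R] Jets K R L) = conv (tensorOne φ) (tensorOne ψ) := by
  refine linearMap_ext_lprod fun l => ?_
  cases l with
  | nil => rw [lprod_nil, conv_one, tensorOne_one, tensorOne_one, tensorOne_one]
  | cons Y l =>
    rw [lprod_cons, ← contr_apply, ← contr_apply, contr_conv]
    simp only [contr_tensorOne, zero_conv, conv_zero, add_zero]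

theorem tensorOne_add (φ ψ : Jets K R L) :
    (tensorOne (φ + ψ) : Env K R L₀ →ₗ[R] Jets K R L) = tensorOne φ + tensorOne ψ := by
  ext1 P; exact smul_add (Coalgebra.counit (R := R) P) φ ψ

end Symmetrized

end LieRinehart

namespace LieRinehart

/-! ### Degrees in `Sym(L)` and leading terms of the iterates of `D` -/

section Homogeneous

variable {K R L L₀ : Type*} [CommRing K] [CommRing R] [Algebra K R]
  [LieRing L] [LieAlgebra K L] [Module R L] [LieRingModule L R]
  [LieRinehartRing R L] [LieRinehartAlgebra K R L]
  [LieRing L₀] [LieAlgebra K L₀] [Module R L₀] [LieRingModule L₀ R]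
  [LieRinehartRing R L₀] [LieRinehartAlgebra K R L₀] [IsAbelian R L₀]
  (e : L₀ ≃ₗ[R] L) (nab : Connection K R L L)

variable (K R L₀) in
/-- The component of degree `n` of `Sym(L)`. -/
noncomputable def symPart (n : ℕ) : Submodule R (Env K R L₀) :=
  Submodule.span R (lprod K R '' {l : List L₀ | l.length = n})

theorem lprod_mem_symPart {l : List L₀} {n : ℕ} (h : l.length = n) :
    lprod K R l ∈ symPart K R L₀ n := Submodule.subset_span ⟨l, h, rfl⟩

theorem ofL_mul_mem_symPart (Y : L₀) {n : ℕ} {P : Env K R L₀} (h : P ∈ symPart K R L₀ n) :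
    Env.ofL K R L₀ Y * P ∈ symPart K R L₀ (n + 1) := by
  induction h using Submodule.span_induction with
  | mem P hP =>
    obtain ⟨l, hl, rfl⟩ := hP
    rw [← lprod_cons]
    exact lprod_mem_symPart (by simpa using hl)
  | zero => rw [mul_zero]; exact zero_mem _
  | add P Q _ _ hP hQ => rw [mul_add]; exact add_mem hP hQ
  | smul f P _ hP =>
    have := (mulOfL Y).map_smul f P
    change Env.ofL K R L₀ Y * (f • P) = f • (Env.ofL K R L₀ Y * P) at this
    rw [this]
    exact Submodule.smul_mem _ f hP

theorem symConn_lprod_mem (X : L) (l : List L₀) :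
    symConn e nab X (lprod K R l) ∈ symPart K R L₀ l.length := by
  induction l with
  | nil => rw [lprod_nil, symConn_one]; exact zero_mem _
  | cons Y l ih =>
    rw [lprod_cons, symConn_mul, symConn_ofL]
    exact add_mem (ofL_mul_mem_symPart Y ih) (ofL_mul_mem_symPart _ (lprod_mem_symPart rfl))

theorem symDer_lprod (Φ : Env K R L₀ →ₗ[R] Jets K R L) (l : List L₀) :
    symDer e nab Φ (lprod K R l) = ∑ i : Fin l.length,
      (Env.ofL K R L (e l[i]) • Φ (lprod K R (l.eraseIdx i)) -
        Φ (symConn e nab (e l[i]) (lprod K R (l.eraseIdx i)))) :=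
  symmetrized_prod e nab Φ l

theorem length_eraseIdx_fin {α : Type*} (l : List α) (i : Fin l.length) :
    (l.eraseIdx i).length + 1 = l.length := by
  have := i.2
  rw [List.length_eraseIdx, if_pos i.2]
  omega

/-- The map `φ ⊗ 1` lives in degree `0`, and `D` raises the degree by exactly one because `∇`
preserves degrees in `Sym(L)`. -/
theorem iterate_symDer_eq_zero (φ : Jets K R L) {n m : ℕ} (h : m ≠ n) {P : Env K R L₀}
    (hP : P ∈ symPart K R L₀ m) : (symDer e nab)^[n] (tensorOne φ) P = 0 := by
  induction n generalizing m P with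
  | zero =>
    induction hP using Submodule.span_induction with
    | mem P hP =>
      obtain ⟨l, hl, rfl⟩ := hP
      cases l with
      | nil => exact absurd hl.symm h
      | cons Y l => rw [lprod_cons, ← contr_apply, Function.iterate_zero, id, contr_tensorOne]; rfl
    | zero => exact map_zero _
    | add P Q _ _ hP hQ => rw [map_add, hP, hQ, add_zero]
    | smul f P _ hP => rw [map_smul, hP, smul_zero]
  | succ n ih =>
    induction hP using Submodule.span_induction with
    | mem P hP =>
      obtain ⟨l, hl, rfl⟩ := hP
      have hl : l.length = m := hl
      rw [Function.iterate_succ_apply', symDer_lprod]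
      refine Finset.sum_eq_zero fun i _ => ?_
      have hi := length_eraseIdx_fin l i
      rw [ih (by omega) (symConn_lprod_mem e nab _ _), ih (by omega) (lprod_mem_symPart rfl),
        smul_zero, sub_zero]
    | zero => exact map_zero _
    | add P Q _ _ hP hQ => rw [map_add, hP, hQ, add_zero]
    | smul f P _ hP => rw [map_smul, hP, smul_zero]

/-- Needed because `∇_X` of a product is only a combination of products of the same degree. -/
theorem exists_smul_of_mem_symPart {Φ : Env K R L₀ →ₗ[R] Jets K R L} {φ : Jets K R L} {n : ℕ}
    (h : ∀ l : List L₀, l.length = n → ∃ D ∈ filt K R L (n + 1), Φ (lprod K R l) = D • φ)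
    {P : Env K R L₀} (hP : P ∈ symPart K R L₀ n) :
    ∃ D ∈ filt K R L (n + 1), Φ P = D • φ := by
  induction hP using Submodule.span_induction with
  | mem P hP => obtain ⟨l, hl, rfl⟩ := hP; exact h l hl
  | zero => exact ⟨0, zero_mem _, by rw [map_zero, zero_smul]⟩
  | add P Q _ _ hP hQ =>
    obtain ⟨D, hD, hD'⟩ := hP
    obtain ⟨E, hE, hE'⟩ := hQ
    exact ⟨D + E, add_mem hD hE, by rw [map_add, hD', hE', add_smul]⟩
  | smul f P _ hP =>
    obtain ⟨D, hD, hD'⟩ := hP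
    exact ⟨f • D, Submodule.smul_mem _ f hD, by rw [map_smul, hD', smul_assoc]⟩

/-- From `n` to `n + 1`, each of the `n + 1` choices of the differentiating factor contributes `n!`
times the product of all factors. Reordering them and the connection terms affect lower orders only.
-/
theorem exists_iterate_symDer_eq (φ : Jets K R L) (n : ℕ) (l : List L₀) (hl : l.length = n) :
    ∃ D ∈ filt K R L n, (symDer e nab)^[n] (tensorOne φ) (lprod K R l) =
      ((n.factorial : Env K R L) * lprod K R (l.map e) + D) • φ := by
  induction n generalizing l with
  | zero =>
    rw [List.length_eq_zero_iff] at hl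
    subst hl
    exact ⟨0, zero_mem _, by simp [tensorOne_one]⟩
  | succ n ih =>
    have key : ∀ i : Fin l.length, ∃ D ∈ filt K R L (n + 1),
        (Env.ofL K R L (e l[i]) • (symDer e nab)^[n] (tensorOne φ) (lprod K R (l.eraseIdx i)) -
          (symDer e nab)^[n] (tensorOne φ) (symConn e nab (e l[i]) (lprod K R (l.eraseIdx i)))) =
        ((n.factorial : Env K R L) * lprod K R (l.map e) + D) • φ := fun i => by
      have hi := length_eraseIdx_fin l i
      obtain ⟨D, hD, hD'⟩ := ih (l.eraseIdx i) (by omega)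
      -- The connection term is evaluated in degree `n`, so it is given by an operator of order at
      -- most `n` and goes into the remainder.
      obtain ⟨E, hE, hE'⟩ := exists_smul_of_mem_symPart (Φ := (symDer e nab)^[n] (tensorOne φ))
        (φ := φ) (n := n) (fun l' hl' => by
          obtain ⟨D, hD, hD'⟩ := ih l' hl'
          refine ⟨_, add_mem ?_ (filt_mono (Nat.le_succ n) hD), hD'⟩
          rw [← nsmul_eq_mul]
          exact Submodule.smul_of_tower_mem _ _ (lprod_mem_filt (by simp [hl'])))
        (P := symConn e nab (e l[i]) (lprod K R (l.eraseIdx i)))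
        (by have := symConn_lprod_mem e nab (e l[i]) (l.eraseIdx i)
            rwa [show (l.eraseIdx i).length = n by omega] at this)
      have hperm : (l.map e).Perm ((l[i] :: l.eraseIdx i).map e) :=
        ((List.getElem_cons_eraseIdx_perm i.2).symm).map e
      have hp := lprod_sub_mem_of_perm (K := K) (R := R) hperm.symm
      rw [List.map_cons, lprod_cons] at hp
      refine ⟨(n.factorial : Env K R L) * (Env.ofL K R L (e l[i]) *
        lprod K R ((l.eraseIdx i).map e) - lprod K R (l.map e)) +
          Env.ofL K R L (e l[i]) * D - E, sub_mem (add_mem ?_ (ofL_mul_mem_filt _ hD)) hE, ?_⟩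
      · rw [← nsmul_eq_mul]
        refine Submodule.smul_of_tower_mem _ _ ?_
        have : (e l[i] :: (l.eraseIdx i).map e).length = n + 1 := by
          rw [List.length_cons, List.length_map]; omega
        rwa [this] at hp
      · rw [hD', hE', smul_smul, ← sub_smul]
        congr 1
        rw [mul_add, ← mul_assoc, ← (Nat.cast_commute n.factorial _).eq, mul_assoc, mul_sub]
        abel
    choose D hD hD' using key
    refine ⟨∑ i, D i, sum_mem fun i _ => hD i, ?_⟩
    rw [Function.iterate_succ_apply', symDer_lprod, Finset.sum_congr rfl fun i _ => hD' i,
      ← Finset.sum_smul, Finset.sum_add_distrib, Finset.sum_const, Finset.card_univ,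
      Fintype.card_fin, nsmul_eq_mul, Nat.factorial_succ, Nat.cast_mul, mul_assoc,
      ← congrArg (Nat.cast (R := Env K R L)) hl]

end Homogeneous

/-! ### The formal exponential of `D` -/

section Exp

variable {K R L L₀ : Type*} [Field K] [CharZero K] [CommRing R] [Algebra K R]
  [LieRing L] [LieAlgebra K L] [Module R L] [LieRingModule L R]
  [LieRinehartRing R L] [LieRinehartAlgebra K R L]
  [LieRing L₀] [LieAlgebra K L₀] [Module R L₀] [LieRingModule L₀ R]
  [LieRinehartRing R L₀] [LieRinehartAlgebra K R L₀] [IsAbelian R L₀]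
  (e : L₀ ≃ₗ[R] L) (nab : Connection K R L L)

/-- Evaluation of jets at `1`, as a linear map for the second module structure. -/
noncomputable def evalOne : Jets K R L →ₗ[R] R where
  toFun φ := Jets.eval φ 1
  map_add' φ ψ := rfl
  map_smul' f φ := by
    rw [Jets.eval_smulR, one_mul, RingHom.id_apply]
    have := (Jets.eval φ).map_smul f 1
    rwa [Env.smul_def, mul_one] at this

/-- The term `(1 / n!) (Dⁿ (φ ⊗ 1))(1)`. -/
noncomputable def expTerm (n : ℕ) (φ : Jets K R L) : Jets K R L₀ :=
  Jets.of (((n.factorial : K)⁻¹) • (evalOne ∘ₗ (symDer e nab)^[n] (tensorOne φ)))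

theorem eval_expTerm (n : ℕ) (φ : Jets K R L) (P : Env K R L₀) :
    Jets.eval (expTerm e nab n φ) P =
      ((n.factorial : K)⁻¹) • Jets.eval ((symDer e nab)^[n] (tensorOne φ) P) 1 := rfl

theorem eval_expTerm_eq_zero (φ : Jets K R L) {n : ℕ} {l : List L₀} (h : l.length ≠ n) :
    Jets.eval (expTerm e nab n φ) (lprod K R l) = 0 := by
  rw [eval_expTerm, iterate_symDer_eq_zero e nab φ h (lprod_mem_symPart rfl), Jets.eval_zero,
    smul_zero]

/-- An element of `Sym(L)` has components in finitely many degrees. This makes the `finsum` defining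
the series an actual sum rather than the default value zero. -/
theorem finite_expTerm (φ : Jets K R L) (P : Env K R L₀) :
    (Function.support fun n => Jets.eval (expTerm e nab n φ) P).Finite := by
  induction P using Env.induction_lprod with
  | hadd P Q hP hQ =>
    refine (hP.union hQ).subset fun n hn => ?_
    by_contra h
    simp only [Set.mem_union, Function.mem_support, not_or, not_not] at h
    exact hn (by simp only [map_add, h.1, h.2, add_zero])
  | hs f l =>
    refine (Set.finite_singleton l.length).subset fun n hn => ?_
    by_contra h
    exact hn (by
      simp only [map_smul]
      rw [eval_expTerm_eq_zero e nab φ (fun h' => h h'.symm), smul_zero])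

/-- The formal series `∑ₙ (1 / n!) (Dⁿ (φ ⊗ 1))(1)`. -/
noncomputable def expJet (φ : Jets K R L) : Jets K R L₀ :=
  Jets.of
    { toFun := fun P => ∑ᶠ n, Jets.eval (expTerm e nab n φ) P
      map_add' := fun P Q => by
        simp only [map_add]
        exact finsum_add_distrib (finite_expTerm e nab φ P) (finite_expTerm e nab φ Q)
      map_smul' := fun f P => by
        simp only [map_smul, RingHom.id_apply]
        exact (smul_finsum' f (finite_expTerm e nab φ P)).symm }

theorem eval_expJet (φ : Jets K R L) (l : List L₀) :
    Jets.eval (expJet e nab φ) (lprod K R l) =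
      Jets.eval (expTerm e nab l.length φ) (lprod K R l) :=
  finsum_eq_single _ _ fun n hn => eval_expTerm_eq_zero e nab φ hn.symm

theorem eval_expJet_eq_pbwValue (φ : Jets K R L) (l : List L₀) :
    Jets.eval (expJet e nab φ) (lprod K R l) = pbwValue e nab φ l := by
  rw [eval_expJet, eval_expTerm]; rfl

theorem jets_ext_lprod {φ ψ : Jets K R L}
    (h : ∀ l : List L, Jets.eval φ (lprod K R l) = Jets.eval ψ (lprod K R l)) : φ = ψ :=
  Jets.ext fun D => by
    induction D using Env.induction_lprod with
    | hadd a b ha hb => rw [map_add, map_add, ha, hb]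
    | hs f l => rw [map_smul, map_smul, h]

/-- Evaluation at `1` is multiplicative on jets, so it turns convolution of jet-valued maps into the
product of `Ŝym(L^∨)`. -/
theorem evalOne_conv (Φ Ψ : Env K R L₀ →ₗ[R] Jets K R L) :
    Jets.of (evalOne ∘ₗ conv Φ Ψ) = (Jets.of (evalOne ∘ₗ Φ) * Jets.of (evalOne ∘ₗ Ψ) : Jets K R L₀) := by
  ext P
  rw [Jets.eval_mul, Jets.eval_of, LinearMap.comp_apply, conv_apply]
  change _ = LinearMap.mul' R R (TensorProduct.map _ _ (comulEnv P))
  generalize comulEnv P = t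
  induction t with
  | zero => simp
  | add x y hx hy => simp only [map_add, hx, hy]
  | tmul a b =>
    simp only [TensorProduct.map_tmul, LinearMap.mul'_apply, Jets.eval_of, LinearMap.comp_apply]
    exact Jets.eval_mul_one _ _

/-- Dividing the iterated Leibniz rule by `n!` absorbs the binomial coefficients and leaves a Cauchy
product. -/
theorem expTerm_mul (n : ℕ) (φ ψ : Jets K R L) : expTerm e nab n (φ * ψ) =
    ∑ p ∈ Finset.HasAntidiagonal.antidiagonal n, expTerm e nab p.1 φ * expTerm e nab p.2 ψ := by
  have h : ∀ (n : ℕ) (χ : Jets K R L), expTerm e nab n χ =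
      ((n.factorial : K)⁻¹) • Jets.of (evalOne ∘ₗ (symDer e nab)^[n] (tensorOne χ)) :=
    fun _ _ => rfl
  have h' : Jets.of (evalOne ∘ₗ (symDer e nab)^[n] (tensorOne (φ * ψ))) =
      ∑ p ∈ Finset.HasAntidiagonal.antidiagonal n, (n.choose p.1 : K) •
        (Jets.of (evalOne ∘ₗ (symDer e nab)^[p.1] (tensorOne φ)) *
          Jets.of (evalOne ∘ₗ (symDer e nab)^[p.2] (tensorOne ψ)) : Jets K R L₀) := by
    rw [tensorOne_mul, iterate_conv]
    ext P
    rw [Jets.eval_sum, Jets.eval_of, LinearMap.comp_apply, LinearMap.sum_apply, map_sum]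
    refine Finset.sum_congr rfl fun p _ => ?_
    rw [← evalOne_conv, Nat.cast_smul_eq_nsmul, LinearMap.smul_apply, map_nsmul, ← Nat.cast_smul_eq_nsmul K]
    rw [← Nat.cast_smul_eq_nsmul K]
    rfl
  rw [h, h', Finset.smul_sum]
  refine Finset.sum_congr rfl fun p hp => ?_
  rw [h, h, smul_mul_smul_comm, smul_smul]
  congr 1
  have hp := Finset.HasAntidiagonal.mem_antidiagonal.1 hp
  have h1 := Nat.add_choose_mul_factorial_mul_factorial p.1 p.2
  rw [hp, ← Nat.choose_symm_of_eq_add hp.symm] at h1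
  have h2 : (n.choose p.1 : K) * p.1.factorial * p.2.factorial = n.factorial := by
    exact_mod_cast h1
  have a1 : (p.1.factorial : K) ≠ 0 := Nat.cast_ne_zero.2 (Nat.factorial_ne_zero _)
  have a2 : (p.2.factorial : K) ≠ 0 := Nat.cast_ne_zero.2 (Nat.factorial_ne_zero _)
  have a3 : (n.factorial : K) ≠ 0 := Nat.cast_ne_zero.2 (Nat.factorial_ne_zero _)
  field_simp
  linear_combination h2

theorem vanish_expTerm (n : ℕ) (φ : Jets K R L) : Jets.Vanish n (expTerm e nab n φ) :=
  fun l hl => eval_expTerm_eq_zero e nab φ hl.ne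

theorem vanish_expJet_sub (N : ℕ) (φ : Jets K R L) :
    Jets.Vanish N (expJet e nab φ - ∑ n ∈ Finset.range N, expTerm e nab n φ) := fun l hl => by
  rw [Jets.eval_sub, Jets.eval_sum, Finset.sum_eq_single l.length, eval_expJet, sub_self]
  · exact fun n _ hn => eval_expTerm_eq_zero e nab φ hn.symm
  · exact fun h => absurd (Finset.mem_range.2 hl) h

theorem expJet_mul (φ ψ : Jets K R L) :
    expJet e nab (φ * ψ) = expJet e nab φ * expJet e nab ψ := by
  refine sub_eq_zero.1 (Jets.eq_zero_of_vanish fun N => ?_)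
  -- Modulo order `N` the series is a finite sum of `N` terms. In the product of two such sums the
  -- terms with `p.1 + p.2 ≥ N` vanish to order `N`, and the others regroup by total degree.
  let q := Ideal.Quotient.mk (Jets.vanishing K R L₀ N)
  have hq : ∀ χ, q χ = 0 ↔ Jets.Vanish N χ := fun χ => Ideal.Quotient.eq_zero_iff_mem
  have hj : ∀ χ, q (expJet e nab χ) = ∑ n ∈ Finset.range N, q (expTerm e nab n χ) := fun χ => by
    rw [← map_sum, ← sub_eq_zero, ← map_sub, hq]
    exact vanish_expJet_sub e nab N χ
  rw [← hq, map_sub, map_mul, hj, hj, hj, sub_eq_zero, Finset.sum_mul_sum, ← Finset.sum_product',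
    ← Finset.sum_filter_add_sum_filter_not _ (fun p : ℕ × ℕ => p.1 + p.2 < N),
    Finset.sum_eq_zero (s := Finset.filter (fun p : ℕ × ℕ => ¬ p.1 + p.2 < N) _) (fun p hp => ?_), add_zero]
  · rw [← Finset.sum_fiberwise_of_maps_to (t := Finset.range N) (g := fun p : ℕ × ℕ => p.1 + p.2)]
    · refine Finset.sum_congr rfl fun n hn => ?_
      rw [expTerm_mul, map_sum]
      refine Finset.sum_congr ?_ fun p _ => map_mul q _ _
      ext p
      simp only [Finset.HasAntidiagonal.mem_antidiagonal, Finset.mem_filter, Finset.mem_product, Finset.mem_range] at hn ⊢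
      omega
    · intro p hp
      exact Finset.mem_range.2 (Finset.mem_filter.1 hp).2
  · rw [← map_mul, hq]
    exact ((vanish_expTerm e nab _ φ).mul (vanish_expTerm e nab _ ψ)).mono
      (not_lt.1 (Finset.mem_filter.1 hp).2)

theorem iterate_symDer_add (n : ℕ) (Φ Ψ : Env K R L₀ →ₗ[R] Jets K R L) :
    (symDer e nab)^[n] (Φ + Ψ) = (symDer e nab)^[n] Φ + (symDer e nab)^[n] Ψ := by
  induction n with
  | zero => rfl
  | succ n ih => simp only [Function.iterate_succ_apply', ih, map_add]

theorem expJet_add (φ ψ : Jets K R L) :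
    expJet e nab (φ + ψ) = expJet e nab φ + expJet e nab ψ := by
  refine jets_ext_lprod fun l => ?_
  rw [Jets.eval_add, eval_expJet, eval_expJet, eval_expJet, eval_expTerm, eval_expTerm,
    eval_expTerm, tensorOne_add, iterate_symDer_add, LinearMap.add_apply, Jets.eval_add, smul_add]

theorem ofL_smul_alpha₁ (X : L) (f : R) : Env.ofL K R L X • Jets.α₁ K R L f = 0 := by
  have := Jets.smul_alpha₁_mul (Env.ofL K R L X) f (1 : Jets K R L)
  rwa [mul_one, Smash.ofL_smul_one, mul_zero] at this

/-- The section `α₁(f) ⊗ 1` is flat: `U(L, R)` acts on jets linearly over `α₁` and `L` kills `1`. -/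
theorem symDer_tensorOne_alpha₁ (f : R) :
    symDer e nab (tensorOne (Jets.α₁ K R L f) : Env K R L₀ →ₗ[R] Jets K R L) = 0 := by
  refine linearMap_ext_lprod fun l => ?_
  rw [symDer_lprod, LinearMap.zero_apply]
  refine Finset.sum_eq_zero fun i _ => ?_
  -- Both sides satisfy the same Leibniz rule over `R`, so they need only be compared on products;
  -- there both are zero.
  have h1 : ∀ P : Env K R L₀, (tensorOne (Jets.α₁ K R L f) : Env K R L₀ →ₗ[R] Jets K R L)
    (symConn e nab (e l[i]) P) = Env.ofL K R L (e l[i]) • (tensorOne (Jets.α₁ K R L f) :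
      Env K R L₀ →ₗ[R] Jets K R L) P := fun P => by
    induction P using Env.induction_lprod with
    | hadd a b ha hb => simp only [map_add, ha, hb, smul_add]
    | hs g l' =>
      rw [symConn_smul, map_add, map_smul, map_smul, map_smul, Env.ofL_smul_smul]
      congr 2
      cases l' with
      | nil =>
        rw [lprod_nil, symConn_one, map_zero, tensorOne_one, ofL_smul_alpha₁]
      | cons Y l' =>
        rw [lprod_cons, symConn_mul, symConn_ofL, map_add, ← contr_apply, ← contr_apply,
          ← contr_apply, contr_tensorOne, contr_tensorOne]
        simp
  rw [h1, sub_self]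

theorem expJet_alpha₁ (f : R) : expJet e nab (Jets.α₁ K R L f) = Jets.α₁ K R L₀ f := by
  refine jets_ext_lprod fun l => ?_
  rw [eval_expJet, eval_expTerm, Jets.α₁_apply]
  cases l with
  | nil => simp [tensorOne_one, Jets.α₁_apply]
  | cons Y l =>
    have h : ∀ n, (symDer e nab)^[n] (0 : Env K R L₀ →ₗ[R] Jets K R L) = 0 := fun n => by
      induction n with
      | zero => rfl
      | succ n ih => rw [Function.iterate_succ_apply', ih, map_zero]
    rw [List.length_cons, Function.iterate_succ_apply, symDer_tensorOne_alpha₁, h, lprod_cons,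
      mul_smul, base_smul_def, baseAct_ofL, IsAbelian.anchor_eq_zero]
    simp

/-- The map `φ ↦ ∑ₙ (1 / n!) (Dⁿ (φ ⊗ 1))(1)`, as an algebra homomorphism. -/
noncomputable def expHom : Jets K R L →ₐ[K] Jets K R L₀ where
  toFun := expJet e nab
  map_one' := by rw [← map_one (Jets.α₁ K R L), expJet_alpha₁, map_one]
  map_mul' := expJet_mul e nab
  map_zero' := by rw [← map_zero (Jets.α₁ K R L), expJet_alpha₁, map_zero]
  map_add' := expJet_add e nab
  commutes' c := by rw [← (Jets.α₁ K R L).commutes, expJet_alpha₁, AlgHom.commutes]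

theorem expHom_apply (φ : Jets K R L) : expHom e nab φ = expJet e nab φ := rfl

/-- The remainder in `exists_iterate_symDer_eq` has order too low to detect `φ`, and `1 / n!`
cancels the factorial. So the exponential is the identity on leading terms. -/
theorem eval_expJet_of_vanish {n : ℕ} {φ : Jets K R L} (h : Jets.Vanish n φ) {l : List L₀}
    (hl : l.length ≤ n) :
    Jets.eval (expJet e nab φ) (lprod K R l) = Jets.eval φ (lprod K R (l.map e)) := by
  obtain ⟨D, hD, hD'⟩ := exists_iterate_symDer_eq e nab φ l.length l rfl
  rw [eval_expJet, eval_expTerm, hD', Jets.eval_smul, one_mul, map_add,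
    h.eval_eq_zero (filt_mono hl hD), add_zero, ← nsmul_eq_mul, map_nsmul,
    ← Nat.cast_smul_eq_nsmul K, smul_smul, inv_mul_cancel₀, one_smul]
  exact Nat.cast_ne_zero.2 (Nat.factorial_ne_zero _)

theorem vanish_expJet {n : ℕ} {φ : Jets K R L} (h : Jets.Vanish n φ) :
    Jets.Vanish n (expJet e nab φ) := fun l hl => by
  rw [eval_expJet_of_vanish e nab h hl.le]
  exact h _ (by simpa using hl)

/-- A nonzero leading term survives. This requires no freeness of `L`, which matters later for
gluing over arbitrary open sets. -/
theorem expHom_injective : Function.Injective (expHom (K := K) e nab) := by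
  rw [injective_iff_map_eq_zero]
  intro φ hφ
  refine Jets.eq_zero_of_vanish fun n => ?_
  induction n with
  | zero => exact Jets.vanish_zero φ
  | succ n ih =>
    intro l hl
    have := eval_expJet_of_vanish e nab ih (l := l.map e.symm) (by simpa using Nat.lt_succ_iff.1 hl)
    have hcomp : ⇑e ∘ ⇑e.symm = id := funext e.apply_symm_apply
    rw [← expHom_apply, hφ, Jets.eval_zero, List.map_map, hcomp, List.map_id] at this
    exact this.symm

theorem expHom_surjective {r : ℕ} {b : Module.Basis (Fin r) R L} {ξ : Fin r → Jets K R L}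
    (hξ : IsDual b ξ) : Function.Surjective (expHom (K := K) e nab) := by
  refine surjective_of_filtered (fun n => (Jets.vanishing K R L n).toAddSubgroup)
    (fun n => (Jets.vanishing K R L₀ n).toAddSubgroup) (expHom e nab : Jets K R L →+ Jets K R L₀)
    (fun a ha => hξ.exists_limit a ha) (fun ψ hψ => Jets.eq_zero_of_vanish hψ)
    (fun ψ => Jets.vanish_zero ψ) (fun n φ hφ => vanish_expJet e nab hφ) (fun n ψ hψ => ?_)
  have hmon : ∀ a : Multiset (Fin r), mon K R (b.map e.symm) a =
      lprod K R (((a.sort (· ≤ ·)).map b).map e.symm) := fun a => by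
    rw [mon, List.map_map]; congr 1
  -- A jet of order `n` with the same leading values as `ψ`; it exists because the ordered monomials
  -- are a basis.
  obtain ⟨φ, hφ⟩ := hξ.exists_eval_eq fun a =>
    if a.card < n then 0 else Jets.eval ψ (mon K R (b.map e.symm) a)
  have hv : Jets.Vanish n φ := (Jets.vanish_iff_mon b).2 fun a ha => by rw [hφ, if_pos ha]
  refine ⟨φ, hv, (Jets.vanish_iff_mon (b.map e.symm)).2 fun a ha => ?_⟩
  change Jets.eval (ψ - expJet e nab φ) _ = 0
  rw [Jets.eval_sub, hmon, eval_expJet_of_vanish e nab hv (by simpa using Nat.lt_succ_iff.1 ha),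
    List.map_map (f := ⇑e.symm)]
  have hcomp : ⇑e ∘ ⇑e.symm = id := funext e.apply_symm_apply
  rw [hcomp, List.map_id]
  change _ - Jets.eval φ (mon K R b a) = 0
  rw [hφ]
  split_ifs with h
  · rw [sub_zero]; exact hψ _ (by simpa using h)
  · rw [hmon, sub_self]

end Exp

/-! ### Compatibility of the exponential with restriction -/

section Compatibility

open scoped LieRinehartAlgebra

variable {K R L L₀ R' L' L₀' : Type*} [Field K] [CharZero K] [CommRing R] [Algebra K R]
  [LieRing L] [LieAlgebra K L] [Module R L] [LieRingModule L R]
  [LieRinehartRing R L] [LieRinehartAlgebra K R L]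
  [LieRing L₀] [LieAlgebra K L₀] [Module R L₀] [LieRingModule L₀ R]
  [LieRinehartRing R L₀] [LieRinehartAlgebra K R L₀] [IsAbelian R L₀]
  [CommRing R'] [Algebra K R']
  [LieRing L'] [LieAlgebra K L'] [Module R' L'] [LieRingModule L' R']
  [LieRinehartRing R' L'] [LieRinehartAlgebra K R' L']
  [LieRing L₀'] [LieAlgebra K L₀'] [Module R' L₀'] [LieRingModule L₀' R']
  [LieRinehartRing R' L₀'] [LieRinehartAlgebra K R' L₀'] [IsAbelian R' L₀']
  {σ : R →ₐ[K] R'} {g : L →ₗ⁅σ⁆ L'} {g₀ : L₀ →ₗ⁅σ⁆ L₀'}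
  {e : L₀ ≃ₗ[R] L} {nab : Connection K R L L} {e' : L₀' ≃ₗ[R'] L'} {nab' : Connection K R' L' L'}

theorem Env.map_lprod (l : List L) : Env.map g (lprod K R l) = lprod K R' (l.map g) := by
  induction l with
  | nil => simp
  | cons X l ih => simp [ih]

theorem Env.map_symConn (he : ∀ Y, e' (g₀ Y) = g (e Y))
    (hnab : ∀ X Y, g (nab.toFun Y X) = nab'.toFun (g Y) (g X)) (X : L) (P : Env K R L₀) :
    Env.map g₀ (symConn e nab X P) = symConn e' nab' (g X) (Env.map g₀ P) := by
  induction P using Env.induction with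
  | hR r =>
    have := g.apply_lie' r X
    rw [symConn_ofR, Env.map_ofR, Env.map_ofR, symConn_ofR]
    exact congrArg _ this
  | hL Y =>
    rw [symConn_ofL, Env.map_ofL, Env.map_ofL, symConn_ofL]
    congr 1
    apply e'.injective
    rw [he, LinearEquiv.apply_symm_apply, LinearEquiv.apply_symm_apply, hnab, he]
  | hadd a b ha hb => simp only [map_add, ha, hb]
  | hmul a b ha hb => simp only [map_add, map_mul, symConn_mul, ha, hb]

theorem Jets.Compatible.zero : Jets.Compatible g (0 : Jets K R L) (0 : Jets K R' L') :=
  fun D => by simp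

theorem compatible_of_lprod {Φ : Env K R L₀ →ₗ[R] Jets K R L} {Φ' : Env K R' L₀' →ₗ[R'] Jets K R' L'}
    (h : ∀ l, Jets.Compatible g (Φ (lprod K R l)) (Φ' (lprod K R' (l.map g₀)))) (P : Env K R L₀) :
    Jets.Compatible g (Φ P) (Φ' (Env.map g₀ P)) := by
  induction P using Env.induction_lprod with
  | hadd a b ha hb => simp only [map_add]; exact ha.add hb
  | hs f l =>
    rw [Env.map_smul, map_smul, map_smul, Jets.smulR_eq, Jets.smulR_eq, Env.map_lprod]
    have := (h l).smul (Env.ofR K R L f)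
    rwa [Env.map_ofR] at this

theorem compatible_symDer (he : ∀ Y, e' (g₀ Y) = g (e Y))
    (hnab : ∀ X Y, g (nab.toFun Y X) = nab'.toFun (g Y) (g X))
    {Φ : Env K R L₀ →ₗ[R] Jets K R L} {Φ' : Env K R' L₀' →ₗ[R'] Jets K R' L'}
    (h : ∀ P, Jets.Compatible g (Φ P) (Φ' (Env.map g₀ P))) (P : Env K R L₀) :
    Jets.Compatible g (symDer e nab Φ P) (symDer e' nab' Φ' (Env.map g₀ P)) := by
  refine compatible_of_lprod (fun l => ?_) P
  have hsum : ∀ (ι : Type) (s : Finset ι) (a : ι → Jets K R L) (b : ι → Jets K R' L'),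
      (∀ i, Jets.Compatible g (a i) (b i)) → Jets.Compatible g (∑ i ∈ s, a i) (∑ i ∈ s, b i) := by
    intro ι s a b hab D
    rw [Jets.eval_sum, Jets.eval_sum, map_sum]
    exact Finset.sum_congr rfl fun i _ => hab i D
  rw [symDer_lprod, symDer_lprod,
    ← Equiv.sum_comp (finCongr (List.length_map (f := g₀) (as := l)).symm)]
  refine hsum _ _ _ _ fun i => ?_
  have h1 : (l.map g₀)[(finCongr (List.length_map (f := g₀) (as := l)).symm i : ℕ)] = g₀ l[i] := by
    simp
  have h2 : (l.map g₀).eraseIdx (finCongr (List.length_map (f := g₀) (as := l)).symm i : ℕ) =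
      (l.eraseIdx i).map g₀ := by simp [List.eraseIdx_map]
  simp only [Fin.getElem_fin] at h1 ⊢
  rw [h1, h2, he, sub_eq_add_neg, sub_eq_add_neg, ← Env.map_lprod, ← Env.map_symConn he hnab, ← Env.map_ofL (K := K) g]
  exact ((h _).smul _).add (h _).neg

/-- Every ingredient of `D` commutes with a morphism respecting the connections, hence so do its
iterates. This lets the exponentials over the open sets form a map of sheaves. -/
theorem compatible_expJet (he : ∀ Y, e' (g₀ Y) = g (e Y))
    (hnab : ∀ X Y, g (nab.toFun Y X) = nab'.toFun (g Y) (g X))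
    {φ : Jets K R L} {φ' : Jets K R' L'} (h : Jets.Compatible g φ φ') :
    Jets.Compatible g₀ (expJet e nab φ) (expJet e' nab' φ') := by
  have hn : ∀ n (P : Env K R L₀), Jets.Compatible g ((symDer e nab)^[n] (tensorOne φ) P)
      ((symDer e' nab')^[n] (tensorOne φ') (Env.map g₀ P)) := fun n => by
    induction n with
    | zero =>
      refine compatible_of_lprod fun l => ?_
      cases l with
      | nil => simpa [tensorOne_one] using h
      | cons Y l =>
        rw [Function.iterate_zero, Function.iterate_zero, id, id, List.map_cons, lprod_cons,
          lprod_cons, ← contr_apply, ← contr_apply, contr_tensorOne, contr_tensorOne]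
        exact Jets.Compatible.zero
    | succ n ih => simp only [Function.iterate_succ_apply']; exact compatible_symDer he hnab ih
  intro P
  induction P using Env.induction_lprod with
  | hadd a b ha hb => simp only [map_add, ha, hb]
  | hs f l =>
    have h1 := hn l.length (lprod K R l) 1
    rw [map_one] at h1
    rw [Env.map_smul, map_smul, map_smul, smul_eq_mul, smul_eq_mul, map_mul, Env.map_lprod,
      eval_expJet, eval_expJet, eval_expTerm, eval_expTerm, List.length_map, map_smul,
      ← Env.map_lprod, h1]

end Compatibility

end LieRinehart

namespace LieRinehart

/-! ### Ordered monomials under restriction -/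

section MonCompatibility

open scoped LieRinehartAlgebra

variable {K R L R' L' : Type*} [Field K] [CharZero K] [CommRing R] [Algebra K R]
  [LieRing L] [LieAlgebra K L] [Module R L] [LieRingModule L R]
  [LieRinehartRing R L] [LieRinehartAlgebra K R L]
  [CommRing R'] [Algebra K R']
  [LieRing L'] [LieAlgebra K L'] [Module R' L'] [LieRingModule L' R']
  [LieRinehartRing R' L'] [LieRinehartAlgebra K R' L']
  {σ : R →ₐ[K] R'} {g : L →ₗ⁅σ⁆ L'} {r : ℕ}

theorem Env.map_mon {e : Fin r → L} {e' : Fin r → L'} (h : ∀ i, g (e i) = e' i)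
    (a : Multiset (Fin r)) : Env.map g (mon K R e a) = mon K R' e' a := by
  rw [mon, Env.map_lprod, List.map_map, mon]
  exact congrArg _ (List.map_congr_left fun i _ => h i)

theorem Env.map_mem_filt {n : ℕ} {D : Env K R L} (hD : D ∈ filt K R L n) :
    Env.map g D ∈ filt K R' L' n := by
  induction hD using Submodule.span_induction with
  | mem D hD =>
    obtain ⟨l, hl, rfl⟩ := hD
    rw [Env.map_lprod]
    exact lprod_mem_filt (by simpa using hl)
  | zero => rw [map_zero]; exact zero_mem _
  | add D E _ _ hD hE => rw [map_add]; exact add_mem hD hE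
  | smul f D _ hD => rw [Env.map_smul]; exact Submodule.smul_mem _ _ hD

theorem Jets.compatible_of_mon (e : Module.Basis (Fin r) R L) {φ : Jets K R L} {φ' : Jets K R' L'}
    (h : ∀ a, Jets.eval φ' (Env.map g (mon K R e a)) = σ (Jets.eval φ (mon K R e a))) :
    Jets.Compatible g φ φ' := fun D => by
  have hD : D ∈ Submodule.span R (Set.range (mon K R e)) := by rw [span_mon e]; trivial
  induction hD using Submodule.span_induction with
  | mem D hD => obtain ⟨a, rfl⟩ := hD; exact h a
  | zero => simp
  | add D E _ _ hD hE => simp only [map_add, hD, hE]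
  | smul f D _ hD => rw [Env.map_smul, _root_.map_smul, _root_.map_smul, hD, smul_eq_mul, smul_eq_mul, map_mul]

theorem Jets.ext_mon (e : Module.Basis (Fin r) R L) {φ ψ : Jets K R L}
    (h : ∀ a, Jets.eval φ (mon K R e a) = Jets.eval ψ (mon K R e a)) : φ = ψ :=
  sub_eq_zero.1 (Jets.eq_zero_of_vanish fun n => (Jets.vanish_iff_mon e).2 fun a _ => by
    rw [Jets.eval_sub, h, sub_self])

end MonCompatibility

/-! ### Local frames and sections of the sheaf of jets -/

section Frames

variable {K : Type u} [Field K] [CharZero K] {X : RingedSpace.{u, u}} [SpaceOver K X]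

namespace LieAlgebroid

variable (L : LieAlgebroid K X) {r : ℕ}

/-- The restrictions of `s` to every open subset of `V` form a basis. -/
def IsFrame (V : Opens X) (s : Fin r → L.Sec V) : Prop :=
  ∀ (W : Opens X) (h : W ≤ V), LinearIndependent (Fn X W) (fun i => L.res h (s i)) ∧
    Submodule.span (Fn X W) (Set.range fun i => L.res h (s i)) = ⊤

variable {L}

theorem IsFrame.restrict {V V' : Opens X} {s : Fin r → L.Sec V} (hs : L.IsFrame V s) (h : V' ≤ V) :
    L.IsFrame V' fun i => L.res h (s i) := fun W hW => by
  simp only [res_res]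
  exact hs W (hW.trans h)

theorem IsLocallyFreeOfRank.exists_isFrame (hL : L.IsLocallyFreeOfRank r) {U : Opens X} {x : X}
    (hx : x ∈ U) : ∃ V : Opens X, x ∈ V ∧ V ≤ U ∧ ∃ s : Fin r → L.Sec V, L.IsFrame V s := by
  obtain ⟨V, hxV, s, hs⟩ := hL x
  exact ⟨V ⊓ U, ⟨hxV, hx⟩, inf_le_right, _, IsFrame.restrict (L := L) hs inf_le_left⟩

theorem IsFrame.abelian {V : Opens X} {s : Fin r → L.Sec V} (hs : L.IsFrame V s) :
    L.abelian.IsFrame V fun i => (L.ofAbelian V).symm (s i) := fun W h => hs W h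

theorem IsLocallyFreeOfRank.abelian (hL : L.IsLocallyFreeOfRank r) :
    L.abelian.IsLocallyFreeOfRank r := hL

/-- The basis of the sections over an open subset given by a frame. -/
noncomputable def IsFrame.basis {V : Opens X} {s : Fin r → L.Sec V} (hs : L.IsFrame V s)
    {W : Opens X} (h : W ≤ V) : Module.Basis (Fin r) (Fn X W) (L.Sec W) :=
  Module.Basis.mk (hs W h).1 (hs W h).2.ge

@[simp] theorem IsFrame.basis_apply {V : Opens X} {s : Fin r → L.Sec V} (hs : L.IsFrame V s)
    {W : Opens X} (h : W ≤ V) (i : Fin r) : hs.basis h i = L.res h (s i) :=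
  Module.Basis.mk_apply _ _ _

theorem IsFrame.res_basis {V : Opens X} {s : Fin r → L.Sec V} (hs : L.IsFrame V s)
    {W W' : Opens X} (h : W ≤ V) (h' : W' ≤ W) (i : Fin r) :
    L.res h' (hs.basis h i) = hs.basis (h'.trans h) i := by
  rw [hs.basis_apply, hs.basis_apply, res_res]

theorem exists_isDual {R M : Type*} [CommRing R] [Algebra K R] [LieRing M] [LieAlgebra K M]
    [Module R M] [LieRingModule M R] [LieRinehartRing R M] [LieRinehartAlgebra K R M]
    (e : Module.Basis (Fin r) R M) : ∃ ξ : Fin r → Jets K R M, IsDual e ξ := by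
  obtain ⟨ξ, h1, h2⟩ := exists_dual_jets (K := K) e
  exact ⟨ξ, h1, h2⟩

/-- The ordered monomials over a smaller open set are restrictions of those over `V`, so the jet
over `V` determines the whole family. -/
theorem IsFrame.val_injective {V : Opens X} {s : Fin r → L.Sec V} (hs : L.IsFrame V s) :
    Function.Injective (Jet.val (L := L) (le_refl V)) := by
  intro φ ψ h
  refine Jet.ext fun W hW => Jets.ext_mon (hs.basis hW) fun a => ?_
  rw [← Env.map_mon (g := L.res hW) (e := hs.basis le_rfl) (fun i => hs.res_basis le_rfl hW i),
    Jet.val_compatible φ le_rfl hW, Jet.val_compatible ψ le_rfl hW, h]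

/-- Over each smaller open set the ordered monomials are a basis again, so a jet can be defined
there by the restricted values. -/
theorem IsFrame.val_surjective {V : Opens X} {s : Fin r → L.Sec V} (hs : L.IsFrame V s) :
    Function.Surjective (Jet.val (L := L) (le_refl V)) := by
  intro φ
  have key : ∀ (W : Opens X) (hW : W ≤ V), ∃ ψ : Jets K (Fn X W) (L.Sec W), ∀ a,
      Jets.eval ψ (mon K _ (hs.basis hW) a) =
        resFn K hW (Jets.eval φ (mon K _ (hs.basis le_rfl) a)) := fun W hW => by
    obtain ⟨ξ, hξ⟩ := exists_isDual (K := K) (hs.basis hW)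
    exact hξ.exists_eval_eq _
  choose ψ hψ using key
  refine ⟨Jet.mk ψ fun W W' hW h => Jets.compatible_of_mon (hs.basis hW) fun a => ?_, ?_⟩
  · rw [Env.map_mon (e' := hs.basis (h.trans hW)) (fun i => hs.res_basis hW h i), hψ, hψ, resFn_resFn]
  · rw [Jet.val_mk]
    refine Jets.ext_mon (hs.basis le_rfl) fun a => ?_
    rw [hψ, resFn_self]

/-- Over an open set with a frame, the sheaf of jets is given by the algebra of jets of the
sections. -/
noncomputable def IsFrame.valEquiv {V : Opens X} {s : Fin r → L.Sec V} (hs : L.IsFrame V s) :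
    L.Jet V ≃ₐ[Fn X V] Jets K (Fn X V) (L.Sec V) :=
  AlgEquiv.ofBijective
    { __ := (Jet.val (le_refl V) : L.Jet V →ₐ[K] Jets K (Fn X V) (L.Sec V))
      commutes' := fun f => by
        change Jets.α₂ K _ _ (resFn K le_rfl f) = Jets.α₂ K _ _ f
        rw [resFn_self] }
    ⟨hs.val_injective, hs.val_surjective⟩

theorem IsFrame.valEquiv_apply {V : Opens X} {s : Fin r → L.Sec V} (hs : L.IsFrame V s)
    (φ : L.Jet V) : hs.valEquiv φ = Jet.val le_rfl φ := rfl

theorem IsFrame.valEquiv_smul {V : Opens X} {s : Fin r → L.Sec V} (hs : L.IsFrame V s)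
    (D : L.Univ V) (φ : L.Jet V) : hs.valEquiv (D • φ) = D • hs.valEquiv φ := by
  rw [hs.valEquiv_apply, Jet.val_smul, map_res_self, hs.valEquiv_apply]

end LieAlgebroid

end Frames

/-! ### Transport along isomorphisms of algebras -/

section Transport

variable {K : Type*} [CommRing K] {A B : Type*} [CommRing A] [Algebra K A] [CommRing B]
  [Algebra K B]

theorem IsDiffOp.conj (f : A ≃ₐ[K] B) : ∀ {n} {D : Module.End K A}, IsDiffOp n D →
    IsDiffOp n (f.toLinearEquiv.conj D)
  | 0, D, hD => by
    have hD : D = 0 := hD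
    rw [hD, map_zero]; exact IsDiffOp.zero 0
  | n + 1, D, hD => fun b => by
    have := (hD (f.symm b)).conj f
    convert this using 1
    ext c
    simp [LinearEquiv.conj_apply]

end Transport

section SmashCongr

variable {K R L A B : Type*} [CommRing K] [CommRing R] [Algebra K R] [LieRing L]
  [Module R L] [LieRingModule L R]
  [CommRing A] [Algebra K A] [Algebra R A] [Module (Env K R L) A] [IsScalarTower K R A]
  [EnvAlgebra K R L A]
  [CommRing B] [Algebra K B] [Algebra R B] [Module (Env K R L) B] [IsScalarTower K R B]
  [EnvAlgebra K R L B]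

/-- The bijection of smash products induced by an equivariant isomorphism of algebras. -/
noncomputable def Smash.congr (f : A ≃ₐ[R] B) : Smash K R L A ≃+ Smash K R L B :=
  (TensorProduct.congr f.toLinearEquiv (LinearEquiv.refl R (Env K R L))).toAddEquiv

theorem Smash.congr_tmul (f : A ≃ₐ[R] B) (a : A) (D : Env K R L) :
    Smash.congr f (Smash.tmul a D) = Smash.tmul (f a) D := rfl

theorem Smash.act_congr (f : A ≃ₐ[R] B) (hf : ∀ (D : Env K R L) a, f (D • a) = D • f a)
    (t : Smash K R L A) (a : A) :
    Smash.act K R L B (Smash.congr f t) (f a) = f (Smash.act K R L A t a) := by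
  induction t using Smash.induction with
  | h0 => simp
  | ht b D => rw [Smash.congr_tmul, Smash.act_tmul, Smash.act_tmul, map_mul, hf]
  | hadd x y hx hy =>
    rw [map_add, map_add, map_add, LinearMap.add_apply, LinearMap.add_apply, hx, hy, map_add]

end SmashCongr

end LieRinehart

namespace LieRinehart

/-! ### Gluing functions, jets and differential operators -/

section Gluing

variable {K : Type u} [Field K] {X : RingedSpace.{u, u}} [SpaceOver K X]

theorem fn_ext_of_cover {ι : Type u} {U : ι → Opens X} {V : Opens X} (hU : ∀ i, U i ≤ V)
    (hV : V ≤ iSup U) {f g : Fn X V} (h : ∀ i, resFn K (hU i) f = resFn K (hU i) g) : f = g :=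
  X.sheaf.eq_of_locally_eq' U V (fun i => homOfLE (hU i)) hV f g h

theorem exists_fn_glue {ι : Type u} {U : ι → Opens X} {V : Opens X} (hU : ∀ i, U i ≤ V)
    (hV : V ≤ iSup U) (f : ∀ i, Fn X (U i))
    (hf : ∀ i j, resFn K (inf_le_left : U i ⊓ U j ≤ U i) (f i) =
      resFn K (inf_le_right : U i ⊓ U j ≤ U j) (f j)) :
    ∃ g : Fn X V, ∀ i, resFn K (hU i) g = f i :=
  (X.sheaf.existsUnique_gluing' U V (fun i => homOfLE (hU i)) hV f
    fun i j => hf i j).exists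

theorem le_iSup_inf {ι : Type u} {U : ι → Opens X} {V W : Opens X} (hV : V ≤ iSup U) (hW : W ≤ V) :
    W ≤ ⨆ i, W ⊓ U i := by
  rw [← inf_iSup_eq]
  exact le_inf le_rfl (hW.trans hV)

namespace LieAlgebroid

variable {L : LieAlgebroid K X}

theorem Jet.ext_of_cover {ι : Type u} {U : ι → Opens X} {V : Opens X} (hU : ∀ i, U i ≤ V)
    (hV : V ≤ iSup U) {φ ψ : L.Jet V} (h : ∀ i, Jet.res (hU i) φ = Jet.res (hU i) ψ) : φ = ψ := by
  refine Jet.ext fun W hW => Jets.ext fun D => ?_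
  refine fn_ext_of_cover (K := K) (fun i => (inf_le_left : W ⊓ U i ≤ W)) (le_iSup_inf hV hW)
    fun i => ?_
  have h1 := Jet.val_compatible φ hW (inf_le_left : W ⊓ U i ≤ W) D
  have h2 := Jet.val_compatible ψ hW (inf_le_left : W ⊓ U i ≤ W) D
  have h3 := congrArg (Jet.val (inf_le_right : W ⊓ U i ≤ U i)) (h i)
  rw [Jet.val_res, Jet.val_res] at h3
  rw [← h1, ← h2, h3]

theorem Jet.exists_glue {ι : Type u} {U : ι → Opens X} {V : Opens X} (hU : ∀ i, U i ≤ V)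
    (hV : V ≤ iSup U) (φ : ∀ i, L.Jet (U i))
    (hφ : ∀ i j, Jet.res (inf_le_left : U i ⊓ U j ≤ U i) (φ i) =
      Jet.res (inf_le_right : U i ⊓ U j ≤ U j) (φ j)) :
    ∃ ψ : L.Jet V, ∀ i, Jet.res (hU i) ψ = φ i := by
  have hval : ∀ (i j : ι) (T : Opens X) (hi : T ≤ U i) (hj : T ≤ U j),
      Jet.val hi (φ i) = Jet.val hj (φ j) := fun i j T hi hj => by
    have := congrArg (Jet.val (le_inf hi hj)) (hφ i j)
    rwa [Jet.val_res, Jet.val_res] at this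
  -- A jet takes values in functions, so its value on each `D` is glued separately over the cover of
  -- `W` by the sets `W ⊓ U i`. Uniqueness of gluing then gives linearity and compatibility.
  have key : ∀ (W : Opens X) (hW : W ≤ V) (D : L.Univ W), ∃ f : Fn X W, ∀ i,
      resFn K (inf_le_left : W ⊓ U i ≤ W) f =
        Jets.eval (Jet.val (inf_le_right : W ⊓ U i ≤ U i) (φ i))
          (Env.map (L.res inf_le_left) D) := fun W hW D => by
    refine exists_fn_glue (K := K) _ (le_iSup_inf hV hW) _ fun i j => ?_
    rw [← Jet.val_compatible (φ i) inf_le_right inf_le_left,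
      ← Jet.val_compatible (φ j) inf_le_right inf_le_right, map_res_res, map_res_res,
      hval i j]
  choose f hf using key
  have hext : ∀ (W : Opens X) (hW : W ≤ V) (g g' : Fn X W),
      (∀ i, resFn K (inf_le_left : W ⊓ U i ≤ W) g = resFn K inf_le_left g') → g = g' :=
    fun W hW g g' h => fn_ext_of_cover (K := K) _ (le_iSup_inf hV hW) h
  refine ⟨Jet.mk (fun W hW => Jets.of
    { toFun := f W hW
      map_add' := fun D E => hext W hW _ _ fun i => by simp only [map_add, hf]
      map_smul' := fun g D => hext W hW _ _ fun i => by
        rw [hf, Env.map_smul, map_smul, RingHom.id_apply, smul_eq_mul, smul_eq_mul, map_mul, hf] })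
    fun W W' hW h D => ?_, fun i => Jet.ext fun W hW => Jets.ext fun D => ?_⟩
  · change f W' _ (Env.map (L.res h) D) = resFn K h (f W hW D)
    refine hext W' (h.trans hW) _ _ fun i => ?_
    have := congrArg (resFn K (inf_le_inf h le_rfl : W' ⊓ U i ≤ W ⊓ U i)) (hf W hW D i)
    rw [resFn_resFn, ← Jet.val_compatible (φ i) inf_le_right, map_res_res] at this
    rw [hf, map_res_res, resFn_resFn, this]
  · change f W (hW.trans (hU i)) D = Jets.eval (Jet.val hW (φ i)) D
    refine hext W (hW.trans (hU i)) _ _ fun j => ?_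
    rw [hf, ← Jet.val_compatible (φ i) hW, hval i j]

theorem Diff.ext {V : Opens X} {D E : L.Diff V}
    (h : ∀ (W : Opens X) (hW : W ≤ V) (φ : L.Jet W), Diff.val hW D φ = Diff.val hW E φ) : D = E :=
  Subtype.ext (funext fun W => LinearMap.ext fun φ => h W.1 W.2 φ)

theorem Diff.res_val {V W W' : Opens X} (D : L.Diff V) (hW : W ≤ V) (h : W' ≤ W) (φ : L.Jet W) :
    Jet.res h (Diff.val hW D φ) = Diff.val (h.trans hW) D (Jet.res h φ) :=
  D.2.2.1 ⟨W, hW⟩ ⟨W', h.trans hW⟩ h φ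

theorem Diff.val_alpha₁_mul {V W : Opens X} (D : L.Diff V) (hW : W ≤ V) (f : Fn X W) (φ : L.Jet W) :
    Diff.val hW D (Jet.α₁ L W f * φ) = Jet.α₁ L W f * Diff.val hW D φ :=
  D.2.1 ⟨W, hW⟩ f φ

theorem Diff.val_res {V V' W : Opens X} (h : V' ≤ V) (hW : W ≤ V') (D : L.Diff V) :
    Diff.val hW (Diff.res h D) = Diff.val (hW.trans h) D := rfl

theorem Diff.exists_isDiffOp {V : Opens X} (D : L.Diff V) {x : X} (hx : x ∈ V) :
    ∃ V' : Opens X, x ∈ V' ∧ ∃ n, ∀ (W : Opens X) (hW : W ≤ V), W ≤ V' → IsDiffOp n (Diff.val hW D) := by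
  obtain ⟨V', hx', n, hn⟩ := D.2.2.2 x hx
  exact ⟨V', hx', n, fun W hW h => hn ⟨W, hW⟩ h⟩

/-- The differential operator with given values. -/
noncomputable def Diff.mk {V : Opens X} (D : ∀ W : Opens X, W ≤ V → Module.End K (L.Jet W))
    (h₁ : ∀ W hW f φ, D W hW (Jet.α₁ L W f * φ) = Jet.α₁ L W f * D W hW φ)
    (h₂ : ∀ W W' (hW : W ≤ V) (h : W' ≤ W) φ,
      Jet.res h (D W hW φ) = D W' (h.trans hW) (Jet.res h φ))
    (h₃ : ∀ x ∈ V, ∃ V' : Opens X, x ∈ V' ∧ ∃ n, ∀ W hW, W ≤ V' → IsDiffOp n (D W hW)) : L.Diff V :=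
  ⟨fun W => D W.1 W.2, fun W f φ => h₁ W.1 W.2 f φ, fun W W' h φ => h₂ W.1 W'.1 W.2 h φ,
    fun x hx => by
      obtain ⟨V', hx', n, hn⟩ := h₃ x hx
      exact ⟨V', hx', n, fun W hW => hn W.1 W.2 hW⟩⟩

theorem Jet.res_res {U V W : Opens X} (h : V ≤ U) (h' : W ≤ V) (φ : L.Jet U) :
    Jet.res h' (Jet.res h φ) = Jet.res (h'.trans h) φ := rfl

theorem Jet.res_alpha₁ {V W : Opens X} (h : W ≤ V) (f : Fn X V) :
    Jet.res h (Jet.α₁ L V f) = Jet.α₁ L W (resFn K h f) := Jet.ext fun T hT => by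
  rw [Jet.val_res, Jet.val_α₁, Jet.val_α₁, resFn_resFn]

/-- `Diff(J(L))` is a sheaf. -/
theorem isSheaf_diffSheaf (L : LieAlgebroid K X) :
    Presheaf.IsSheaf (Opens.grothendieckTopology X) L.diffSheaf := by
  refine (TopCat.Presheaf.isSheaf_iff_isSheafUniqueGluing L.diffSheaf).2 fun ι U D hD => ?_
  let D : ∀ i, L.Diff (U i) := D
  have hval : ∀ (i j : ι) (T : Opens X) (hi : T ≤ U i) (hj : T ≤ U j),
      Diff.val hi (D i) = Diff.val hj (D j) := fun i j T hi hj =>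
    congrArg (Diff.val (L := L) (le_inf hi hj)) (hD i j)
  have hext : ∀ (W : Opens X) (hW : W ≤ iSup U) (φ ψ : L.Jet W),
      (∀ i, Jet.res (inf_le_left : W ⊓ U i ≤ W) φ = Jet.res inf_le_left ψ) → φ = ψ :=
    fun W hW φ ψ h => Jet.ext_of_cover _ (le_iSup_inf le_rfl hW) h
  -- The image of `φ` is glued from the images of its restrictions.
  have key : ∀ (W : Opens X) (hW : W ≤ iSup U) (φ : L.Jet W), ∃ ψ : L.Jet W, ∀ i,
      Jet.res (inf_le_left : W ⊓ U i ≤ W) ψ =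
        Diff.val (inf_le_right : W ⊓ U i ≤ U i) (D i) (Jet.res inf_le_left φ) := fun W hW φ => by
    refine Jet.exists_glue _ (le_iSup_inf le_rfl hW) _ fun i j => ?_
    rw [Diff.res_val, Diff.res_val, Jet.res_res, Jet.res_res, hval i j]
  choose F hF using key
  have hFi : ∀ (i : ι) (W : Opens X) (hW : W ≤ U i) (φ : L.Jet W),
      F W (hW.trans (le_iSup U i)) φ = Diff.val hW (D i) φ := fun i W hW φ =>
    hext W (hW.trans (le_iSup U i)) _ _ fun j => by rw [hF, Diff.res_val, hval i j]
  have hlin : ∀ (W : Opens X) (hW : W ≤ iSup U), ∃ E : Module.End K (L.Jet W),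
      ∀ φ, E φ = F W hW φ := fun W hW =>
    ⟨{ toFun := F W hW
       map_add' := fun φ ψ => hext W hW _ _ fun i => by simp only [map_add, hF]
       map_smul' := fun c φ => hext W hW _ _ fun i => by
         simp only [map_smul, hF, RingHom.id_apply] }, fun φ => rfl⟩
  choose E hE using hlin
  refine ⟨Diff.mk E (fun W hW f φ => hext W hW _ _ fun i => ?_)
    (fun W W' hW h φ => hext W' (h.trans hW) _ _ fun i => ?_) (fun x hx => ?_), fun i => ?_,
    fun E' hE' => ?_⟩
  · rw [hE, hE, hF, map_mul (Jet.res _), map_mul (Jet.res _), hF, Jet.res_alpha₁, Diff.val_alpha₁_mul]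
  · rw [hE, hE, hF]
    have := congrArg (Jet.res (inf_le_inf h le_rfl : W' ⊓ U i ≤ W ⊓ U i)) (hF W hW φ i)
    rw [Diff.res_val] at this
    exact this
  -- The order need only be bounded near each point, so one member of the cover suffices.
  · obtain ⟨i, hi⟩ := Opens.mem_iSup.1 hx
    obtain ⟨V', hx', n, hn⟩ := (D i).exists_isDiffOp hi
    refine ⟨V' ⊓ U i, ⟨hx', hi⟩, n, fun W hW h => ?_⟩
    have : E W hW = Diff.val (h.trans inf_le_right) (D i) := LinearMap.ext fun φ => by
      rw [hE]; exact hFi i W _ φ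
    rw [this]
    exact hn W _ (h.trans inf_le_left)
  · refine Diff.ext fun W hW φ => ?_
    exact (hE W _ φ).trans (hFi i W hW φ)
  · refine Diff.ext fun W hW φ => hext W hW _ _ fun i => ?_
    have h1 : Diff.res (le_iSup U i) (E' : L.Diff (iSup U)) = D i := hE' i
    refine (Diff.res_val (E' : L.Diff (iSup U)) hW inf_le_left φ).trans
      (Eq.trans ?_ ((congrArg _ (hE W hW φ)).trans (hF W hW φ i)).symm)
    rw [← h1]
    rfl

end LieAlgebroid

end Gluing

/-! ### The isomorphism `j_∇` of sheaves -/

section ExpSheaf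

variable {K : Type u} [Field K] [CharZero K] {X : RingedSpace.{u, u}} [SpaceOver K X]

namespace LieAlgebroid

variable {L : LieAlgebroid K X} (nab : L.Connection)

/-- The map `j_∇` on sections. -/
noncomputable def expSec (V : Opens X) : L.Jet V →ₐ[K] L.abelian.Jet V where
  toFun φ := Jet.mk (fun W hW => expHom (L.ofAbelian W) (nab.onSections W) (Jet.val hW φ))
    fun W W' hW h => compatible_expJet (g := L.res h) (fun Y => rfl)
      (fun Y Z => nab.res_onSections h Y Z) (Jet.val_compatible φ hW h)
  map_one' := Jet.ext fun W hW => map_one (expHom (L.ofAbelian W) (nab.onSections W))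
  map_zero' := Jet.ext fun W hW => map_zero (expHom (L.ofAbelian W) (nab.onSections W))
  map_add' φ ψ := Jet.ext fun W hW => map_add (expHom (L.ofAbelian W) (nab.onSections W)) _ _
  map_mul' φ ψ := Jet.ext fun W hW => map_mul (expHom (L.ofAbelian W) (nab.onSections W)) _ _
  commutes' c := Jet.ext fun W hW => AlgHom.commutes (expHom (L.ofAbelian W) (nab.onSections W)) c

theorem val_expSec {V W : Opens X} (hW : W ≤ V) (φ : L.Jet V) : Jet.val hW (expSec nab V φ) =
    expHom (L.ofAbelian W) (nab.onSections W) (Jet.val hW φ) := rfl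

theorem res_expSec {V W : Opens X} (h : W ≤ V) (φ : L.Jet V) :
    Jet.res h (expSec nab V φ) = expSec nab W (Jet.res h φ) := rfl

theorem expSec_alpha₁ {V : Opens X} (f : Fn X V) :
    expSec nab V (Jet.α₁ L V f) = Jet.α₁ L.abelian V f :=
  Jet.ext fun W hW => expJet_alpha₁ (L.ofAbelian W) (nab.onSections W) (resFn K hW f)

theorem expSec_injective (V : Opens X) : Function.Injective (expSec nab V) := fun φ ψ h =>
  Jet.ext fun W hW => expHom_injective (L.ofAbelian W) (nab.onSections W)
    (congrArg (Jet.val hW) h)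

theorem IsFrame.expSec_surjective {r : ℕ} {V : Opens X} {s : Fin r → L.Sec V}
    (hs : L.IsFrame V s) : Function.Surjective (expSec nab V) := fun ψ => by
  obtain ⟨ξ, hξ⟩ := exists_isDual (K := K) (hs.basis le_rfl)
  obtain ⟨φ, hφ⟩ := expHom_surjective (L.ofAbelian V) (nab.onSections V) hξ (Jet.val le_rfl ψ)
  obtain ⟨φ, rfl⟩ := hs.val_surjective φ
  exact ⟨φ, hs.abelian.val_injective hφ⟩

/-- Preimages exist over the members of a cover by framed open sets, and injectivity over the
overlaps lets them glue. -/
theorem expSec_surjective {r : ℕ} (hL : L.IsLocallyFreeOfRank r) (V : Opens X) :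
    Function.Surjective (expSec nab V) := fun ψ => by
  choose! T hT hTV s hs using fun (x : X) (hx : x ∈ V) => hL.exists_isFrame hx
  have hsurj := fun x : V => (hs x.1 x.2).expSec_surjective nab (Jet.res (hTV x.1 x.2) ψ)
  choose φ hφ using hsurj
  have hcov : V ≤ ⨆ x : V, T x.1 := fun x hx => Opens.mem_iSup.2 ⟨⟨x, hx⟩, hT x hx⟩
  obtain ⟨χ, hχ⟩ := Jet.exists_glue (U := fun x : V => T x.1) (fun x => hTV x.1 x.2) hcov φ
    fun x y => expSec_injective nab _ (by
      rw [← res_expSec, ← res_expSec, hφ, hφ]; rfl)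
  refine ⟨χ, Jet.ext_of_cover (U := fun x : V => T x.1) (fun x => hTV x.1 x.2) hcov fun x => ?_⟩
  rw [res_expSec, hχ, hφ]

/-- The isomorphism `j_∇` on sections. -/
noncomputable def expEquiv {r : ℕ} (hL : L.IsLocallyFreeOfRank r) (V : Opens X) :
    L.Jet V ≃ₐ[K] L.abelian.Jet V :=
  AlgEquiv.ofBijective (expSec nab V) ⟨expSec_injective nab V, expSec_surjective nab hL V⟩

/-- The isomorphism `j_∇`. -/
noncomputable def expIso {r : ℕ} (hL : L.IsLocallyFreeOfRank r) :
    L.jetSheaf ≅ L.abelian.jetSheaf :=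
  NatIso.ofComponents (fun V => (expEquiv nab hL V.unop).toAlgebraIso) fun i => rfl

theorem expIso_hom_app {r : ℕ} (hL : L.IsLocallyFreeOfRank r) (V : Opens X) (φ : L.Jet V) :
    ((expIso nab hL).hom.app (op V)).hom φ = expSec nab V φ := rfl

end LieAlgebroid

end ExpSheaf

end LieRinehart

/-! ### The isomorphism of `J(L) ⊗ U(L)` with differential operators -/

namespace LieRinehart

/-- Both `η` and the map to the sheafification belong to `J.W`, hence so does the lift by
cancellation; between sheaves, maps in `J.W` are isomorphisms. -/
theorem isIso_sheafifyLift_of_W {C : Type*} [Category* C] (J : GrothendieckTopology C) {D : Type*}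
    [Category* D] [HasWeakSheafify J D] {P Q : Cᵒᵖ ⥤ D} (η : P ⟶ Q) (hQ : Presheaf.IsSheaf J Q)
    (hη : J.W η) : IsIso (sheafifyLift J η hQ) := by
  have h : J.W (sheafifyLift J η hQ) := by
    rw [← toSheafify_sheafifyLift J η hQ] at hη
    exact (J.W.precomp_iff _ _ (J.W_toSheafify P)).1 hη
  let f : (presheafToSheaf J D).obj P ⟶ ⟨Q, hQ⟩ := ⟨sheafifyLift J η hQ⟩
  have : IsIso f := (J.W_sheafToPresheaf_map_iff_isIso f).1 h
  exact inferInstanceAs (IsIso ((sheafToPresheaf J D).map f))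

section DiffSheaf

variable {K : Type u} [Field K] [CharZero K] {X : RingedSpace.{u, u}} [SpaceOver K X]

namespace LieAlgebroid

variable {L : LieAlgebroid K X}

theorem Jet.smul_alpha₁_mul {V : Opens X} (D : L.Univ V) (f : Fn X V) (φ : L.Jet V) :
    D • (Jet.α₁ L V f * φ) = Jet.α₁ L V f * (D • φ) := Jet.ext fun W hW => by
  rw [Jet.val_smul, map_mul, map_mul, Jet.val_smul, Jet.val_α₁, Jets.smul_alpha₁_mul]

theorem Jet.act_alpha₁_mul {V : Opens X} (t : L.JU V) (f : Fn X V) (φ : L.Jet V) :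
    Smash.act K _ _ (L.Jet V) t (Jet.α₁ L V f * φ) =
      Jet.α₁ L V f * Smash.act K _ _ (L.Jet V) t φ := by
  induction t using Smash.induction with
  | h0 => simp
  | ht ψ D => rw [Smash.act_tmul, Smash.act_tmul, Jet.smul_alpha₁_mul, mul_left_comm]
  | hadd x y hx hy => rw [map_add, LinearMap.add_apply, LinearMap.add_apply, hx, hy, mul_add]

theorem resJU_tmul {V W : Opens X} (h : W ≤ V) (φ : L.Jet V) (D : L.Univ V) :
    L.resJU h (Smash.tmul φ D) = Smash.tmul (Jet.res h φ) (Env.map (L.res h) D) := rfl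

theorem resJU_resJU {U V W : Opens X} (h : V ≤ U) (h' : W ≤ V) (t : L.JU U) :
    L.resJU h' (L.resJU h t) = L.resJU (h'.trans h) t :=
  (ConcreteCategory.congr_hom (L.presheafJU.map_comp (homOfLE h).op (homOfLE h').op) t).symm

theorem resJU_self {V : Opens X} (t : L.JU V) : L.resJU le_rfl t = t :=
  ConcreteCategory.congr_hom (L.presheafJU.map_id (op V)) t

theorem Jet.res_act {V W : Opens X} (h : W ≤ V) (t : L.JU V) (φ : L.Jet V) :
    Jet.res h (Smash.act K _ _ (L.Jet V) t φ) =
      Smash.act K _ _ (L.Jet W) (L.resJU h t) (Jet.res h φ) := by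
  induction t using Smash.induction with
  | h0 => simp
  | ht ψ D => rw [resJU_tmul, Smash.act_tmul, Smash.act_tmul, map_mul, Jet.res_smul]
  | hadd x y hx hy =>
    rw [map_add, map_add, map_add, LinearMap.add_apply, LinearMap.add_apply, map_add, hx, hy]

/-- Restriction preserves the order filtration of `U(L)`, so one bound serves all smaller open sets
at once. -/
theorem exists_isDiffOp_act {V : Opens X} (t : L.JU V) : ∃ n, ∀ (W : Opens X) (hW : W ≤ V),
    IsDiffOp n (Smash.act K _ _ (L.Jet W) (L.resJU hW t)) := by
  induction t using Smash.induction with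
  | h0 => exact ⟨0, fun W hW => by rw [map_zero, map_zero]; exact IsDiffOp.zero 0⟩
  | ht ψ D =>
    obtain ⟨n, hn⟩ := exists_mem_filt D
    exact ⟨n + 1, fun W hW => isDiffOp_act_tmul _ (Env.map_mem_filt hn)⟩
  | hadd x y hx hy =>
    obtain ⟨n, hn⟩ := hx
    obtain ⟨m, hm⟩ := hy
    refine ⟨max n m, fun W hW => ?_⟩
    rw [map_add, map_add]
    exact ((hn W hW).mono (le_max_left _ _)).add ((hm W hW).mono (le_max_right _ _))

/-- The action of the sections of `J(L) ⊗ U(L)` by differential operators. -/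
noncomputable def actDiff (V : Opens X) : L.JU V →ₐ[K] L.Diff V where
  toFun t := Diff.mk (fun W hW => Smash.act K _ _ (L.Jet W) (L.resJU hW t))
    (fun W hW f φ => Jet.act_alpha₁_mul _ f φ)
    (fun W W' hW h φ => by rw [Jet.res_act, resJU_resJU])
    (fun x hx => by
      obtain ⟨n, hn⟩ := exists_isDiffOp_act t
      exact ⟨V, hx, n, fun W hW _ => hn W hW⟩)
  map_one' := Diff.ext fun W hW φ =>
    DFunLike.congr_fun (map_one ((Smash.act K _ _ (L.Jet W)).comp (L.resJU hW))) φ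
  map_zero' := Diff.ext fun W hW φ =>
    DFunLike.congr_fun (map_zero ((Smash.act K _ _ (L.Jet W)).comp (L.resJU hW))) φ
  map_add' s t := Diff.ext fun W hW φ =>
    DFunLike.congr_fun (map_add ((Smash.act K _ _ (L.Jet W)).comp (L.resJU hW)) s t) φ
  map_mul' s t := Diff.ext fun W hW φ =>
    DFunLike.congr_fun (map_mul ((Smash.act K _ _ (L.Jet W)).comp (L.resJU hW)) s t) φ
  commutes' c := Diff.ext fun W hW φ =>
    DFunLike.congr_fun (((Smash.act K _ _ (L.Jet W)).comp (L.resJU hW)).commutes c) φ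

theorem val_actDiff {V W : Opens X} (hW : W ≤ V) (t : L.JU V) : Diff.val hW (actDiff V t) =
    Smash.act K _ _ (L.Jet W) (L.resJU hW t) := rfl

theorem res_actDiff {V W : Opens X} (h : W ≤ V) (t : L.JU V) :
    Diff.res h (actDiff V t) = actDiff W (L.resJU h t) := Diff.ext fun T hT φ => by
  rw [Diff.val_res, val_actDiff, val_actDiff, resJU_resJU]

variable (L) in
/-- The action of `J(L) ⊗ U(L)` on `J(L)` by differential operators. -/
noncomputable def actHom : L.presheafJU ⟶ L.diffSheaf where
  app V := AlgCat.ofHom (actDiff V.unop)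
  naturality V W i := AlgCat.hom_ext _ (AlgHom.ext fun t => (res_actDiff i.unop.le t).symm)

section Frame

variable {r : ℕ} {V : Opens X} {s : Fin r → L.Sec V} (hs : L.IsFrame V s)
include hs

theorem IsFrame.act_injective : Function.Injective (Smash.act K (Fn X V) (L.Sec V) (L.Jet V)) := by
  obtain ⟨ξ, hξ⟩ := exists_isDual (K := K) (hs.basis le_rfl)
  intro t t' h
  apply (Smash.congr hs.valEquiv).injective
  apply hξ.act_injective
  ext φ : 1
  obtain ⟨φ, rfl⟩ := hs.valEquiv.surjective φ
  rw [Smash.act_congr _ hs.valEquiv_smul, Smash.act_congr _ hs.valEquiv_smul, h]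

theorem IsFrame.actDiff_injective : Function.Injective (actDiff (L := L) V) := fun t t' h =>
  hs.act_injective (by
    have := congrArg (Diff.val (le_refl V)) h
    rwa [val_actDiff, val_actDiff, resJU_self, resJU_self] at this)

theorem IsFrame.alpha₁_mul_valEquiv (f : Fn X V) (φ : L.Jet V) :
    Jets.α₁ K _ _ f * hs.valEquiv φ = hs.valEquiv (Jet.α₁ L V f * φ) := by
  rw [map_mul]
  congr 1
  rw [hs.valEquiv_apply, Jet.val_α₁, resFn_self]

/-- Jets over `W` need not be restrictions of jets over `V`. But the dual jets `ζ` restrict to dual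
jets over `W`, so `D` kills their monomials there, and these determine an operator of bounded order.
-/
theorem IsFrame.diff_eq_zero {n : ℕ} {D : L.Diff V}
    (hn : ∀ (W : Opens X) (hW : W ≤ V), IsDiffOp n (Diff.val hW D))
    (h : Diff.val (le_refl V) D = 0) : D = 0 := by
  obtain ⟨ξ, hξ⟩ := exists_isDual (K := K) (hs.basis le_rfl)
  obtain ⟨ζ, hζ⟩ : ∃ ζ : Fin r → L.Jet V, ∀ k, Jet.val le_rfl (ζ k) = ξ k :=
    ⟨fun k => hs.valEquiv.symm (ξ k), fun k => hs.valEquiv.apply_symm_apply (ξ k)⟩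
  refine Diff.ext fun W hW φ => ?_
  let f := (hs.restrict hW).valEquiv.restrictScalars K
  have hf : ∀ φ, f φ = Jet.val le_rfl φ := fun φ => rfl
  have hconj : ∀ ψ, f.toLinearEquiv.conj (Diff.val hW D) (f ψ) = f (Diff.val hW D ψ) := fun ψ => by
    simp [LinearEquiv.conj_apply]
  have hdual : IsDual (hs.basis hW) fun k => Jet.val hW (ζ k) := by
    refine ⟨fun k => ?_, fun k i => ?_⟩
    · have := Jet.val_compatible (ζ k) le_rfl hW 1
      rw [map_one, hζ, hξ.eval_one, map_zero] at this
      exact this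
    · have := Jet.val_compatible (ζ k) le_rfl hW (Env.ofL K _ _ (hs.basis le_rfl i))
      rw [Env.map_ofL, hs.res_basis, hζ, hξ.eval_ofL] at this
      rw [this]
      split_ifs <;> simp
  have key := hdual.eq_zero_of_isDiffOp n (f.toLinearEquiv.conj (Diff.val hW D))
    (fun g ψ => by
      obtain ⟨ψ, rfl⟩ := f.surjective ψ
      have h1 := (hs.restrict hW).alpha₁_mul_valEquiv g
      change ∀ ψ, Jets.α₁ K _ _ g * f ψ = f _ at h1
      rw [h1, hconj, hconj, Diff.val_alpha₁_mul]
      exact ((hs.restrict hW).alpha₁_mul_valEquiv g _).symm)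
    ((hn W hW).conj f)
    (fun b hb => by
      have : jetMon (fun k => Jet.val hW (ζ k)) b = f (Jet.res hW (b.map ζ).prod) := by
        rw [hf, Jet.val_res, map_multiset_prod, Multiset.map_map]
        rfl
      rw [this, hconj, ← Diff.res_val D le_rfl hW, h, LinearMap.zero_apply, map_zero, map_zero])
  apply f.injective
  rw [← hconj, key]
  exact (map_zero f).symm

/-- The element is found from the action on sections over `V` alone; agreement over smaller open
sets is then `IsFrame.diff_eq_zero`, applied to the difference with the larger of the two orders. -/
theorem IsFrame.exists_actDiff_eq {n : ℕ} {D : L.Diff V}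
    (hn : ∀ (W : Opens X) (hW : W ≤ V), IsDiffOp n (Diff.val hW D)) : ∃ t, actDiff V t = D := by
  obtain ⟨ξ, hξ⟩ := exists_isDual (K := K) (hs.basis le_rfl)
  let f := hs.valEquiv.restrictScalars K
  have hconj : ∀ ψ, f.toLinearEquiv.conj (Diff.val le_rfl D) (f ψ) = f (Diff.val le_rfl D ψ) :=
    fun ψ => by simp [LinearEquiv.conj_apply]
  obtain ⟨t, ht⟩ := hξ.exists_act_eq (D := f.toLinearEquiv.conj (Diff.val le_rfl D))
    (fun g ψ => by
      obtain ⟨ψ, rfl⟩ := f.surjective ψ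
      have h1 := hs.alpha₁_mul_valEquiv g
      change ∀ ψ, Jets.α₁ K _ _ g * f ψ = f _ at h1
      rw [h1, hconj, hconj, Diff.val_alpha₁_mul, h1])
    ((hn V le_rfl).conj f)
  obtain ⟨t, rfl⟩ := (Smash.congr hs.valEquiv).surjective t
  obtain ⟨m, hm⟩ := exists_isDiffOp_act t
  refine ⟨t, sub_eq_zero.1 (hs.diff_eq_zero (n := max m n) (fun W hW => ?_) ?_)⟩
  · rw [map_sub, val_actDiff]
    exact ((hm W hW).mono (le_max_left _ _)).sub ((hn W hW).mono (le_max_right _ _))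
  · rw [map_sub, sub_eq_zero, val_actDiff, resJU_self]
    ext φ : 1
    apply hs.valEquiv.injective
    rw [← Smash.act_congr _ hs.valEquiv_smul, ht]
    exact hconj φ

end Frame

theorem actHom_mem_W {r : ℕ} (hL : L.IsLocallyFreeOfRank r) :
    (Opens.grothendieckTopology X).W L.actHom := by
  have h1 : Presheaf.IsLocallyInjective (Opens.grothendieckTopology X) L.actHom := by
    refine ⟨fun {V} s t h x hx => ?_⟩
    obtain ⟨V', hx', hV', σ, hσ⟩ := hL.exists_isFrame (U := V.unop) hx
    refine ⟨V', homOfLE hV', hσ.actDiff_injective ?_, hx'⟩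
    have h : actDiff V.unop s = actDiff V.unop t := h
    exact (res_actDiff hV' s).symm.trans ((congrArg _ h).trans (res_actDiff hV' t))
  have h2 : Presheaf.IsLocallySurjective (Opens.grothendieckTopology X) L.actHom := by
    refine ⟨fun {V} D x hx => ?_⟩
    -- The neighbourhood is shrunk twice: to bound the order of the operator, and to have a frame.
    obtain ⟨V₁, hx₁, n, hn⟩ := Diff.exists_isDiffOp (L := L) D hx
    obtain ⟨V', hx', hV', σ, hσ⟩ := hL.exists_isFrame (U := V ⊓ V₁) ⟨hx, hx₁⟩
    obtain ⟨t, ht⟩ := hσ.exists_actDiff_eq (n := n) (D := Diff.res (hV'.trans inf_le_left) D)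
      fun W hW => hn W _ (hW.trans (hV'.trans inf_le_right))
    exact ⟨V', homOfLE (hV'.trans inf_le_left), ⟨t, ht⟩, hx'⟩
  exact GrothendieckTopology.W_of_isLocallyBijective _ _

/-- The sheaf `J(L) ⊗ U(L)` is the sheaf of differential operators on `J(L)`. -/
noncomputable def actIso {r : ℕ} (hL : L.IsLocallyFreeOfRank r) : L.sheafJU ≅ L.diffSheaf :=
  @asIso _ _ _ _ (sheafifyLift _ L.actHom (isSheaf_diffSheaf L))
    (isIso_sheafifyLift_of_W _ L.actHom (isSheaf_diffSheaf L) (actHom_mem_W hL))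

theorem actIso_tmul {r : ℕ} (hL : L.IsLocallyFreeOfRank r) {V : Opens X} (φ : L.Jet V)
    (D : L.Univ V) :
    ((actIso hL).hom.app (op V)).hom (L.tmul φ D) = actDiff V (Smash.tmul φ D) := by
  have h := toSheafify_sheafifyLift (Opens.grothendieckTopology X) L.actHom (isSheaf_diffSheaf L)
  exact ConcreteCategory.congr_hom (NatTrans.congr_app h (op V)) (Smash.tmul φ D : L.JU V)

theorem val_actIso_tmul {r : ℕ} (hL : L.IsLocallyFreeOfRank r) {V W : Opens X} (h : W ≤ V)
    (φ : L.Jet V) (D : L.Univ V) (ψ : L.Jet W) :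
    Diff.val h (((actIso hL).hom.app (op V)).hom (L.tmul φ D) : L.Diff V) ψ =
      Jet.res h φ * (Env.map (L.res h) D • ψ) :=
  congrArg (fun E : L.Diff V => Diff.val h E ψ) (actIso_tmul hL φ D)

section Conj

variable {L' : LieAlgebroid K X} (j : ∀ W, L.Jet W ≃ₐ[K] L'.Jet W)
  (hres : ∀ {V W : Opens X} (h : W ≤ V) φ, Jet.res h (j V φ) = j W (Jet.res h φ))
  (hα : ∀ W f, j W (Jet.α₁ L W f) = Jet.α₁ L' W f)

include hres in
theorem symm_res {V W : Opens X} (h : W ≤ V) (φ : L'.Jet V) :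
    Jet.res h ((j V).symm φ) = (j W).symm (Jet.res h φ) := by
  rw [AlgEquiv.eq_symm_apply, ← hres, AlgEquiv.apply_symm_apply]

include hα in
theorem symm_alpha₁ (W : Opens X) (f : Fn X W) :
    (j W).symm (Jet.α₁ L' W f) = Jet.α₁ L W f := by
  rw [AlgEquiv.symm_apply_eq, hα]

/-- Conjugation of differential operators by an isomorphism of sheaves of algebras of jets. -/
noncomputable def Diff.conj (V : Opens X) : L.Diff V →ₐ[K] L'.Diff V where
  toFun D := Diff.mk (fun W hW => (j W).toLinearEquiv.conj (Diff.val hW D))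
    (fun W hW f φ => by
      change j W (Diff.val hW D ((j W).symm _)) = _ * j W (Diff.val hW D ((j W).symm _))
      rw [map_mul, symm_alpha₁ j hα, Diff.val_alpha₁_mul, map_mul, hα])
    (fun W W' hW h φ => by
      change Jet.res h (j W (Diff.val hW D ((j W).symm _))) =
        j W' (Diff.val (h.trans hW) D ((j W').symm _))
      rw [hres, Diff.res_val, symm_res j hres])
    (fun x hx => by
      obtain ⟨V', hx', n, hn⟩ := D.exists_isDiffOp hx
      exact ⟨V', hx', n, fun W hW h => (hn W hW h).conj (j W)⟩)
  map_one' := Diff.ext fun W hW φ => (j W).apply_symm_apply φ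
  map_zero' := Diff.ext fun W hW φ => map_zero (j W)
  map_add' D E := Diff.ext fun W hW φ => map_add (j W) _ _
  map_mul' D E := Diff.ext fun W hW φ => congrArg (fun ψ => j W (Diff.val hW D ψ))
    ((j W).symm_apply_apply _).symm
  commutes' c := Diff.ext fun W hW φ => by
    change j W (c • (j W).symm φ) = c • φ
    rw [map_smul, AlgEquiv.apply_symm_apply]

theorem Diff.val_conj {V W : Opens X} (hW : W ≤ V) (D : L.Diff V) (φ : L'.Jet W) :
    Diff.val hW (Diff.conj j hres hα V D) φ = j W (Diff.val hW D ((j W).symm φ)) := rfl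

/-- Conjugation of differential operators by an isomorphism of sheaves of algebras of jets, as an
isomorphism. -/
noncomputable def Diff.conjIso : L.diffSheaf ≅ L'.diffSheaf :=
  NatIso.ofComponents
    (fun V => (AlgEquiv.ofAlgHom (Diff.conj j hres hα V.unop)
      (Diff.conj (fun W => (j W).symm) (symm_res j hres) (symm_alpha₁ j hα) V.unop)
      (AlgHom.ext fun D => Diff.ext fun W hW φ => by
        rw [AlgHom.comp_apply, Diff.val_conj, Diff.val_conj]; simp)
      (AlgHom.ext fun D => Diff.ext fun W hW φ => by
        rw [AlgHom.comp_apply, Diff.val_conj, Diff.val_conj]; simp)).toAlgebraIso)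
    fun i => rfl

end Conj

end LieAlgebroid

end DiffSheaf

end LieRinehart

/-! ### The completed symmetric algebra as an adic completion -/

namespace LieRinehart

/-- A complete separated filtered ring into which `A` maps densely, with the `I`-adic filtration as
the induced one, is the `I`-adic completion of `A`. -/
theorem exists_adicCompletion_equiv {A B : Type*} [CommRing A] [CommRing B] (I : Ideal A)
    (F : ℕ → Ideal B) (τ : A →+* B) (hF : Antitone F) (hI : ∀ n x, x ∈ I ^ n ↔ τ x ∈ F n)
    (hdense : ∀ n b, ∃ x, b - τ x ∈ F n) (hsep : ∀ b, (∀ n, b ∈ F n) → b = 0)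
    (hcomp : ∀ b : ℕ → B, (∀ n, b (n + 1) - b n ∈ F n) → ∃ y, ∀ n, y - b n ∈ F n) :
    ∃ c : AdicCompletion I A ≃+* B, ∀ x, c (AdicCompletion.of I A x) = τ x := by
  -- Injective because the filtration of `A` is the induced one, surjective by density. The inverses
  -- assemble to a map from `B` to the completion.
  let q : ∀ n, A ⧸ I ^ n →+* B ⧸ F n := fun n =>
    Ideal.quotientMap (F n) τ fun x hx => (hI n x).1 hx
  have hq : ∀ n x, q n (Ideal.Quotient.mk _ x) = Ideal.Quotient.mk _ (τ x) := fun n x =>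
    Ideal.quotientMap_mk
  have hbij : ∀ n, Function.Bijective (q n) := fun n => by
    refine ⟨(injective_iff_map_eq_zero _).2 fun x hx => ?_, fun b => ?_⟩
    · obtain ⟨x, rfl⟩ := Ideal.Quotient.mk_surjective x
      rw [hq, Ideal.Quotient.eq_zero_iff_mem] at hx
      exact Ideal.Quotient.eq_zero_iff_mem.2 ((hI n x).2 hx)
    · obtain ⟨b, rfl⟩ := Ideal.Quotient.mk_surjective b
      obtain ⟨x, hx⟩ := hdense n b
      exact ⟨Ideal.Quotient.mk _ x, by rw [hq]; exact (Ideal.Quotient.eq.2 hx).symm⟩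
  let f : ∀ n, B →+* A ⧸ I ^ n := fun n =>
    ((RingEquiv.ofBijective (q n) (hbij n)).symm : B ⧸ F n →+* A ⧸ I ^ n).comp (Ideal.Quotient.mk (F n))
  have hf : ∀ n b x, f n b = Ideal.Quotient.mk _ x ↔ b - τ x ∈ F n := fun n b x => by
    change (RingEquiv.ofBijective (q n) (hbij n)).symm (Ideal.Quotient.mk (F n) b) = _ ↔ _
    rw [RingEquiv.symm_apply_eq, ← Ideal.Quotient.eq]
    rw [show RingEquiv.ofBijective (q n) (hbij n) (Ideal.Quotient.mk _ x) = _ from hq n x]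
  let ψ : B →+* AdicCompletion I A := AdicCompletion.liftRingHom I f fun {m n} hmn => by
    ext b
    obtain ⟨x, hx⟩ := hdense n b
    rw [RingHom.comp_apply, (hf n b x).2 hx, (hf m b x).2 (hF hmn hx)]
    rfl
  have hψ : ∀ n b, AdicCompletion.evalₐ I n (ψ b) = f n b := fun n b =>
    AdicCompletion.evalₐ_liftRingHom _ _ _ _ _
  have hψbij : Function.Bijective ψ := by
    refine ⟨(injective_iff_map_eq_zero _).2 fun b hb => hsep b fun n => ?_, fun y => ?_⟩
    · have h := hψ n b
      rw [hb, map_zero] at h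
      simpa using (hf n b 0).1 (h.symm.trans (map_zero _).symm)
    · obtain ⟨a, rfl⟩ := AdicCompletion.mk_surjective I A y
      obtain ⟨b, hb⟩ := hcomp (fun n => τ (a n)) fun n => by
        rw [← map_sub, ← hI]
        have := (a.property (Nat.le_succ n)).symm
        rw [SModEq.sub_mem, smul_eq_mul, Ideal.mul_top] at this
        exact this
      refine ⟨b, AdicCompletion.ext_evalₐ (I := I) fun n => ?_⟩
      rw [hψ, AdicCompletion.evalₐ_mk, hf]
      exact hb n
  refine ⟨(RingEquiv.ofBijective ψ hψbij).symm, fun x => ?_⟩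
  rw [RingEquiv.symm_apply_eq]
  refine AdicCompletion.ext_evalₐ (I := I) fun n => ?_
  rw [AdicCompletion.evalₐ_of]
  refine ((hψ n _).trans ((hf n _ x).2 ?_)).symm
  rw [sub_self]
  exact zero_mem _

/-- Every element of `A` is a scalar modulo `I`, so coefficients can be replaced by scalars at the
price of the next power of `I`. -/
theorem exists_mem_pow_of_mem_pow {R A : Type*} [CommRing R] [CommRing A] [Algebra R A] {I : Ideal A}
    {N : Submodule R A} (h0 : ∀ x, ∃ c : R, x - algebraMap R A c ∈ I) (hI : I = Ideal.span (N : Set A))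
    (n : ℕ) : ∀ x ∈ I ^ n, ∃ y ∈ N ^ n, x - y ∈ I ^ (n + 1) := by
  have hNI : ∀ y ∈ N, y ∈ I := fun y hy => hI ▸ Ideal.subset_span hy
  have h1 : ∀ x ∈ I, ∃ y ∈ N, x - y ∈ I ^ 2 := fun x hx => by
    rw [hI] at hx
    induction hx using Submodule.span_induction with
    | mem x hx => exact ⟨x, hx, by rw [sub_self]; exact zero_mem _⟩
    | zero => exact ⟨0, zero_mem _, by rw [sub_self]; exact zero_mem _⟩
    | add x y _ _ hx hy =>
      obtain ⟨x', hx', hx⟩ := hx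
      obtain ⟨y', hy', hy⟩ := hy
      exact ⟨x' + y', add_mem hx' hy', by rw [add_sub_add_comm]; exact add_mem hx hy⟩
    | smul a x _ hx =>
      obtain ⟨y, hy, hx⟩ := hx
      obtain ⟨c, hc⟩ := h0 a
      refine ⟨c • y, Submodule.smul_mem _ c hy, ?_⟩
      have : a • x - c • y = a * (x - y) + (a - algebraMap R A c) * y := by
        rw [smul_eq_mul, Algebra.smul_def]; ring
      rw [this]
      refine add_mem (Ideal.mul_mem_left _ _ hx) ?_
      rw [pow_two]
      exact Ideal.mul_mem_mul hc (hNI y hy)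
  induction n with
  | zero =>
    intro x _
    obtain ⟨c, hc⟩ := h0 x
    exact ⟨algebraMap R A c, by rw [pow_zero]; exact Submodule.algebraMap_mem c, by simpa using hc⟩
  | succ n ih =>
    intro x hx
    rw [pow_succ] at hx
    induction hx using Submodule.mul_induction_on' with
    | mem_mul_mem m hm k hk =>
      obtain ⟨y, hy, hy'⟩ := ih m hm
      obtain ⟨z, hz, hz'⟩ := h1 k hk
      refine ⟨y * z, by rw [pow_succ]; exact Submodule.mul_mem_mul hy hz, ?_⟩
      have hyI : y ∈ I ^ n := by
        have := sub_mem hm (Ideal.pow_le_pow_right (Nat.le_succ n) hy')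
        rwa [sub_sub_cancel] at this
      have : m * k - y * z = (m - y) * k + y * (k - z) := by ring
      rw [this]
      refine add_mem ?_ ?_
      · rw [pow_succ]; exact Ideal.mul_mem_mul hy' hk
      · rw [show n + 1 + 1 = n + 2 from rfl, pow_add]; exact Ideal.mul_mem_mul hyI hz'
    | add x _ y _ hx hy =>
      obtain ⟨x', hx', hx⟩ := hx
      obtain ⟨y', hy', hy⟩ := hy
      exact ⟨x' + y', add_mem hx' hy', by rw [add_sub_add_comm]; exact add_mem hx hy⟩

open scoped Pointwise in
-- The power of a span is spanned by products of `n` generators, which by commutativity depend only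
-- on the multiset of indices.
theorem exists_eq_sum_of_mem_span_pow {R A : Type*} [CommRing R] [CommRing A] [Algebra R A] {r : ℕ}
    (t : Fin r → A) {n : ℕ} {y : A} (hy : y ∈ Submodule.span R (Set.range t) ^ n) :
    ∃ g : Sym (Fin r) n → R, y = ∑ b : Sym (Fin r) n, g b • ((b : Multiset (Fin r)).map t).prod := by
  rw [Submodule.span_pow] at hy
  have h : (Set.range t) ^ n ⊆
      Set.range fun b : Sym (Fin r) n => ((b : Multiset (Fin r)).map t).prod := by
    intro a ha
    obtain ⟨f, rfl⟩ := Set.mem_pow.1 ha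
    choose k hk using fun i => (f i).2
    refine ⟨⟨(List.ofFn k : List (Fin r)), by simp⟩, ?_⟩
    change (Multiset.map t (List.ofFn k : List (Fin r))).prod = _
    rw [Multiset.map_coe, Multiset.prod_coe, List.map_ofFn]
    congr 2
    exact funext hk
  obtain ⟨g, hg⟩ := (Submodule.mem_span_range_iff_exists_fun R).1 (Submodule.span_mono h hy)
  exact ⟨g, hg.symm⟩

section Completion

variable {K : Type u} [Field K] [CharZero K] {X : RingedSpace.{u, u}} [SpaceOver K X]

theorem degOne_one {R M : Type*} [CommRing R] [Algebra K R] [LieRing M] [LieAlgebra K M]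
    [Module R M] [LieRingModule M R] [IsAbelian R M] [IsScalarTower K R M] :
    degOne K R M 1 = 0 := by
  change (degOneAct K R M 1 (1, 0)).2 = 0
  rw [map_one]; rfl

theorem degOne_ofL {R M : Type*} [CommRing R] [Algebra K R] [LieRing M] [LieAlgebra K M]
    [Module R M] [LieRingModule M R] [LieRinehartRing R M] [LieRinehartAlgebra K R M]
    [IsAbelian R M] (x : M) : degOne K R M (Env.ofL K R M x) = x := by
  have := degOne_ofL_mul (K := K) (R := R) x 1
  rwa [mul_one, counit_eq, one_smul, one_smul] at this

namespace LieAlgebroid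

variable {L : LieAlgebroid K X} {r : ℕ} {V : Opens X} {s : Fin r → L.Sec V}

theorem IsFrame.res_coord (hs : L.IsFrame V s) {W W' : Opens X} (hW : W ≤ V) (h : W' ≤ W)
    (k : Fin r) (x : L.Sec W) :
    resFn K h ((hs.basis hW).coord k x) = (hs.basis (h.trans hW)).coord k (L.res h x) := by
  have hx : L.res h x = ∑ i, resFn K h ((hs.basis hW).repr x i) • hs.basis (h.trans hW) i := by
    conv_lhs => rw [← (hs.basis hW).sum_repr x, map_sum]
    refine Finset.sum_congr rfl fun i _ => ?_
    rw [← hs.res_basis hW h]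
    exact resMod_smul (K := K) L.toSheaf h _ _
  rw [Module.Basis.coord_apply, Module.Basis.coord_apply, hx, Module.Basis.repr_sum_self]

/-- The dual frame. -/
noncomputable def IsFrame.dual (hs : L.IsFrame V s) (k : Fin r) : L.Dual V :=
  ⟨fun W => (hs.basis W.2).coord k, fun W W' h x => hs.res_coord W.2 h k x⟩

theorem IsFrame.val_dual (hs : L.IsFrame V s) {W : Opens X} (hW : W ≤ V) (k : Fin r) :
    (hs.dual k).val hW = (hs.basis hW).coord k := rfl

theorem Dual.val_smul {W : Opens X} (hW : W ≤ V) (f : Fn X V) (ξ : L.Dual V) :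
    (f • ξ).val hW = resFn K hW f • ξ.val hW := rfl

theorem Dual.val_sum {ι : Type*} (t : Finset ι) {W : Opens X} (hW : W ≤ V) (ξ : ι → L.Dual V) :
    (∑ i ∈ t, ξ i).val hW = ∑ i ∈ t, (ξ i).val hW :=
  map_sum (AddMonoidHom.mk' (fun ξ : L.Dual V => ξ.val hW) fun _ _ => rfl) ξ t

theorem IsFrame.eq_sum_dual (hs : L.IsFrame V s) (ξ : L.Dual V) :
    ξ = ∑ k, ξ.val le_rfl (hs.basis le_rfl k) • hs.dual k := by
  refine Dual.ext fun W hW => (hs.basis hW).ext fun i => ?_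
  rw [Dual.val_sum, LinearMap.sum_apply, Finset.sum_eq_single i]
  · rw [Dual.val_smul, LinearMap.smul_apply, hs.val_dual, Module.Basis.coord_apply,
      Module.Basis.repr_self, Finsupp.single_eq_same, smul_eq_mul, mul_one, Dual.res_val,
      hs.res_basis]
  · intro k _ hk
    rw [Dual.val_smul, LinearMap.smul_apply, hs.val_dual, Module.Basis.coord_apply,
      Module.Basis.repr_self, Finsupp.single_eq_of_ne hk, smul_zero]
  · exact fun h => absurd (Finset.mem_univ i) h

theorem eval_val_dualToSymHat (ξ : L.Dual V) {W : Opens X} (hW : W ≤ V) (P : L.abelian.Univ W) :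
    Jets.eval (Jet.val hW (L.dualToSymHat V ξ)) P = ξ.val hW (L.ofAbelian W (degOne K _ _ P)) := rfl

/-- For zero bracket and anchor the dual jets can be taken to be the linear coordinates, which come
from `Sym(L^∨)`. The results on monomials in dual jets thus speak about this polynomial subalgebra.
-/
theorem IsFrame.isDual_dual (hs : L.IsFrame V s) : IsDual (hs.abelian.basis (le_refl V))
    fun k => Jet.val le_rfl (L.dualToSymHat V (hs.dual k)) := by
  refine ⟨fun k => ?_, fun k i => ?_⟩
  · rw [eval_val_dualToSymHat, degOne_one, map_zero, map_zero]
  · rw [eval_val_dualToSymHat, degOne_ofL, hs.val_dual]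
    have : L.ofAbelian V (hs.abelian.basis (le_refl V) i) = hs.basis le_rfl i := by
      rw [hs.abelian.basis_apply, hs.basis_apply]; rfl
    rw [this, Module.Basis.coord_apply, Module.Basis.repr_self, Finsupp.single_apply]

/-- When the enveloping algebra is commutative, left and right multiplication by `R` agree and the
two module structures on jets coincide. -/
theorem smul_eq_alpha₁_mul {R M : Type*} [CommRing R] [Algebra K R] [LieRing M] [LieAlgebra K M]
    [Module R M] [LieRingModule M R] [LieRinehartRing R M] [LieRinehartAlgebra K R M]
    [IsAbelian R M] (f : R) (φ : Jets K R M) : f • φ = Jets.α₁ K R M f * φ := by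
  ext D
  rw [Jets.eval_smulR, Env.mul_comm_of_isAbelian, ← Env.smul_def, map_smul, Jets.eval_alpha₁_mul,
    smul_eq_mul]

variable (L V) in
/-- The filtration of the completed symmetric algebra by the order of vanishing. -/
noncomputable def symFilt (n : ℕ) : Ideal (L.SymHat V) :=
  (Jets.vanishing K (Fn X V) (L.abelian.Sec V) n).comap (Jet.val (le_refl V))

theorem mem_symFilt {n : ℕ} {φ : L.SymHat V} :
    φ ∈ L.symFilt V n ↔ Jets.Vanish n (Jet.val (le_refl V) φ) := Iff.rfl

theorem symToSymHat_ι (ξ : L.Dual V) :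
    L.symToSymHat V (SymmetricAlgebra.ι _ _ ξ) = L.dualToSymHat V ξ :=
  SymmetricAlgebra.lift_ι_apply _ _

theorem symToSymHat_mem_symFilt {n : ℕ} {x : SymmetricAlgebra (Fn X V) (L.Dual V)}
    (hx : x ∈ L.augIdeal V ^ n) : L.symToSymHat V x ∈ L.symFilt V n := by
  have h1 : L.augIdeal V ≤ (L.symFilt V 1).comap (L.symToSymHat V) := by
    refine Ideal.span_le.2 ?_
    rintro _ ⟨ξ, rfl⟩
    change L.symToSymHat V (SymmetricAlgebra.ι _ _ ξ) ∈ L.symFilt V 1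
    rw [symToSymHat_ι, mem_symFilt]
    refine Jets.vanish_one ?_
    rw [eval_val_dualToSymHat, degOne_one, map_zero, map_zero]
  suffices h : L.augIdeal V ^ n ≤ (L.symFilt V n).comap (L.symToSymHat V) from h hx
  induction n generalizing x with
  | zero => exact fun x _ => Jets.vanish_zero _
  | succ n ih =>
    rw [pow_succ, Ideal.mul_le]
    intro a ha b hb
    rw [Ideal.mem_comap, map_mul, mem_symFilt, map_mul]
    exact Jets.Vanish.mul (ih ha ha) (h1 hb)

theorem exists_sub_algebraMap_mem (x : SymmetricAlgebra (Fn X V) (L.Dual V)) :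
    ∃ c, x - algebraMap (Fn X V) _ c ∈ L.augIdeal V := by
  induction x using SymmetricAlgebra.induction with
  | algebraMap c => exact ⟨c, by rw [sub_self]; exact zero_mem _⟩
  | ι ξ => exact ⟨0, by rw [map_zero, sub_zero]; exact Ideal.subset_span ⟨ξ, rfl⟩⟩
  | mul a b ha hb =>
    obtain ⟨c, hc⟩ := ha
    obtain ⟨d, hd⟩ := hb
    refine ⟨c * d, ?_⟩
    have : a * b - algebraMap (Fn X V) _ (c * d) = (a - algebraMap (Fn X V) _ c) * b +
        algebraMap (Fn X V) _ c * (b - algebraMap (Fn X V) _ d) := by rw [map_mul]; ring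
    rw [this]
    exact add_mem (Ideal.mul_mem_right _ _ hc) (Ideal.mul_mem_left _ _ hd)
  | add a b ha hb =>
    obtain ⟨c, hc⟩ := ha
    obtain ⟨d, hd⟩ := hb
    exact ⟨c + d, by rw [map_add, add_sub_add_comm]; exact add_mem hc hd⟩

theorem IsFrame.augIdeal_eq (hs : L.IsFrame V s) : L.augIdeal V = Ideal.span
    (Submodule.span (Fn X V) (Set.range fun k => SymmetricAlgebra.ι (Fn X V) (L.Dual V) (hs.dual k)) :
      Set (SymmetricAlgebra (Fn X V) (L.Dual V))) := by
  refine le_antisymm (Ideal.span_mono ?_) (Ideal.span_le.2 ?_)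
  · rintro _ ⟨ξ, rfl⟩
    rw [hs.eq_sum_dual ξ, map_sum]
    refine sum_mem fun k _ => ?_
    rw [map_smul]
    exact Submodule.smul_mem _ _ (Submodule.subset_span ⟨k, rfl⟩)
  · have : Submodule.span (Fn X V)
        (Set.range fun k => SymmetricAlgebra.ι (Fn X V) (L.Dual V) (hs.dual k)) ≤
        (L.augIdeal V).restrictScalars (Fn X V) := by
      refine Submodule.span_le.2 ?_
      rintro _ ⟨k, rfl⟩
      exact Ideal.subset_span ⟨_, rfl⟩
    exact this

theorem IsFrame.val_symToSymHat_sum (hs : L.IsFrame V s) {n : ℕ} (g : Sym (Fin r) n → Fn X V) :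
    Jet.val (le_refl V) (L.symToSymHat V (∑ b : Sym (Fin r) n, g b • ((b : Multiset (Fin r)).map
      fun k => SymmetricAlgebra.ι (Fn X V) (L.Dual V) (hs.dual k)).prod)) =
    ∑ b : Sym (Fin r) n, Jets.α₁ K _ _ (g b) *
      jetMon (fun k => Jet.val le_rfl (L.dualToSymHat V (hs.dual k))) b := by
  rw [map_sum, map_sum]
  refine Finset.sum_congr rfl fun b _ => ?_
  rw [map_smul, Jet.val_smulFn, resFn_self, smul_eq_alpha₁_mul, map_multiset_prod,
    map_multiset_prod, Multiset.map_map, Multiset.map_map, jetMon]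
  congr 3
  refine funext fun k => ?_
  rw [Function.comp_apply, Function.comp_apply, symToSymHat_ι]

/-- Modulo the next power, an element of the `n`-th power of the ideal is a form of degree `n` in
the dual frame. If its image vanishes to order `n + 1`, pairing with the ordered monomials of degree
`n` shows that all coefficients are zero. -/
theorem IsFrame.mem_augIdeal_pow (hs : L.IsFrame V s) (n : ℕ)
    (x : SymmetricAlgebra (Fn X V) (L.Dual V)) (hx : L.symToSymHat V x ∈ L.symFilt V n) :
    x ∈ L.augIdeal V ^ n := by
  induction n with
  | zero => rw [pow_zero, Ideal.one_eq_top]; trivial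
  | succ n ih =>
    have hxn := ih (Jets.Vanish.mono hx (Nat.le_succ n))
    obtain ⟨y, hy, hxy⟩ := exists_mem_pow_of_mem_pow exists_sub_algebraMap_mem hs.augIdeal_eq n x hxn
    obtain ⟨g, rfl⟩ := exists_eq_sum_of_mem_span_pow _ hy
    have h1 := sub_mem hx (symToSymHat_mem_symFilt hxy)
    rw [← map_sub, sub_sub_cancel, mem_symFilt, hs.val_symToSymHat_sum] at h1
    obtain ⟨c, hc, hpair⟩ := hs.isDual_dual.exists_pairing
    have hg : ∀ a, g a = 0 := fun a => by
      have h2 := h1.eval_eq_zero (mon_mem_filt (K := K) (R := Fn X V)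
        (hs.abelian.basis (le_refl V)) (b := a) (n := n + 1) (by rw [a.card_coe]; omega))
      rw [Jets.eval_sum, Finset.sum_eq_single a, Jets.eval_alpha₁_mul, hpair _ _ rfl, if_pos rfl] at h2
      · exact (isUnit_natCast K (hc a)).mul_left_eq_zero.1 h2
      · intro b _ hb
        rw [Jets.eval_alpha₁_mul, hpair _ _ (by rw [a.card_coe, b.card_coe]),
          if_neg (fun h => hb (Subtype.ext h.symm)), mul_zero]
      · exact fun h => absurd (Finset.mem_univ a) h
    simpa [hg] using hxy

/-- Taylor expansion: each degree is matched by a form in the dual frame. -/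
theorem IsFrame.exists_sub_symToSymHat_mem (hs : L.IsFrame V s) (n : ℕ) (φ : L.SymHat V) :
    ∃ x, φ - L.symToSymHat V x ∈ L.symFilt V n := by
  induction n with
  | zero => exact ⟨0, Jets.vanish_zero _⟩
  | succ n ih =>
    obtain ⟨x, hx⟩ := ih
    obtain ⟨g, hg⟩ := hs.isDual_dual.exists_approx (mem_symFilt.1 hx)
    refine ⟨x + ∑ b : Sym (Fin r) n, g b • ((b : Multiset (Fin r)).map
      fun k => SymmetricAlgebra.ι (Fn X V) (L.Dual V) (hs.dual k)).prod, ?_⟩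
    rw [mem_symFilt, map_add (L.symToSymHat V), ← sub_sub, map_sub (Jet.val (le_refl V)),
      hs.val_symToSymHat_sum]
    exact hg

/-- Over an open set with a frame, the completed symmetric algebra is the adic completion of the
symmetric algebra. -/
theorem IsFrame.exists_completion_equiv (hs : L.IsFrame V s) :
    ∃ c : AdicCompletion (L.augIdeal V) (SymmetricAlgebra (Fn X V) (L.Dual V)) ≃+* L.SymHat V,
      ∀ P, c (AdicCompletion.of _ _ P) = L.symToSymHat V P := by
  refine exists_adicCompletion_equiv (L.augIdeal V) (L.symFilt V) (L.symToSymHat V).toRingHom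
    (fun m n h φ hφ => Jets.Vanish.mono hφ h)
    (fun n x => ⟨symToSymHat_mem_symFilt, hs.mem_augIdeal_pow n x⟩)
    hs.exists_sub_symToSymHat_mem (fun φ hφ => hs.abelian.val_injective ?_) (fun φ hφ => ?_)
  · rw [map_zero]
    exact Jets.eq_zero_of_vanish hφ
  · obtain ⟨ψ, hψ⟩ := hs.isDual_dual.exists_limit (fun n => Jet.val (le_refl V) (φ n)) fun n => by
      have := hφ n
      rwa [mem_symFilt, map_sub] at this
    obtain ⟨ψ, rfl⟩ := hs.abelian.val_surjective ψ
    exact ⟨ψ, fun n => by rw [mem_symFilt, map_sub]; exact hψ n⟩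

end LieAlgebroid

end Completion

end LieRinehart

/-! ### The Weyl relations and the theorem -/

namespace LieRinehart

namespace Smash

variable {K R L A : Type*} [CommRing K] [CommRing R] [Algebra K R] [LieRing L] [Module R L]
  [LieRingModule L R] [CommRing A] [Algebra K A] [Algebra R A] [Module (Env K R L) A]
  [IsScalarTower K R A] [EnvAlgebra K R L A]

theorem tmul_one_mul (a b : A) (D : Env K R L) : tmul a (1 : Env K R L) * tmul b D = tmul (a * b) D := by
  change a • tensorAct (1 : Env K R L) (b ⊗ₜ[R] D) = _
  rw [map_one]
  rfl

theorem one_tmul_mul (D E : Env K R L) : tmul (1 : A) D * tmul 1 E = tmul 1 (D * E) := by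
  change (1 : A) • tensorAct D ((1 : A) ⊗ₜ[R] E) = _
  rw [one_smul, tensorAct_tmul_left _ ofL_smul_one]
  rfl

theorem one_tmul_ofL_mul (x : L) (a : A) :
    tmul (1 : A) (Env.ofL K R L x) * tmul a 1 =
      tmul (Env.ofL K R L x • a) 1 + tmul a (Env.ofL K R L x) := by
  change (1 : A) • tensorAct (Env.ofL K R L x) (a ⊗ₜ[R] (1 : Env K R L)) = _
  rw [one_smul, tensorAct_ofL, smul_eq_mul, mul_one]
  rfl

end Smash

namespace LieAlgebroid

variable {K : Type u} [Field K] [CharZero K] {X : RingedSpace.{u, u}} [SpaceOver K X]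
  {L : LieAlgebroid K X} {V : Opens X}

variable (L V) in
/-- The canonical map from sections of the presheaf to sections of the sheaf. -/
noncomputable def toSheafJU :
    Smash K (Fn X V) (L.Sec V) (L.Jet V) →ₐ[K] L.sheafJU.obj (op V) :=
  ((toSheafify (Opens.grothendieckTopology X) L.presheafJU).app (op V)).hom

theorem toSheafJU_tmul (φ : L.Jet V) (D : L.Univ V) :
    L.toSheafJU V (Smash.tmul φ D) = L.tmul φ D := rfl

/-- The degree-one part of `x P` is `ε(P) x`, so contracting a linear form with `x` leaves the
constant `ξ(x)`. -/
theorem ofL_smul_dualToSymHat (x : L.abelian.Sec V) (ξ : L.Dual V) :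
    Env.ofL K (Fn X V) _ x • L.dualToSymHat V ξ =
      Jet.α₁ L.abelian V (ξ.val le_rfl (L.ofAbelian V x)) := by
  refine Jet.ext fun W hW => Jets.ext fun P => ?_
  rw [Jet.val_smul, Env.map_ofL, Jets.eval_smul, Env.mul_comm_of_isAbelian, eval_val_dualToSymHat,
    degOne_ofL_mul, counit_eq]
  change _ = Jets.eval (Jets.α₁ K _ _ (resFn K hW _)) P
  rw [Jets.α₁_apply, map_smul, map_smul, smul_eq_mul, mul_comm, Dual.res_val]
  rfl

theorem commute_tmul_one (φ ψ : L.Jet V) : Commute (L.tmul φ 1) (L.tmul ψ 1) := by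
  refine Commute.map (x := Smash.tmul φ 1) (y := Smash.tmul ψ 1) ?_ (L.toSheafJU V)
  rw [commute_iff_eq, Smash.tmul_one_mul, Smash.tmul_one_mul, mul_comm]

theorem commute_one_tmul (P Q : L.abelian.Univ V) :
    Commute (L.abelian.tmul 1 P) (L.abelian.tmul 1 Q) := by
  refine Commute.map (x := Smash.tmul 1 P) (y := Smash.tmul 1 Q) ?_ (L.abelian.toSheafJU V)
  rw [commute_iff_eq, Smash.one_tmul_mul, Smash.one_tmul_mul, Env.mul_comm_of_isAbelian]

/-- As `x` is primitive, `(1 ⊗ x)(φ ⊗ 1) = xφ ⊗ 1 + φ ⊗ x`; the last term is the product in the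
other order. -/
theorem tmul_ofL_bracket (x : L.Sec V) (φ : L.Jet V) :
    L.tmul 1 (Env.ofL K _ _ x) * L.tmul φ 1 - L.tmul φ 1 * L.tmul 1 (Env.ofL K _ _ x) =
      L.tmul (Env.ofL K (Fn X V) _ x • φ) 1 := by
  simp only [← toSheafJU_tmul]
  rw [← map_mul, ← map_mul, ← map_sub, Smash.one_tmul_ofL_mul, Smash.tmul_one_mul, mul_one,
    add_sub_cancel_right]

end LieAlgebroid

end LieRinehart

theorem mainTheorem6 {K : Type u} [Field K] [CharZero K] (X : LocallyRingedSpace.{u})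
    [SpaceOver K X.toSheafedSpace] (L : LieAlgebroid K X.toSheafedSpace) (r : ℕ)
    (hL : L.IsLocallyFreeOfRank r) (nab : L.Connection) :
    (∀ (U : Opens X.toSheafedSpace), ∀ x ∈ U, ∃ V : Opens X.toSheafedSpace, x ∈ V ∧ V ≤ U ∧
      ∃ c : AdicCompletion (L.augIdeal V) (SymmetricAlgebra (Fn X.toSheafedSpace V) (L.Dual V)) ≃+*
          L.SymHat V,
        ∀ P, c (AdicCompletion.of _ _ P) = L.symToSymHat V P) ∧
    ∃ j : L.jetSheaf ≅ L.abelian.jetSheaf,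
      (∀ (V W : Opens X.toSheafedSpace) (h : W ≤ V) (φ : L.Jet V) (l : List (L.abelian.Sec W)),
        Jets.eval (LieAlgebroid.Jet.val h ((j.hom.app (op V)).hom φ : L.SymHat V))
            (l.map (Env.ofL K _ _)).prod =
          pbwValue (L.ofAbelian W) (nab.onSections W) (LieAlgebroid.Jet.val h φ) l) ∧
      (∀ (V : Opens X.toSheafedSpace) (f : Fn X.toSheafedSpace V),
        (j.hom.app (op V)).hom (LieAlgebroid.Jet.α₁ L V f) =
          LieAlgebroid.Jet.α₁ L.abelian V f) ∧
      (∃ e : L.sheafJU ≅ L.abelian.diffSheaf,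
        ∀ (V W : Opens X.toSheafedSpace) (h : W ≤ V) (φ : L.Jet V) (D : L.Univ V) (ψ : L.Jet W),
          LieAlgebroid.Diff.val h ((e.hom.app (op V)).hom (L.tmul φ D) : L.abelian.Diff V)
              ((j.hom.app (op W)).hom ψ : L.SymHat W) =
            (j.hom.app (op W)).hom
              (LieAlgebroid.Jet.res h φ * (Env.map (L.res h) D • ψ) : L.Jet W)) ∧
      (∃ w : L.abelian.sheafJU ≅ L.abelian.diffSheaf,
        ∀ (V W : Opens X.toSheafedSpace) (h : W ≤ V) (α : L.SymHat V) (P : L.abelian.Univ V)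
          (β : L.SymHat W),
          LieAlgebroid.Diff.val h ((w.hom.app (op V)).hom (L.abelian.tmul α P) : L.abelian.Diff V) β =
            LieAlgebroid.Jet.res h α * (Env.map (L.abelian.res h) P • β)) ∧
      (∀ (V : Opens X.toSheafedSpace) (ξ η : L.Dual V) (x y : L.abelian.Sec V),
        Commute (L.abelian.tmul (L.dualToSymHat V ξ) 1) (L.abelian.tmul (L.dualToSymHat V η) 1) ∧
        Commute (L.abelian.tmul 1 (Env.ofL K _ _ x)) (L.abelian.tmul 1 (Env.ofL K _ _ y)) ∧
        L.abelian.tmul 1 (Env.ofL K _ _ x) * L.abelian.tmul (L.dualToSymHat V ξ) 1 -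
            L.abelian.tmul (L.dualToSymHat V ξ) 1 * L.abelian.tmul 1 (Env.ofL K _ _ x) =
          L.abelian.tmul (LieAlgebroid.Jet.α₁ L.abelian V (ξ.val le_rfl (L.ofAbelian V x))) 1) := by
  refine ⟨fun U x hx => ?_, LieAlgebroid.expIso nab hL, fun V W h φ l => ?_,
    fun V f => LieAlgebroid.expSec_alpha₁ nab f,
    -- Operators on `J(L)` linear over `α₁` are carried by conjugation with `j_∇` to `𝒪_X`-linear
    -- operators on `Ŝym(L^∨)`, since `j_∇` respects `α₁`.
    ⟨LieAlgebroid.actIso hL ≪≫ LieAlgebroid.Diff.conjIso (LieAlgebroid.expEquiv nab hL)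
      (fun h φ => LieAlgebroid.res_expSec nab h φ) (fun V f => LieAlgebroid.expSec_alpha₁ nab f),
      fun V W h φ D ψ => ?_⟩,
    -- The Weyl algebra is `J ⊗ U` for zero bracket and anchor, so the same isomorphism applies
    -- without conjugation.
    ⟨LieAlgebroid.actIso hL.abelian, fun V W h α P β =>
      LieAlgebroid.val_actIso_tmul hL.abelian h α P β⟩,
    fun V ξ η x y => ⟨LieAlgebroid.commute_tmul_one _ _, LieAlgebroid.commute_one_tmul _ _, ?_⟩⟩
  · obtain ⟨V, hxV, hVU, s, hs⟩ := hL.exists_isFrame hx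
    exact ⟨V, hxV, hVU, hs.exists_completion_equiv⟩
  · rw [LieAlgebroid.expIso_hom_app, LieAlgebroid.val_expSec, expHom_apply]
    exact eval_expJet_eq_pbwValue _ _ _ _
  · refine congrArg (LieAlgebroid.expEquiv nab hL W)
      (Eq.trans ?_ (LieAlgebroid.val_actIso_tmul hL h φ D ψ))
    exact congrArg _ ((LieAlgebroid.expEquiv nab hL W).symm_apply_apply ψ)
  · rw [LieAlgebroid.tmul_ofL_bracket, LieAlgebroid.ofL_smul_dualToSymHat]
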